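/- Let $R$ be a Dedekind domain with $\operatorname{char}(R)\neq 3$ and fraction field $K$, and let $\mathfrak a$ be a nonzero fractional ideal of $R$. A quadratic ring over $R$ is a commutative $R$-algebra $S$ that is a finitely generated torsion-free $R$-module of rank $2$; put $L=S\otimes_R K$. It is nondegenerate if its discriminant is nonzero. An $\mathfrak a$-orientation of $S$ is an isomorphism of $R$-modules $\pi\colon\bigwedge^2 S\to\mathfrak a$; let $\pi_K\colon\bigwedge^2 L\to K$ be its $K$-linear extension. The discriminant of the oriented ring $(S,\pi)$ is the determinant of the trace pairing of $L/K$ in any basis $1,\xi$ with $S=R+\mathfrak a\xi$ and $\pi_K(1\wedge\xi)=1$ (an element of $\mathfrak a^{-2}$). A fractional ideal of $S$ is a finitely generated $S$-submodule of $L$ spanning $L$ over $K$; it is invertible if its product with some fractional ideal is $S$. An $\mathfrak a$-balanced quadruple $(S,I,\delta,s)$ consists of a nondegenerate $\mathfrak a$-oriented quadratic ring $S$, a fractional ideal $I$ of $S$, an element $\delta\in L^\times$ and an element $s\in K^\times$ such that $I^3\subset\delta S$, the module index $[S:I]_R$ is $sR$, and $s^3=N_{L/K}(\delta)$. Quadruples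 $(S,I,\delta,s)$ and $(S',I',\delta',s')$ are equivalent, written $\sim$, if there are an isomorphism $\phi\colon S\to S'$ of $R$-algebras compatible with the orientations and an element $\kappa\in S'\otimes_RK$ with $I'=\kappa\phi(I)$, $\delta'=\kappa^3\phi(\delta)$ and $s'=N(\kappa)s$. Let $V_{\mathfrak a}$ be the set of forms $f=ax^3+3bx^2y+3cxy^2+dy^3$ with $a\in\mathfrak a$, $b\in R$, $c\in\mathfrak a^{-1}$, $d\in\mathfrak a^{-2}$, let $\operatorname{disc}(f)=-3b^2c^2+4ac^3+4b^3d+a^2d^2-6abcd$, and let $V_{\mathfrak a}^{\mathrm{nd}}$ be the set of $f\in V_{\mathfrak a}$ with $\operatorname{disc}(f)\ne0$. The group $\mathrm{SL}(R\oplus\mathfrak a)$ of matrices $\begin{pmatrix}r&t\\u&v\end{pmatrix}$ of determinant $1$ with $r,v\in R$, $t\in\mathfrak a$, $u\in\mathfrak a^{-1}$ acts on these sets by $(g\cdot f)(x,y)=f((x,y)g)$. A form $f\in V_{\mathfrak a}$ is projective if no prime ideal $\mathfrak p$ of $R$ contains all three of $(b^2-ac)R$, $(ad-bc)\mathfrak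 a$ and $(c^2-bd)\mathfrak a^2$. Theorem. For every $\mathfrak a$-balanced quadruple $(S,I,\delta,s)$ there are $\alpha,\beta\in L$ with $I=R\alpha+\mathfrak a\beta$ and $\pi_K(\alpha\wedge\beta)=s$. For every such choice, the form $$C(x,y)=\pi_K\bigl(1\wedge(\alpha x+\beta y)^3\delta^{-1}\bigr),$$ that is, the form $\zeta\mapsto\pi(1\wedge\zeta^3\delta^{-1})$ on $I$, whose coefficients $(a,3b,3c,d)$ are given by $a=\pi_K(1\wedge\alpha^3\delta^{-1})$, $b=\pi_K(1\wedge\alpha^2\beta\delta^{-1})$, $c=\pi_K(1\wedge\alpha\beta^2\delta^{-1})$, $d=\pi_K(1\wedge\beta^3\delta^{-1})$, lies in $V_{\mathfrak a}^{\mathrm{nd}}$, and its $\mathrm{SL}(R\oplus\mathfrak a)$-orbit depends only on the equivalence class of $(S,I,\delta,s)$. The resulting map $$\Phi_{\mathfrak a}\colon\{\mathfrak a\text{-balanced quadruples }(S,I,\delta,s)\}/{\sim}\;\longrightarrow\;\mathrm{SL}(R\oplus\mathfrak a)\backslash V_{\mathfrak a}^{\mathrm{nd}}$$ is a bijection. It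 preserves discriminants: if $\Phi_{\mathfrak a}$ sends the class of $(S,I,\delta,s)$ to the orbit of $f$, then the discriminant of the oriented ring $S$ is $\operatorname{disc}(f)$. Moreover, in this case $I$ is invertible if and only if $f$ is projective. -/

import Mathlib

open scoped TensorProduct nonZeroDivisors Pointwise

universe u

noncomputable section

namespace CubicParam

/-! ### Lattices, localizations and the module index -/

section Lattices

variable {R : Type*} [CommRing R]

/-- The localization `M_(𝔭)`, taken inside the ambient module `V`:
all `v` with `r v ∈ M` for some `r ∉ 𝔭`. -/
def locAt (𝔭 : Ideal R) [h𝔭 : 𝔭.IsPrime] {V : Type*} [AddCommGroup V] [Module R V]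
    (M : Submodule R V) : Submodule R V where
  carrier := {v | ∃ r : R, r ∉ 𝔭 ∧ r • v ∈ M}
  zero_mem' := ⟨1, (Ideal.ne_top_iff_one 𝔭).1 h𝔭.ne_top, by simp⟩
  add_mem' := by
    rintro v w ⟨r, hr, hv⟩ ⟨t, ht, hw⟩
    refine ⟨r * t, fun h => (h𝔭.mem_or_mem h).elim hr ht, ?_⟩
    rw [smul_add]
    refine M.add_mem ?_ ?_
    · rw [mul_comm, mul_smul]; exact M.smul_mem _ hv
    · rw [mul_smul]; exact M.smul_mem _ hw
  smul_mem' := by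
    rintro c v ⟨r, hr, hv⟩
    exact ⟨r, hr, by rw [smul_comm]; exact M.smul_mem _ hv⟩

variable (K : Type*) [Field K] [Algebra R K]
  {V : Type*} [AddCommGroup V] [Module R V] [Module K V] [IsScalarTower R K V]

/-- The local index `[M_(𝔭) : N_(𝔭)] = det(φ) R_(𝔭)`, where `φ : V ≃ V` is any `K`-linear
automorphism with `φ(M_(𝔭)) = N_(𝔭)`. For lattices of full rank over a Dedekind domain such `φ`
exist and `det(φ) R_(𝔭)` does not depend on `φ`, so that the supremum is over equal submodules. -/
def localIndex (𝔭 : Ideal R) [𝔭.IsPrime] (M N : Submodule R V) : Submodule R K :=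
  ⨆ (φ : V ≃ₗ[K] V)
    (_ : (locAt 𝔭 M).map ((φ : V →ₗ[K] V).restrictScalars R) = locAt 𝔭 N),
    (locAt 𝔭 (1 : Submodule R K)).map
      (LinearMap.mulLeft R (LinearMap.det (φ : V →ₗ[K] V)))

/-- The module index `[M : N]_R`: the intersection in `K` of all local indices. -/
def moduleIndex (M N : Submodule R V) : Submodule R K :=
  ⨅ (𝔭 : Ideal R) (_ : 𝔭.IsPrime), localIndex K 𝔭 M N

variable {K}

/-- The submodule `R α + 𝔞 β` of `V`. -/
def decomp (𝔞 : FractionalIdeal R⁰ K) (α β : V) : Submodule R V :=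
  Submodule.span R {α} ⊔
    (𝔞 : Submodule R K).map ((LinearMap.toSpanSingleton K V β).restrictScalars R)

end Lattices

/-! ### Oriented quadratic rings -/

section Quadratic

variable (R K : Type u) [CommRing R] [Field K] [Algebra R K]

/-- A quadratic ring over `R` (a commutative `R`-algebra that is a finitely generated
torsion-free `R`-module of rank `2`) with an `𝔞`-orientation `Λ²S ≃ 𝔞`. -/
structure OrientedQuadraticRing (𝔞 : FractionalIdeal R⁰ K) : Type (u + 1) where
  /-- the underlying ring -/
  S : Type u
  [commRing : CommRing S]
  [algebra : Algebra R S]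
  [finite : Module.Finite R S]
  [torsionFree : Module.IsTorsionFree R S]
  rank_eq_two : Module.finrank K (K ⊗[R] S) = 2
  /-- the orientation -/
  orientation : ⋀[R]^2 S ≃ₗ[R] (𝔞 : Submodule R K)

attribute [instance] OrientedQuadraticRing.commRing OrientedQuadraticRing.algebra
  OrientedQuadraticRing.finite OrientedQuadraticRing.torsionFree

variable {R K}
variable {𝔞 : FractionalIdeal R⁰ K}

namespace OrientedQuadraticRing

variable (A : OrientedQuadraticRing R K 𝔞)

/-- The ambient `K`-algebra `L = K ⊗ S`. -/
abbrev L : Type u := K ⊗[R] A.S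

/-- `S` as an `R`-lattice in `L`. -/
def lattice : Submodule R A.L :=
  LinearMap.range (Algebra.TensorProduct.includeRight : A.S →ₐ[R] A.L).toLinearMap

/-- The bilinear map `(x, y) ↦ π(x ∧ y)` on `S`, with values in `K`. -/
def wedge : A.S →ₗ[R] A.S →ₗ[R] K :=
  LinearMap.mk₂ R
    (fun x y => ((A.orientation (exteriorPower.ιMulti R 2 ![x, y]) : (𝔞 : Submodule R K)) : K))
    (fun x x' y => by
      have h := (exteriorPower.ιMulti R 2 (M := A.S)).map_update_add ![x, y] 0 x x'
      have e : ∀ z, Function.update ![x, y] 0 z = ![z, y] := by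
        intro z; ext i; fin_cases i <;> simp
      simp only [e] at h
      simp [h])
    (fun c x y => by
      have h := (exteriorPower.ιMulti R 2 (M := A.S)).map_update_smul ![x, y] 0 c x
      have e : ∀ z, Function.update ![x, y] 0 z = ![z, y] := by
        intro z; ext i; fin_cases i <;> simp
      simp only [e] at h
      simp [h])
    (fun x y y' => by
      have h := (exteriorPower.ιMulti R 2 (M := A.S)).map_update_add ![x, y] 1 y y'
      have e : ∀ z, Function.update ![x, y] 1 z = ![x, z] := by
        intro z; ext i; fin_cases i <;> simp
      simp only [e] at h
      simp [h])
    (fun c x y => by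
      have h := (exteriorPower.ιMulti R 2 (M := A.S)).map_update_smul ![x, y] 1 c y
      have e : ∀ z, Function.update ![x, y] 1 z = ![x, z] := by
        intro z; ext i; fin_cases i <;> simp
      simp only [e] at h
      simp [h])

theorem wedge_apply (x y : A.S) :
    A.wedge x y = ((A.orientation (exteriorPower.ιMulti R 2 ![x, y]) : (𝔞 : Submodule R K)) : K) :=
  rfl

/-- The `K`-bilinear extension `(α, β) ↦ π_K(α ∧ β)` to `L`. -/
def wedgeK : A.L →ₗ[K] A.L →ₗ[K] K :=
  LinearMap.liftBaseChange K
    (((LinearMap.liftBaseChangeEquiv (R := R) (M := A.S) (N := K) K).toLinearMap.restrictScalars R)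
      ∘ₗ A.wedge)

theorem wedgeK_tmul (k k' : K) (x y : A.S) :
    A.wedgeK (k ⊗ₜ x) (k' ⊗ₜ y) = k * k' * A.wedge x y := by
  simp [wedgeK, mul_assoc]

/-- The discriminant of `S` is nonzero, that is, the trace pairing of `L` is nondegenerate. -/
def IsNondegenerate : Prop := (Algebra.traceForm K A.L).Nondegenerate

/-- `1, ξ` is a basis specified by the orientation: `S = R + 𝔞 ξ` and `π_K(1 ∧ ξ) = 1`. -/
def IsOrientedGenerator (ξ : A.L) : Prop :=
  A.lattice = decomp 𝔞 (1 : A.L) ξ ∧ A.wedgeK 1 ξ = 1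

/-- The discriminant of the oriented ring is `Δ`: this is the determinant of the trace pairing
in a basis `1, ξ` specified by the orientation. -/
def HasDiscr (Δ : K) : Prop :=
  (∃ ξ : A.L, A.IsOrientedGenerator ξ) ∧
    ∀ ξ : A.L, A.IsOrientedGenerator ξ → Algebra.discr K ![(1 : A.L), ξ] = Δ

/-- A fractional ideal of `S`: a finitely generated `S`-submodule of `L` spanning `L` over `K`.
As `S` is finite over `R`, finite generation over `S` and over `R` agree. -/
structure IsFractionalIdeal (I : Submodule R A.L) : Prop where
  mul_mem : ∀ (a : A.S) (x : A.L), x ∈ I → ((1 : K) ⊗ₜ[R] a) * x ∈ I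
  fg : I.FG
  span_eq_top : Submodule.span K (I : Set A.L) = ⊤

/-- `I` is an invertible fractional ideal of `S`. -/
def IsInvertible (I : Submodule R A.L) : Prop :=
  A.IsFractionalIdeal I ∧ ∃ J : Submodule R A.L, A.IsFractionalIdeal J ∧ I * J = A.lattice

end OrientedQuadraticRing

/-- The submodule `κ I`. -/
def scale {L : Type*} [CommRing L] [Algebra R L] (κ : L) (I : Submodule R L) : Submodule R L :=
  I.map (LinearMap.mulLeft R κ)

/-- The `K`-linear extension `K ⊗ S ≃ K ⊗ S'` of an isomorphism `S ≃ S'`. -/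
def extend {S S' : Type u} [CommRing S] [Algebra R S] [CommRing S'] [Algebra R S']
    (φ : S ≃ₐ[R] S') : (K ⊗[R] S) ≃ₐ[K] (K ⊗[R] S') :=
  Algebra.TensorProduct.congr AlgEquiv.refl φ

variable (R K) in
/-- An `𝔞`-balanced quadruple `(S, I, δ, s)`. -/
structure BalancedQuadruple (𝔞 : FractionalIdeal R⁰ K) : Type (u + 1)
    extends OrientedQuadraticRing R K 𝔞 where
  nondegenerate : toOrientedQuadraticRing.IsNondegenerate
  /-- the fractional ideal -/
  I : Submodule R toOrientedQuadraticRing.L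
  isFractionalIdeal : toOrientedQuadraticRing.IsFractionalIdeal I
  /-- the element `δ` -/
  δ : (toOrientedQuadraticRing.L)ˣ
  /-- the element `s` -/
  s : Kˣ
  cube_le : I ^ 3 ≤ scale (δ : toOrientedQuadraticRing.L) toOrientedQuadraticRing.lattice
  index_eq : moduleIndex K toOrientedQuadraticRing.lattice I = Submodule.span R {(s : K)}
  cube_eq_norm : (s : K) ^ 3 = Algebra.norm K (δ : toOrientedQuadraticRing.L)

namespace BalancedQuadruple

/-- Equivalence of balanced quadruples: an isomorphism `φ : S ≃ S'` of oriented rings and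
`κ ∈ L'` with `I' = κ φ(I)`, `δ' = κ³ φ(δ)` and `s' = N(κ) s`. -/
def Equivalent (Q Q' : BalancedQuadruple R K 𝔞) : Prop :=
  ∃ (φ : Q.S ≃ₐ[R] Q'.S) (κ : Q'.L),
    (∀ x y : Q.S, Q'.wedge (φ x) (φ y) = Q.wedge x y) ∧
    Q'.I = scale κ (Q.I.map ((extend φ : Q.L ≃ₐ[K] Q'.L).toLinearMap.restrictScalars R)) ∧
    (Q'.δ : Q'.L) = κ ^ 3 * (extend φ : Q.L ≃ₐ[K] Q'.L) (Q.δ : Q.L) ∧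
    (Q'.s : K) = Algebra.norm K κ * (Q.s : K)

theorem extend_symm_apply {S S' : Type u} [CommRing S] [Algebra R S] [CommRing S'] [Algebra R S']
    (φ : S ≃ₐ[R] S') (x : K ⊗[R] S') :
    (extend φ.symm : (K ⊗[R] S') ≃ₐ[K] (K ⊗[R] S)) x = (extend φ).symm x := rfl

theorem extend_refl_apply {S : Type u} [CommRing S] [Algebra R S] (x : K ⊗[R] S) :
    (extend AlgEquiv.refl : (K ⊗[R] S) ≃ₐ[K] (K ⊗[R] S)) x = x := by
  simp [extend]

theorem extend_trans_apply {S S' S'' : Type u} [CommRing S] [Algebra R S] [CommRing S']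
    [Algebra R S'] [CommRing S''] [Algebra R S''] (φ : S ≃ₐ[R] S') (ψ : S' ≃ₐ[R] S'')
    (x : K ⊗[R] S) :
    (extend (φ.trans ψ) : (K ⊗[R] S) ≃ₐ[K] (K ⊗[R] S'')) x =
      (extend ψ : (K ⊗[R] S') ≃ₐ[K] (K ⊗[R] S'')) ((extend φ : (K ⊗[R] S) ≃ₐ[K] (K ⊗[R] S')) x) := by
  induction x with
  | zero => simp
  | tmul k a => simp [extend]
  | add x y hx hy => simp only [map_add, hx, hy]

theorem mem_scale_map {S S' : Type u} [CommRing S] [Algebra R S] [CommRing S'] [Algebra R S']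
    (φ : S ≃ₐ[R] S') (κ : K ⊗[R] S') (I : Submodule R (K ⊗[R] S)) (x : K ⊗[R] S') :
    x ∈ scale κ (I.map ((extend φ : (K ⊗[R] S) ≃ₐ[K] (K ⊗[R] S')).toLinearMap.restrictScalars R)) ↔
      ∃ y ∈ I, κ * (extend φ : (K ⊗[R] S) ≃ₐ[K] (K ⊗[R] S')) y = x := by
  simp [scale]

theorem Equivalent.refl (Q : BalancedQuadruple R K 𝔞) : Q.Equivalent Q := by
  refine ⟨AlgEquiv.refl, 1, fun _ _ => rfl, ?_, ?_, ?_⟩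
  · ext x
    rw [mem_scale_map]
    simp [extend_refl_apply]
  · simp [extend_refl_apply]
  · simp

theorem Equivalent.symm {Q Q' : BalancedQuadruple R K 𝔞} (h : Q.Equivalent Q') :
    Q'.Equivalent Q := by
  obtain ⟨φ, κ, hw, hI, hδ, hs⟩ := h
  have hκ : IsUnit κ := by
    have h1 : IsUnit (κ ^ 3 * (extend φ : Q.L ≃ₐ[K] Q'.L) (Q.δ : Q.L)) := hδ ▸ Q'.δ.isUnit
    exact (isUnit_pow_iff three_ne_zero).1 (isUnit_of_mul_isUnit_left h1)
  obtain ⟨k, rfl⟩ := hκ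
  refine ⟨φ.symm, (extend φ : Q.L ≃ₐ[K] Q'.L).symm (↑k⁻¹ : Q'.L), fun x y => ?_, ?_, ?_, ?_⟩
  · rw [← hw]; simp
  · ext x
    rw [mem_scale_map, hI]
    simp only [mem_scale_map, extend_symm_apply]
    constructor
    · intro hx
      exact ⟨_, ⟨x, hx, rfl⟩, by rw [← map_mul]; simp⟩
    · rintro ⟨_, ⟨y, hy, rfl⟩, rfl⟩
      rw [← map_mul]; simpa using hy
  · rw [extend_symm_apply, ← map_pow, ← map_mul, hδ, ← mul_assoc, ← mul_pow]; simp
  · have hn : Algebra.norm K ((extend φ : Q.L ≃ₐ[K] Q'.L).symm (↑k⁻¹ : Q'.L)) =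
        Algebra.norm K (↑k⁻¹ : Q'.L) :=
      Algebra.norm_eq_of_algEquiv (extend φ : Q.L ≃ₐ[K] Q'.L).symm _
    rw [hn, hs, ← mul_assoc, ← map_mul]; simp

theorem Equivalent.trans {Q Q' Q'' : BalancedQuadruple R K 𝔞} (h : Q.Equivalent Q')
    (h' : Q'.Equivalent Q'') : Q.Equivalent Q'' := by
  obtain ⟨φ, κ, hw, hI, hδ, hs⟩ := h
  obtain ⟨ψ, κ', hw', hI', hδ', hs'⟩ := h'
  refine ⟨φ.trans ψ, κ' * (extend ψ : Q'.L ≃ₐ[K] Q''.L) κ, fun x y => ?_, ?_, ?_, ?_⟩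
  · rw [← hw, ← hw']; rfl
  · ext x
    rw [hI', mem_scale_map, mem_scale_map, hI]
    simp only [mem_scale_map]
    constructor
    · rintro ⟨_, ⟨y, hy, rfl⟩, rfl⟩
      exact ⟨y, hy, by rw [extend_trans_apply, map_mul, mul_assoc]⟩
    · rintro ⟨y, hy, rfl⟩
      exact ⟨_, ⟨y, hy, rfl⟩, by rw [extend_trans_apply, map_mul, mul_assoc]⟩
  · rw [hδ', hδ, extend_trans_apply, map_mul, map_pow]; ring
  · have hn : Algebra.norm K ((extend ψ : Q'.L ≃ₐ[K] Q''.L) κ) = Algebra.norm K κ :=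
      Algebra.norm_eq_of_algEquiv (extend ψ : Q'.L ≃ₐ[K] Q''.L) _
    rw [hs', hs, map_mul, hn]; ring

variable (R K) in
/-- Equivalence of `𝔞`-balanced quadruples as a setoid. -/
def setoid (𝔞 : FractionalIdeal R⁰ K) : Setoid (BalancedQuadruple R K 𝔞) where
  r := Equivalent
  iseqv := ⟨Equivalent.refl, Equivalent.symm, Equivalent.trans⟩

end BalancedQuadruple
end Quadratic

/-! ### Binary cubic forms -/

section Forms

/-- The binary cubic form `a x³ + 3b x²y + 3c xy² + d y³`, given by `(a, b, c, d)`
(when `3` is invertible in `K`, these coefficients are determined by the polynomial). -/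
@[ext]
structure CubicForm (K : Type*) where
  /-- coefficient of `x³` -/
  a : K
  /-- a third of the coefficient of `x²y` -/
  b : K
  /-- a third of the coefficient of `xy²` -/
  c : K
  /-- coefficient of `y³` -/
  d : K

namespace CubicForm

variable {K : Type*} [Field K]

/-- The value `f(x, y)` in a `K`-algebra. -/
def eval (f : CubicForm K) {B : Type*} [CommRing B] [Algebra K B] (x y : B) : B :=
  algebraMap K B f.a * x ^ 3 + 3 * algebraMap K B f.b * x ^ 2 * y
    + 3 * algebraMap K B f.c * x * y ^ 2 + algebraMap K B f.d * y ^ 3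

/-- The reduced discriminant, `-1/27` times the polynomial discriminant. -/
def disc (f : CubicForm K) : K :=
  -3 * f.b ^ 2 * f.c ^ 2 + 4 * f.a * f.c ^ 3 + 4 * f.b ^ 3 * f.d + f.a ^ 2 * f.d ^ 2
    - 6 * f.a * f.b * f.c * f.d

/-- The action `(g • f)(x, y) = f((x, y) g)` of `SL₂(K)`, in coordinates
(see `eval_smul`). -/
instance : SMul (Matrix.SpecialLinearGroup (Fin 2) K) (CubicForm K) where
  smul g f :=
    { a := f.a * g 0 0 ^ 3 + 3 * f.b * g 0 0 ^ 2 * g 0 1 + 3 * f.c * g 0 0 * g 0 1 ^ 2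
        + f.d * g 0 1 ^ 3
      b := f.a * g 0 0 ^ 2 * g 1 0 + f.b * (g 0 0 ^ 2 * g 1 1 + 2 * g 0 0 * g 0 1 * g 1 0)
        + f.c * (g 0 1 ^ 2 * g 1 0 + 2 * g 0 0 * g 0 1 * g 1 1) + f.d * g 0 1 ^ 2 * g 1 1
      c := f.a * g 0 0 * g 1 0 ^ 2 + f.b * (g 1 0 ^ 2 * g 0 1 + 2 * g 0 0 * g 1 0 * g 1 1)
        + f.c * (g 0 0 * g 1 1 ^ 2 + 2 * g 0 1 * g 1 0 * g 1 1) + f.d * g 0 1 * g 1 1 ^ 2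
      d := f.a * g 1 0 ^ 3 + 3 * f.b * g 1 0 ^ 2 * g 1 1 + 3 * f.c * g 1 0 * g 1 1 ^ 2
        + f.d * g 1 1 ^ 3 }

theorem smul_def (g : Matrix.SpecialLinearGroup (Fin 2) K) (f : CubicForm K) :
    g • f =
    { a := f.a * g 0 0 ^ 3 + 3 * f.b * g 0 0 ^ 2 * g 0 1 + 3 * f.c * g 0 0 * g 0 1 ^ 2
        + f.d * g 0 1 ^ 3
      b := f.a * g 0 0 ^ 2 * g 1 0 + f.b * (g 0 0 ^ 2 * g 1 1 + 2 * g 0 0 * g 0 1 * g 1 0)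
        + f.c * (g 0 1 ^ 2 * g 1 0 + 2 * g 0 0 * g 0 1 * g 1 1) + f.d * g 0 1 ^ 2 * g 1 1
      c := f.a * g 0 0 * g 1 0 ^ 2 + f.b * (g 1 0 ^ 2 * g 0 1 + 2 * g 0 0 * g 1 0 * g 1 1)
        + f.c * (g 0 0 * g 1 1 ^ 2 + 2 * g 0 1 * g 1 0 * g 1 1) + f.d * g 0 1 * g 1 1 ^ 2
      d := f.a * g 1 0 ^ 3 + 3 * f.b * g 1 0 ^ 2 * g 1 1 + 3 * f.c * g 1 0 * g 1 1 ^ 2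
        + f.d * g 1 1 ^ 3 } := rfl

theorem eval_smul (g : Matrix.SpecialLinearGroup (Fin 2) K) (f : CubicForm K)
    {B : Type*} [CommRing B] [Algebra K B] (x y : B) :
    (g • f).eval x y =
      f.eval (x * algebraMap K B (g 0 0) + y * algebraMap K B (g 1 0))
        (x * algebraMap K B (g 0 1) + y * algebraMap K B (g 1 1)) := by
  simp only [smul_def, eval, map_add, map_mul, map_pow, map_ofNat]
  ring

instance : MulAction (Matrix.SpecialLinearGroup (Fin 2) K) (CubicForm K) where
  one_smul f := by
    ext <;> simp [smul_def]
  mul_smul g h f := by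
    ext <;> simp only [smul_def, Matrix.SpecialLinearGroup.coe_mul, Matrix.mul_apply,
      Fin.sum_univ_two] <;> ring

variable {R : Type*} [CommRing R] [Algebra R K]

/-- Membership in `V_𝔞`: `a ∈ 𝔞`, `b ∈ R`, `c ∈ 𝔞⁻¹`, `d ∈ 𝔞⁻²`. -/
def IsOfType [IsDomain R] [IsFractionRing R K] (𝔞 : FractionalIdeal R⁰ K) (f : CubicForm K) :
    Prop :=
  f.a ∈ 𝔞 ∧ f.b ∈ (1 : FractionalIdeal R⁰ K) ∧ f.c ∈ 𝔞⁻¹ ∧ f.d ∈ 𝔞⁻¹ ^ 2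

/-- `f ∈ V_𝔞` is projective if its Hessian is primitive: no prime `𝔭` of `R` divides (contains)
all three of `(b² - ac) R`, `(ad - bc) 𝔞` and `(c² - bd) 𝔞²`. -/
def IsProjective [IsFractionRing R K] (𝔞 : FractionalIdeal R⁰ K) (f : CubicForm K) : Prop :=
  ∀ 𝔭 : Ideal R, 𝔭.IsPrime →
    ¬ (FractionalIdeal.spanSingleton R⁰ (f.b ^ 2 - f.a * f.c) ≤ (𝔭 : FractionalIdeal R⁰ K) ∧
      FractionalIdeal.spanSingleton R⁰ (f.a * f.d - f.b * f.c) * 𝔞 ≤ (𝔭 : FractionalIdeal R⁰ K) ∧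
      FractionalIdeal.spanSingleton R⁰ (f.c ^ 2 - f.b * f.d) * 𝔞 ^ 2 ≤
        (𝔭 : FractionalIdeal R⁰ K))

end CubicForm

variable {R K : Type*} [CommRing R] [IsDedekindDomain R] [Field K] [Algebra R K] [IsFractionRing R K]

/-- `SL(R ⊕ 𝔞)`: matrices of determinant `1` with diagonal entries in `R`, upper right entry
in `𝔞` and lower left entry in `𝔞⁻¹`. -/
def SLa (𝔞 : FractionalIdeal R⁰ K) :
    Subgroup (Matrix.SpecialLinearGroup (Fin 2) K) where
  carrier := {g | g 0 0 ∈ (1 : FractionalIdeal R⁰ K) ∧ g 0 1 ∈ 𝔞 ∧ g 1 0 ∈ 𝔞⁻¹ ∧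
    g 1 1 ∈ (1 : FractionalIdeal R⁰ K)}
  one_mem' := by
    refine ⟨?_, ?_, ?_, ?_⟩ <;> simp [FractionalIdeal.zero_mem]
  mul_mem' := by
    rintro g h ⟨g1, g2, g3, g4⟩ ⟨h1, h2, h3, h4⟩
    have key : 𝔞 * 𝔞⁻¹ ≤ 1 := by
      by_cases h0 : 𝔞 = 0
      · simp [h0]
      · exact (mul_inv_cancel₀ h0).le
    have hm : ∀ {I J M : FractionalIdeal R⁰ K} {x y : K}, I * J ≤ M → x ∈ I → y ∈ J → x * y ∈ M :=
      fun hle hx hy => hle (FractionalIdeal.mul_mem_mul hx hy)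
    have ha : ∀ {I : FractionalIdeal R⁰ K} {x y : K}, x ∈ I → y ∈ I → x + y ∈ I :=
      fun {I} _ _ hx hy => Submodule.add_mem (I : Submodule R K) hx hy
    refine ⟨?_, ?_, ?_, ?_⟩ <;>
      simp only [Matrix.SpecialLinearGroup.coe_mul, Matrix.mul_apply, Fin.sum_univ_two]
    · exact ha (hm (by simp) g1 h1) (hm key g2 h3)
    · exact ha (hm (by simp) g1 h2) (hm (by simp) g2 h4)
    · exact ha (hm (by simp) g3 h1) (hm (by simp) g4 h3)
    · exact ha (hm (mul_comm 𝔞 _ ▸ key) g3 h2) (hm (by simp) g4 h4)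
  inv_mem' := by
    rintro g ⟨g1, g2, g3, g4⟩
    have hn : ∀ {I : FractionalIdeal R⁰ K} {x : K}, x ∈ I → -x ∈ I :=
      fun {I} _ hx => Submodule.neg_mem (I : Submodule R K) hx
    refine ⟨?_, ?_, ?_, ?_⟩ <;>
      simp only [Matrix.SpecialLinearGroup.coe_inv, Matrix.adjugate_fin_two]
    · simpa using g4
    · simpa using hn g2
    · simpa using hn g3
    · simpa using g1

/-- The nondegenerate forms in `V_𝔞`, those with nonzero discriminant. -/
def NondegForm (𝔞 : FractionalIdeal R⁰ K) : Type _ :=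
  {f : CubicForm K // f.IsOfType 𝔞 ∧ f.disc ≠ 0}

/-- Two nondegenerate forms in `V_𝔞` are related if they are in the same `SL(R ⊕ 𝔞)`-orbit. -/
def orbitSetoid (𝔞 : FractionalIdeal R⁰ K) : Setoid (NondegForm 𝔞) :=
  (MulAction.orbitRel (SLa 𝔞) (CubicForm K)).comap Subtype.val

end Forms

/-! ### The form of a balanced quadruple -/

section Phi

variable {R K : Type u} [CommRing R] [Field K] [Algebra R K] {𝔞 : FractionalIdeal R⁰ K}

namespace BalancedQuadruple

variable (Q : BalancedQuadruple R K 𝔞)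

/-- `I = R α + 𝔞 β` with `π_K(α ∧ β) = s` (this forces `α, β` to be independent over `K`). -/
def IsBasis (α β : Q.L) : Prop :=
  Q.I = decomp 𝔞 α β ∧ Q.wedgeK α β = Q.s

/-- The form `π_K(1 ∧ (α x + β y)³ δ⁻¹)`, i.e. `ζ ↦ π(1 ∧ ζ³ δ⁻¹)` on `I = R α + 𝔞 β`. -/
def form (α β : Q.L) : CubicForm K where
  a := Q.wedgeK 1 (α ^ 3 * (↑Q.δ⁻¹ : Q.L))
  b := Q.wedgeK 1 (α ^ 2 * β * (↑Q.δ⁻¹ : Q.L))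
  c := Q.wedgeK 1 (α * β ^ 2 * (↑Q.δ⁻¹ : Q.L))
  d := Q.wedgeK 1 (β ^ 3 * (↑Q.δ⁻¹ : Q.L))

theorem eval_form (α β : Q.L) (x y : K) :
    (Q.form α β).eval x y = Q.wedgeK 1 ((x • α + y • β) ^ 3 * (↑Q.δ⁻¹ : Q.L)) := by
  have h : (x • α + y • β) ^ 3 * (↑Q.δ⁻¹ : Q.L) =
      x ^ 3 • (α ^ 3 * (↑Q.δ⁻¹ : Q.L)) + (3 * x ^ 2 * y) • (α ^ 2 * β * (↑Q.δ⁻¹ : Q.L))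
      + (3 * x * y ^ 2) • (α * β ^ 2 * (↑Q.δ⁻¹ : Q.L)) + y ^ 3 • (β ^ 3 * (↑Q.δ⁻¹ : Q.L)) := by
    simp only [Algebra.smul_def, map_mul, map_pow, map_ofNat]
    ring
  rw [h]
  simp only [map_add, map_smul, smul_eq_mul, CubicForm.eval, form, Algebra.algebraMap_self,
    RingHom.id_apply]
  ring

end BalancedQuadruple
end Phi
end CubicParam

end

/-! Everything takes place in coordinates. An oriented quadratic ring has a chart: `L = K[ω]` with
`ω² = p + qω`, `S = R + 𝔞ω`, the wedge product being the determinant in the basis `1, ω`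
(`exists_chart`). With `ι = δ⁻¹`, the form of a quadruple becomes `ζ ↦ im (ζ³ ι)` on `I = Rα + 𝔞β`.

The key is the Hessian `h₀x² + h₁xy + h₂y²` of this form. An identity in quadratic algebras
(`imForm_hess₀` and its companions) together with `s³ = N(δ)` shows that it equals `s⁻¹ N(αx + βy)`.
Hence `τ = s⁻¹ᾱβ` has trace `h₁` and norm `h₀h₂`. It differs from `ω` by a constant `k` with `k𝔞 ⊆
R`, so it may serve as the generator: `τ² = -h₀h₂ + h₁τ`, and the discriminant of `S` is that of the
Hessian, which is `disc f`. Moreover `τα = h₀β` and `τβ = h₁β - h₂α`. So the form determines the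
oriented ring and the matrix of `τ` on `α, β` (`IsBasis.exists_chart`).

Injectivity: two bases with the same matrix of `τ` differ by a factor `κ` (`exists_mul_eq`), and the
form then determines `ι` (`imForm_injective`). Surjectivity: the ring, the module and the would-be
products `α³ι, α²βι, αβ²ι, β³ι` are written down from `f`, and `ι` is recovered from these products
(`exists_isRealization`). That the orbit is well defined comes down to the fact that two bases of
`I` with the same wedge `s` differ by an element of `SL(R ⊕ 𝔞)`. Existence of such bases rests on
Steinitz' structure of rank-two lattices and the computation of the module index
(`exists_eq_decomp`, `moduleIndex_decomp`).

Invertibility: put `T = s⁻¹ I Ī`. Its elements have imaginary part in `𝔞`, it contains `𝔞τ`, and its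
real part is generated by `h₀`, `𝔞h₁`, `𝔞²h₂`. If `f` is projective then `T = S`. If a prime `𝔭`
contains all three, then `T² ⊆ 𝔭T`, which is impossible for invertible `I`. -/

noncomputable section

namespace CubicParam

/-! ### Membership calculus for fractional ideals of a Dedekind domain. -/

section FractionalIdeals

variable {R K : Type*} [CommRing R] [Field K] [Algebra R K]

theorem mem_add {I : FractionalIdeal R⁰ K} {x y : K} (hx : x ∈ I) (hy : y ∈ I) : x + y ∈ I :=
  Submodule.add_mem (I : Submodule R K) hx hy

theorem mem_sub {I : FractionalIdeal R⁰ K} {x y : K} (hx : x ∈ I) (hy : y ∈ I) : x - y ∈ I :=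
  Submodule.sub_mem (I : Submodule R K) hx hy

theorem mem_neg {I : FractionalIdeal R⁰ K} {x : K} (hx : x ∈ I) : -x ∈ I :=
  Submodule.neg_mem (I : Submodule R K) hx

theorem mem_smul {I : FractionalIdeal R⁰ K} (r : R) {x : K} (hx : x ∈ I) :
    algebraMap R K r * x ∈ I := by
  rw [← Algebra.smul_def]
  exact Submodule.smul_mem (I : Submodule R K) r hx

theorem mul_mem_of_le {I J M : FractionalIdeal R⁰ K} {x y : K} (h : I * J ≤ M) (hx : x ∈ I)
    (hy : y ∈ J) : x * y ∈ M :=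
  h (FractionalIdeal.mul_mem_mul hx hy)

theorem one_mul_mem {I : FractionalIdeal R⁰ K} {x y : K} (hx : x ∈ (1 : FractionalIdeal R⁰ K))
    (hy : y ∈ I) : x * y ∈ I :=
  mul_mem_of_le (one_mul I).le hx hy

theorem mul_one_mem {I : FractionalIdeal R⁰ K} {x y : K} (hx : x ∈ I)
    (hy : y ∈ (1 : FractionalIdeal R⁰ K)) : x * y ∈ I :=
  mul_mem_of_le (mul_one I).le hx hy

theorem algebraMap_mem_one (r : R) : algebraMap R K r ∈ (1 : FractionalIdeal R⁰ K) :=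
  (FractionalIdeal.mem_one_iff R⁰).2 ⟨r, rfl⟩

theorem one_mem_one : (1 : K) ∈ (1 : FractionalIdeal R⁰ K) := by
  simpa using algebraMap_mem_one (R := R) (K := K) 1

variable [IsDedekindDomain R] [IsFractionRing R K]

theorem mul_inv_mem {I : FractionalIdeal R⁰ K} {x y : K} (hx : x ∈ I) (hy : y ∈ I⁻¹) :
    x * y ∈ (1 : FractionalIdeal R⁰ K) := by
  by_cases h0 : I = 0
  · subst h0
    rw [FractionalIdeal.mem_zero_iff] at hx
    rw [hx, zero_mul]
    exact FractionalIdeal.zero_mem 1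
  · exact mul_mem_of_le (mul_inv_cancel₀ h0).le hx hy

theorem mem_of_forall_mul_mem {I M N : FractionalIdeal R⁰ K} (hI : I ≠ 0) (hM : I * N = M) {x : K}
    (h : ∀ t ∈ I, t * x ∈ M) : x ∈ N := by
  have h1 : FractionalIdeal.spanSingleton R⁰ x * I ≤ M := by
    rw [FractionalIdeal.spanSingleton_mul_le_iff]
    intro t ht
    rw [mul_comm]
    exact h t ht
  have h2 : FractionalIdeal.spanSingleton R⁰ x * I * I⁻¹ ≤ M * I⁻¹ := by gcongr
  rw [mul_assoc, mul_inv_cancel₀ hI, mul_one, ← hM, mul_comm I, mul_assoc, mul_inv_cancel₀ hI,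
    mul_one] at h2
  exact FractionalIdeal.spanSingleton_le_iff_mem.1 h2

theorem mem_inv_of_forall {I : FractionalIdeal R⁰ K} (hI : I ≠ 0) {x : K}
    (h : ∀ t ∈ I, t * x ∈ (1 : FractionalIdeal R⁰ K)) : x ∈ I⁻¹ :=
  mem_of_forall_mul_mem hI (mul_inv_cancel₀ hI) h

theorem mem_one_of_forall {I : FractionalIdeal R⁰ K} (hI : I ≠ 0) {x : K}
    (h : ∀ t ∈ I, t * x ∈ I) : x ∈ (1 : FractionalIdeal R⁰ K) :=
  mem_of_forall_mul_mem hI (mul_one I) h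

theorem mem_inv_sq_of_forall {I : FractionalIdeal R⁰ K} (hI : I ≠ 0) {x : K}
    (h : ∀ t ∈ I, ∀ t' ∈ I, t * t' * x ∈ (1 : FractionalIdeal R⁰ K)) : x ∈ I⁻¹ ^ 2 := by
  refine mem_of_forall_mul_mem (M := I⁻¹) hI ?_ fun t ht => mem_inv_of_forall hI fun t' ht' => ?_
  · rw [sq, ← mul_assoc, mul_inv_cancel₀ hI, one_mul]
  · rw [← mul_assoc]
    exact h t' ht' t ht

/-- For nonzero fractional ideals `𝔠`, `𝔡` there is a matrix of determinant one with a row in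
`(𝔠, 𝔡)` and the other row in `(𝔡⁻¹, 𝔠⁻¹)`. -/
theorem exists_det_one {𝔠 𝔡 : FractionalIdeal R⁰ K} (hc : 𝔠 ≠ 0) (hd : 𝔡 ≠ 0) :
    ∃ p ∈ 𝔠, ∃ q ∈ 𝔡, ∃ r ∈ 𝔡⁻¹, ∃ t ∈ 𝔠⁻¹, p * t - q * r = 1 := by
  obtain ⟨p, hp, hp0⟩ : ∃ p ∈ 𝔠, p ≠ 0 := by
    by_contra! h
    exact hc (FractionalIdeal.eq_zero_iff.2 h)
  have hle : FractionalIdeal.spanSingleton R⁰ p * 𝔠⁻¹ ≤ 1 := by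
    rw [← mul_inv_cancel₀ hc]
    gcongr
    exact FractionalIdeal.spanSingleton_le_iff_mem.2 hp
  -- As `p𝔠⁻¹` is a nonzero integral ideal, some multiple `q𝔡⁻¹` of `𝔡⁻¹` is comaximal with it.
  -- Expanding `1` in `p𝔠⁻¹ + q𝔡⁻¹ = R` supplies the second row of the matrix.
  obtain ⟨q, hq⟩ := IsDedekindDomain.exists_add_spanSingleton_mul_eq (K := K) hle
    (mul_ne_zero (by rwa [ne_eq, FractionalIdeal.spanSingleton_eq_zero_iff]) (inv_ne_zero hc))
    (inv_ne_zero hd)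
  have hq' : q ∈ 𝔡 := by
    have h1 : FractionalIdeal.spanSingleton R⁰ q * 𝔡⁻¹ ≤ 1 := by
      rw [← hq]
      exact le_add_of_nonneg_left bot_le
    have h2 : FractionalIdeal.spanSingleton R⁰ q * 𝔡⁻¹ * 𝔡 ≤ 1 * 𝔡 := by gcongr
    rw [mul_assoc, inv_mul_cancel₀ hd, mul_one, one_mul] at h2
    exact FractionalIdeal.spanSingleton_le_iff_mem.1 h2
  have h1 : (1 : K) ∈ FractionalIdeal.spanSingleton R⁰ p * 𝔠⁻¹ +
      FractionalIdeal.spanSingleton R⁰ q * 𝔡⁻¹ := by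
    rw [hq]; exact one_mem_one
  obtain ⟨x, hx, y, hy, hxy⟩ := (FractionalIdeal.mem_add _ _ _).1 h1
  obtain ⟨t, ht, rfl⟩ := FractionalIdeal.mem_singleton_mul.1 hx
  obtain ⟨r, hr, rfl⟩ := FractionalIdeal.mem_singleton_mul.1 hy
  exact ⟨p, hp, q, hq', -r, mem_neg hr, t, ht, by rw [← hxy]; ring⟩

end FractionalIdeals

/-! ### Lattices of rank two over a Dedekind domain. -/

section Decomp

variable {R K : Type*} [CommRing R] [Field K] [Algebra R K]
  {V : Type*} [AddCommGroup V] [Module R V] [Module K V] [IsScalarTower R K V]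

theorem mem_decomp {𝔞 : FractionalIdeal R⁰ K} {α β v : V} :
    v ∈ decomp 𝔞 α β ↔
      ∃ x ∈ (1 : FractionalIdeal R⁰ K), ∃ y ∈ 𝔞, v = x • α + y • β := by
  simp only [decomp, Submodule.mem_sup, Submodule.mem_span_singleton, Submodule.mem_map]
  constructor
  · rintro ⟨_, ⟨r, rfl⟩, _, ⟨y, hy, rfl⟩, rfl⟩
    exact ⟨algebraMap R K r, algebraMap_mem_one r, y, hy, by simp⟩
  · rintro ⟨x, hx, y, hy, rfl⟩
    obtain ⟨r, rfl⟩ := (FractionalIdeal.mem_one_iff R⁰).1 hx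
    exact ⟨_, ⟨r, rfl⟩, _, ⟨y, hy, rfl⟩, by simp⟩

theorem left_mem_decomp (𝔞 : FractionalIdeal R⁰ K) (α β : V) : α ∈ decomp 𝔞 α β :=
  mem_decomp.2 ⟨1, one_mem_one, 0, FractionalIdeal.zero_mem _, by simp⟩

theorem smul_right_mem_decomp {𝔞 : FractionalIdeal R⁰ K} (α β : V) {t : K} (ht : t ∈ 𝔞) :
    t • β ∈ decomp 𝔞 α β :=
  mem_decomp.2 ⟨0, FractionalIdeal.zero_mem _, t, ht, by simp⟩

theorem map_decomp {W : Type*} [AddCommGroup W] [Module R W] [Module K W] [IsScalarTower R K W]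
    (𝔞 : FractionalIdeal R⁰ K) (α β : V) (f : V →ₗ[K] W) :
    (decomp 𝔞 α β).map (f.restrictScalars R) = decomp 𝔞 (f α) (f β) := by
  ext w
  simp only [Submodule.mem_map, mem_decomp]
  constructor
  · rintro ⟨_, ⟨x, hx, y, hy, rfl⟩, rfl⟩
    exact ⟨x, hx, y, hy, by simp⟩
  · rintro ⟨x, hx, y, hy, rfl⟩
    exact ⟨_, ⟨x, hx, y, hy, rfl⟩, by simp⟩

theorem mem_decomp_basis {𝔞 : FractionalIdeal R⁰ K} (b : Module.Basis (Fin 2) K V) {v : V} :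
    v ∈ decomp 𝔞 (b 0) (b 1) ↔ b.repr v 0 ∈ (1 : FractionalIdeal R⁰ K) ∧ b.repr v 1 ∈ 𝔞 := by
  rw [mem_decomp]
  constructor
  · rintro ⟨x, hx, y, hy, rfl⟩
    have e0 : b.repr (x • b 0 + y • b 1) 0 = x := by simp
    have e1 : b.repr (x • b 0 + y • b 1) 1 = y := by simp
    rw [e0, e1]
    exact ⟨hx, hy⟩
  · rintro ⟨hx, hy⟩
    refine ⟨_, hx, _, hy, ?_⟩
    have := b.sum_repr v
    rw [Fin.sum_univ_two] at this
    exact this.symm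

theorem exists_smul_mem_of_mem_span [IsDomain R] [IsFractionRing R K] {M : Submodule R V} {v : V}
    (hv : v ∈ Submodule.span K (M : Set V)) : ∃ r : R, r ≠ 0 ∧ r • v ∈ M := by
  induction hv using Submodule.span_induction with
  | mem x hx => exact ⟨1, one_ne_zero, by simpa using hx⟩
  | zero => exact ⟨1, one_ne_zero, by simp⟩
  | add x y _ _ hx hy =>
    obtain ⟨r, hr, hx⟩ := hx
    obtain ⟨t, ht, hy⟩ := hy
    refine ⟨r * t, mul_ne_zero hr ht, ?_⟩
    rw [smul_add]
    refine M.add_mem ?_ ?_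
    · rw [mul_comm, mul_smul]; exact M.smul_mem _ hx
    · rw [mul_smul]; exact M.smul_mem _ hy
  | smul k x _ hx =>
    obtain ⟨r, hr, hx⟩ := hx
    obtain ⟨n, d, hd, rfl⟩ := IsFractionRing.div_surjective (A := R) k
    have hd0 : algebraMap R K d ≠ 0 := by simpa using nonZeroDivisors.ne_zero hd
    refine ⟨r * d, mul_ne_zero hr (nonZeroDivisors.ne_zero hd), ?_⟩
    have : (r * d) • (algebraMap R K n / algebraMap R K d) • x = n • r • x := by
      rw [← algebraMap_smul K (r * d), ← algebraMap_smul K n, ← algebraMap_smul K r x, smul_smul,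
        smul_smul, map_mul]
      congr 1
      field_simp
    rw [this]
    exact M.smul_mem _ hx

variable [IsDedekindDomain R] [IsFractionRing R K]

/-- The lattice `𝔠 γ + 𝔡 η` has the form `R α + 𝔠𝔡 β`. -/
theorem exists_decomp_mul {𝔠 𝔡 : FractionalIdeal R⁰ K} (hc : 𝔠 ≠ 0) (hd : 𝔡 ≠ 0) (γ η : V)
    {M : Submodule R V} (hM : ∀ v, v ∈ M ↔ ∃ x ∈ 𝔠, ∃ y ∈ 𝔡, v = x • γ + y • η) :
    ∃ α β : V, M = decomp (𝔠 * 𝔡) α β := by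
  obtain ⟨p, hp, q, hq, r, hr, t, ht, h1⟩ := exists_det_one hc hd
  refine ⟨p • γ + q • η, r • γ + t • η, ?_⟩
  ext v
  rw [hM, mem_decomp]
  constructor
  · rintro ⟨x, hx, y, hy, rfl⟩
    refine ⟨x * t - y * r, mem_sub (mul_inv_mem hx ht) (mul_inv_mem hy hr), y * p - x * q,
      mem_sub (mul_mem_of_le (mul_comm 𝔡 𝔠).le hy hp) (FractionalIdeal.mul_mem_mul hx hq), ?_⟩
    have e1 : x = (x * t - y * r) * p + (y * p - x * q) * r := by linear_combination (-x) * h1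
    have e2 : y = (x * t - y * r) * q + (y * p - x * q) * t := by linear_combination (-y) * h1
    conv_lhs => rw [e1, e2]
    module
  · rintro ⟨x, hx, y, hy, rfl⟩
    refine ⟨x * p + y * r, mem_add (one_mul_mem hx hp) (mul_mem_of_le ?_ hy hr), x * q + y * t,
      mem_add (one_mul_mem hx hq) (mul_mem_of_le ?_ hy ht), by module⟩
    · rw [mul_assoc, mul_inv_cancel₀ hd, mul_one]
    · rw [mul_comm 𝔠, mul_assoc, mul_inv_cancel₀ hc, mul_one]

/-- A lattice splits along a linear functional. -/
theorem exists_section {M : Submodule R V} {l : V →ₗ[K] K} {𝔡 : FractionalIdeal R⁰ K}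
    (hd : 𝔡 ≠ 0) (hM : M.map (l.restrictScalars R) = (𝔡 : Submodule R K)) :
    ∃ η : V, l η = 1 ∧ ∀ y ∈ 𝔡, y • η ∈ M := by
  obtain ⟨p, hp, q, hq, r, hr, t, ht, h1⟩ := exists_det_one hd hd
  have hl : ∀ y ∈ 𝔡, ∃ m ∈ M, l m = y := fun y hy => by
    have : y ∈ M.map (l.restrictScalars R) := hM ▸ hy
    simpa using this
  obtain ⟨m, hm, rfl⟩ := hl p hp
  obtain ⟨m', hm', rfl⟩ := hl q hq
  have hsm : ∀ {x : K}, x ∈ (1 : FractionalIdeal R⁰ K) → ∀ {v : V}, v ∈ M → x • v ∈ M := by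
    intro x hx v hv
    obtain ⟨c, rfl⟩ := (FractionalIdeal.mem_one_iff R⁰).1 hx
    rw [algebraMap_smul]
    exact M.smul_mem _ hv
  -- Here `m, m'` lie over `p, q ∈ 𝔡` with `pt - qr = 1` and `t, r ∈ 𝔡⁻¹`. Hence `yt, yr ∈ R` for `y
  -- ∈ 𝔡`, which keeps `y • η` in `M`.
  refine ⟨t • m - r • m', by simp only [map_sub, map_smul, smul_eq_mul]; linear_combination h1,
    fun y hy => ?_⟩
  rw [smul_sub, smul_smul, smul_smul]
  exact M.sub_mem (hsm (mul_inv_mem hy ht) hm) (hsm (mul_inv_mem hy hr) hm')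

/-- A lattice of rank two has the form `R α + 𝔟 β`. -/
theorem exists_eq_decomp (hV : Module.finrank K V = 2) {M : Submodule R V} (hM : M.FG)
    (hspan : Submodule.span K (M : Set V) = ⊤) :
    ∃ 𝔟 : FractionalIdeal R⁰ K, 𝔟 ≠ 0 ∧ ∃ α β : V, M = decomp 𝔟 α β := by
  have : Module.Finite K V := Module.finite_of_finrank_pos (by omega)
  let b := Module.finBasisOfFinrankEq K V hV
  let l : V →ₗ[K] K := b.coord 1
  let j : K →ₗ[K] V := LinearMap.toSpanSingleton K V (b 0)
  have hj : Function.Injective j := fun x y hxy => by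
    simpa [j, b.ne_zero 0] using hxy
  have hrep : ∀ v : V, v = b.repr v 0 • b 0 + b.repr v 1 • b 1 := fun v => by
    have := b.sum_repr v
    rw [Fin.sum_univ_two] at this
    exact this.symm
  have hker : ∀ v : V, l v = 0 → v = j (b.repr v 0) := fun v hv => by
    conv_lhs => rw [hrep v]
    have : b.repr v 1 = 0 := hv
    simp [j, this]
  -- The intersection of `M` with the line `K b₀` and its projection `𝔡` to the other coordinate.
  -- Splitting the projection gives `M = 𝔠 b₀ + 𝔡 η`, and `exists_decomp_mul` merges the two ideals.
  let 𝔠 : FractionalIdeal R⁰ K := ⟨M.comap (j.restrictScalars R), by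
    refine FractionalIdeal.isFractional_of_fg ?_
    have : IsNoetherian R M := isNoetherian_of_fg_of_noetherian M hM
    refine Submodule.fg_of_fg_map_injective (j.restrictScalars R) hj ?_
    exact Submodule.FG.of_le hM (Submodule.map_comap_le _ _)⟩
  let 𝔡 : FractionalIdeal R⁰ K := ⟨M.map (l.restrictScalars R),
    FractionalIdeal.isFractional_of_fg (hM.map _)⟩
  have hcm : ∀ x, x ∈ 𝔠 ↔ j x ∈ M := fun x => Iff.rfl
  have hdm : ∀ v ∈ M, l v ∈ 𝔡 := fun v hv => Submodule.mem_map_of_mem (f := l.restrictScalars R) hv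
  have hden : ∀ v : V, ∃ r : R, r ≠ 0 ∧ r • v ∈ M := fun v =>
    exists_smul_mem_of_mem_span (hspan ▸ Submodule.mem_top)
  have hne : ∀ {r : R}, r ≠ 0 → algebraMap R K r ≠ 0 := fun {r} hr => by simpa using hr
  have hc : 𝔠 ≠ 0 := by
    obtain ⟨r, hr, hrm⟩ := hden (b 0)
    intro h0
    have : algebraMap R K r ∈ 𝔠 := by rw [hcm]; simpa [j] using hrm
    rw [h0, FractionalIdeal.mem_zero_iff] at this
    exact hne hr this
  have hd : 𝔡 ≠ 0 := by
    obtain ⟨r, hr, hrm⟩ := hden (b 1)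
    intro h0
    have := hdm _ hrm
    rw [h0, FractionalIdeal.mem_zero_iff, ← algebraMap_smul K r] at this
    simp [l] at this
    exact hr this
  obtain ⟨η, hη, hηM⟩ := exists_section (l := l) (M := M) hd rfl
  refine ⟨𝔠 * 𝔡, mul_ne_zero hc hd, exists_decomp_mul hc hd (b 0) η fun v => ⟨fun hv => ?_, ?_⟩⟩
  · have h1 : l (v - l v • η) = 0 := by simp [hη]
    refine ⟨b.repr (v - l v • η) 0, ?_, l v, hdm v hv, ?_⟩
    · rw [hcm, ← hker _ h1]
      exact M.sub_mem hv (hηM _ (hdm v hv))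
    · have := hker _ h1
      rw [sub_eq_iff_eq_add] at this
      exact this
  · rintro ⟨x, hx, y, hy, rfl⟩
    exact M.add_mem hx (hηM y hy)

end Decomp

/-! ### Localization and the module index of two lattices. -/

section ModuleIndex

variable {R K : Type*} [CommRing R]

theorem mem_locAt {𝔭 : Ideal R} [𝔭.IsPrime] {V : Type*} [AddCommGroup V] [Module R V]
    {M : Submodule R V} {v : V} : v ∈ locAt 𝔭 M ↔ ∃ r : R, r ∉ 𝔭 ∧ r • v ∈ M := Iff.rfl

theorem le_locAt (𝔭 : Ideal R) [h𝔭 : 𝔭.IsPrime] {V : Type*} [AddCommGroup V] [Module R V]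
    (M : Submodule R V) : M ≤ locAt 𝔭 M := fun v hv =>
  ⟨1, (Ideal.ne_top_iff_one 𝔭).1 h𝔭.ne_top, by simpa using hv⟩

/-- If `v` lies in every localization, then the ideal of all `r` with `r • v ∈ M` lies in no maximal
ideal. -/
theorem iInf_locAt {V : Type*} [AddCommGroup V] [Module R V] (M : Submodule R V) :
    ⨅ (𝔭 : Ideal R) (_ : 𝔭.IsPrime), locAt 𝔭 M = M := by
  refine le_antisymm (fun v hv => ?_) (le_iInf₂ fun 𝔭 h𝔭 => le_locAt 𝔭 M)
  simp only [Submodule.mem_iInf] at hv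
  let J : Ideal R := M.comap (LinearMap.toSpanSingleton R V v)
  suffices J = ⊤ by simpa [J] using J.eq_top_iff_one.1 this
  by_contra hJ
  obtain ⟨𝔪, h𝔪, hle⟩ := J.exists_le_maximal hJ
  obtain ⟨r, hr, hrv⟩ := hv 𝔪 h𝔪.isPrime
  exact hr (hle (by simpa [J] using hrv))

variable [Field K] [Algebra R K]

theorem mem_one_submodule {x : K} :
    x ∈ (1 : Submodule R K) ↔ x ∈ (1 : FractionalIdeal R⁰ K) := by
  rw [← FractionalIdeal.coe_one (S := R⁰), FractionalIdeal.mem_coe]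

/-- The localization of the ring `R` at `𝔭` as a subring of `K`. -/
def locRing (𝔭 : Ideal R) [𝔭.IsPrime] (K : Type*) [Field K] [Algebra R K] : Submodule R K :=
  locAt 𝔭 (1 : Submodule R K)

theorem mem_locRing {𝔭 : Ideal R} [𝔭.IsPrime] {x : K} :
    x ∈ locRing 𝔭 K ↔ ∃ r : R, r ∉ 𝔭 ∧ algebraMap R K r * x ∈ (1 : FractionalIdeal R⁰ K) := by
  simp only [← Algebra.smul_def, locRing, mem_locAt, mem_one_submodule]

theorem mem_locRing_of_mul_mem {𝔭 : Ideal R} [𝔭.IsPrime] {x : K} {r : R} (hr : r ∉ 𝔭)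
    (h : algebraMap R K r * x ∈ (1 : FractionalIdeal R⁰ K)) : x ∈ locRing 𝔭 K :=
  mem_locRing.2 ⟨r, hr, h⟩

theorem locRing_mul {𝔭 : Ideal R} [h𝔭 : 𝔭.IsPrime] {x y : K} (hx : x ∈ locRing 𝔭 K)
    (hy : y ∈ locRing 𝔭 K) : x * y ∈ locRing 𝔭 K := by
  obtain ⟨r, hr, hx⟩ := mem_locRing.1 hx
  obtain ⟨t, ht, hy⟩ := mem_locRing.1 hy
  refine mem_locRing.2 ⟨r * t, fun h => (h𝔭.mem_or_mem h).elim hr ht, ?_⟩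
  have := one_mul_mem hx hy
  rwa [map_mul, mul_mul_mul_comm]

variable [IsDedekindDomain R] [IsFractionRing R K]

/-- `g` generates the fractional ideal `𝔞` at `𝔭`. -/
def IsLocalGenerator (𝔭 : Ideal R) (𝔞 : FractionalIdeal R⁰ K) (g : K) : Prop :=
  g ∈ 𝔞 ∧ g ≠ 0 ∧ ∃ r : R, r ∉ 𝔭 ∧ algebraMap R K r * g⁻¹ ∈ 𝔞⁻¹

/-- If no element of `𝔞` worked, all products of elements of `𝔞` and `𝔞⁻¹` would lie in `𝔭`, against
`𝔞𝔞⁻¹ = R`. -/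
theorem exists_isLocalGenerator (𝔭 : Ideal R) [h𝔭 : 𝔭.IsPrime] {𝔞 : FractionalIdeal R⁰ K}
    (h𝔞 : 𝔞 ≠ 0) : ∃ g, IsLocalGenerator 𝔭 𝔞 g := by
  by_contra! h
  have hle : 𝔞 * 𝔞⁻¹ ≤ (𝔭 : FractionalIdeal R⁰ K) := by
    rw [FractionalIdeal.mul_le]
    intro g hg g' hg'
    obtain ⟨r, hr⟩ := (FractionalIdeal.mem_one_iff R⁰).1 (mul_inv_mem hg hg')
    rw [← hr, FractionalIdeal.mem_coeIdeal]
    refine ⟨r, ?_, rfl⟩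
    by_contra hr𝔭
    have hr0 : algebraMap R K r ≠ 0 := by
      intro h0
      rw [map_eq_zero_iff _ (IsFractionRing.injective R K)] at h0
      exact hr𝔭 (h0 ▸ 𝔭.zero_mem)
    have hg0 : g ≠ 0 := fun h0 => hr0 (by rw [hr, h0, zero_mul])
    refine h g ⟨hg, hg0, r, hr𝔭, ?_⟩
    rw [hr]
    convert! hg' using 1
    field_simp
  rw [mul_inv_cancel₀ h𝔞, ← FractionalIdeal.coeIdeal_top, FractionalIdeal.coeIdeal_le_coeIdeal]
    at hle
  exact h𝔭.ne_top (top_le_iff.1 hle)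

theorem IsLocalGenerator.mem_locAt_iff {𝔭 : Ideal R} [h𝔭 : 𝔭.IsPrime] {𝔞 : FractionalIdeal R⁰ K}
    {g : K} (hg : IsLocalGenerator 𝔭 𝔞 g) {x : K} :
    x ∈ locAt 𝔭 (𝔞 : Submodule R K) ↔ ∃ o ∈ locRing 𝔭 K, x = g * o := by
  obtain ⟨hg, hg0, r, hr, hg'⟩ := hg
  constructor
  · rintro ⟨t, ht, hx⟩
    refine ⟨g⁻¹ * x, mem_locRing.2 ⟨r * t, fun h => (h𝔭.mem_or_mem h).elim hr ht, ?_⟩,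
      by field_simp⟩
    have := mul_inv_mem (I := 𝔞) hx hg'
    rw [Algebra.smul_def] at this
    rw [map_mul]
    convert! this using 1
    ring
  · rintro ⟨o, ho, rfl⟩
    obtain ⟨t, ht, ho⟩ := mem_locRing.1 ho
    refine ⟨t, ht, ?_⟩
    have := mul_one_mem hg ho
    rw [Algebra.smul_def]
    convert! this using 1
    ring

theorem IsLocalGenerator.div {𝔭 : Ideal R} [h𝔭 : 𝔭.IsPrime] {𝔞 𝔟 : FractionalIdeal R⁰ K}
    {g h k : K} (hg : IsLocalGenerator 𝔭 𝔞 g) (hh : IsLocalGenerator 𝔭 𝔟 h) (hk : k ≠ 0) {x : K} :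
    x ∈ locAt 𝔭 ((FractionalIdeal.spanSingleton R⁰ k * 𝔟 * 𝔞⁻¹ : FractionalIdeal R⁰ K) :
      Submodule R K) ↔ ∃ o ∈ locRing 𝔭 K, x = k * h * g⁻¹ * o := by
  obtain ⟨hg, hg0, r, hr, hg'⟩ := hg
  obtain ⟨hh, hh0, t, ht, hh'⟩ := hh
  have hr0 : algebraMap R K r ≠ 0 := by
    intro h0
    rw [map_eq_zero_iff _ (IsFractionRing.injective R K)] at h0
    exact hr (h0 ▸ 𝔭.zero_mem)
  -- The element `g⁻¹` need not lie in `𝔞⁻¹`, but `r g⁻¹` does. The extra factor `r ∉ 𝔭` is a unit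
  -- at `𝔭` and is removed below.
  have key : IsLocalGenerator 𝔭 (FractionalIdeal.spanSingleton R⁰ k * 𝔟 * 𝔞⁻¹)
      (k * h * (algebraMap R K r * g⁻¹)) := by
    refine ⟨FractionalIdeal.mul_mem_mul (FractionalIdeal.mul_mem_mul
      (FractionalIdeal.mem_spanSingleton_self _ _) hh) hg',
      mul_ne_zero (mul_ne_zero hk hh0) (mul_ne_zero hr0 (inv_ne_zero hg0)), r * t,
      fun h => (h𝔭.mem_or_mem h).elim hr ht, ?_⟩
    have := FractionalIdeal.mul_mem_mul (FractionalIdeal.mul_mem_mul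
      (FractionalIdeal.mem_spanSingleton_self R⁰ k⁻¹) hh') hg
    rw [mul_inv, mul_inv, inv_inv, FractionalIdeal.spanSingleton_inv]
    convert! this using 1
    rw [map_mul]
    field_simp
  rw [key.mem_locAt_iff]
  constructor
  · rintro ⟨o, ho, rfl⟩
    exact ⟨algebraMap R K r * o,
      locRing_mul (le_locAt 𝔭 _ (mem_one_submodule.2 (algebraMap_mem_one r))) ho, by ring⟩
  · rintro ⟨o, ho, rfl⟩
    refine ⟨(algebraMap R K r)⁻¹ * o, locRing_mul (mem_locRing_of_mul_mem hr ?_) ho, ?_⟩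
    · rw [mul_inv_cancel₀ hr0]
      exact one_mem_one
    · field_simp

variable {V : Type*} [AddCommGroup V] [Module R V] [Module K V] [IsScalarTower R K V]

theorem mem_locAt_decomp {𝔭 : Ideal R} [h𝔭 : 𝔭.IsPrime] {𝔞 : FractionalIdeal R⁰ K} {g : K}
    (hg : IsLocalGenerator 𝔭 𝔞 g) (b : Module.Basis (Fin 2) K V) {v : V} :
    v ∈ locAt 𝔭 (decomp 𝔞 (b 0) (b 1)) ↔
      b.repr v 0 ∈ locRing 𝔭 K ∧ ∃ o ∈ locRing 𝔭 K, b.repr v 1 = g * o := by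
  rw [← hg.mem_locAt_iff, mem_locRing, mem_locAt, mem_locAt]
  have hsm : ∀ (r : R) (i : Fin 2), b.repr (r • v) i = algebraMap R K r * b.repr v i := by
    intro r i
    rw [← algebraMap_smul K r v, map_smul, Finsupp.smul_apply, smul_eq_mul]
  simp only [mem_decomp_basis, hsm, Algebra.smul_def]
  constructor
  · rintro ⟨r, hr, h0, h1⟩
    exact ⟨⟨r, hr, h0⟩, r, hr, h1⟩
  · rintro ⟨⟨r, hr, h0⟩, t, ht, h1⟩
    refine ⟨t * r, fun h => (h𝔭.mem_or_mem h).elim ht hr, ?_, ?_⟩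
    · rw [map_mul, mul_assoc]
      exact mem_smul t h0
    · rw [map_mul, mul_comm (algebraMap R K t), mul_assoc]
      exact mem_smul r h1

theorem det_fin_two_eq (b b' : Module.Basis (Fin 2) K V) :
    b.det b' = b.repr (b' 0) 0 * b.repr (b' 1) 1 - b.repr (b' 1) 0 * b.repr (b' 0) 1 := by
  simp [Module.Basis.det_apply, Matrix.det_fin_two, Module.Basis.toMatrix_apply]

/-- At `𝔭` the lattices become free with bases `b₀, g b₁` and `b'₀, h b'₁`, where `g, h` generate
`𝔞, 𝔟` locally. An automorphism matching them has determinant `h g⁻¹ det_b(b')` up to a factor that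
is integral at `𝔭`, and the obvious one attains this value exactly. -/
theorem localIndex_decomp (𝔭 : Ideal R) [𝔭.IsPrime] {𝔞 𝔟 : FractionalIdeal R⁰ K} (h𝔞 : 𝔞 ≠ 0)
    (h𝔟 : 𝔟 ≠ 0) (b b' : Module.Basis (Fin 2) K V) :
    localIndex K 𝔭 (decomp 𝔞 (b 0) (b 1)) (decomp 𝔟 (b' 0) (b' 1)) =
      locAt 𝔭 ((FractionalIdeal.spanSingleton R⁰ (b.det b') * 𝔟 * 𝔞⁻¹ : FractionalIdeal R⁰ K) :
        Submodule R K) := by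
  obtain ⟨g, hg⟩ := exists_isLocalGenerator 𝔭 h𝔞
  obtain ⟨h, hh⟩ := exists_isLocalGenerator 𝔭 h𝔟
  have hk : b.det b' ≠ 0 := (b.isUnit_det b').ne_zero
  have hg0 := hg.2.1
  have hh0 := hh.2.1
  have hone : (1 : K) ∈ locRing 𝔭 K := le_locAt 𝔭 _ (mem_one_submodule.2 one_mem_one)
  have hzero : (0 : K) ∈ locRing 𝔭 K := Submodule.zero_mem _
  have hdet : ∀ φ : V ≃ₗ[K] V, LinearMap.det (φ : V →ₗ[K] V) = b.det b' * b'.det (b.map φ) := by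
    intro φ
    rw [Module.Basis.det_mul_det]
    have := b.det_comp (φ : V →ₗ[K] V) b
    rw [b.det_self, mul_one] at this
    rw [← this]
    congr 1
  refine le_antisymm (iSup₂_le fun φ hφ => ?_) fun x hx => ?_
  · rintro _ ⟨x, hx, rfl⟩
    have hmem : ∀ v, v ∈ locAt 𝔭 (decomp 𝔞 (b 0) (b 1)) →
        b'.repr (φ v) 0 ∈ locRing 𝔭 K ∧ ∃ o ∈ locRing 𝔭 K, b'.repr (φ v) 1 = h * o := by
      intro v hv
      rw [← mem_locAt_decomp hh b', ← hφ]
      exact Submodule.mem_map_of_mem (f := (φ : V →ₗ[K] V).restrictScalars R) hv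
    obtain ⟨h0, o, ho, h1⟩ := hmem (b 0)
      ((mem_locAt_decomp hg b).2 ⟨by simpa using hone, 0, hzero, by simp⟩)
    obtain ⟨h0', o', ho', h1'⟩ := hmem (g • b 1)
      ((mem_locAt_decomp hg b).2 ⟨by simp, 1, hone, by simp⟩)
    rw [hg.div hh hk]
    rw [map_smul, map_smul] at h0' h1'
    simp only [Finsupp.smul_apply, smul_eq_mul] at h0' h1'
    refine ⟨(b'.repr (φ (b 0)) 0 * o' - (g * b'.repr (φ (b 1)) 0) * o) * x,
      locRing_mul (Submodule.sub_mem _ (locRing_mul h0 ho') (locRing_mul h0' ho)) hx, ?_⟩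
    have e1 : b'.repr (φ (b 1)) 1 = g⁻¹ * (h * o') := by rw [← h1']; field_simp
    simp only [LinearMap.mulLeft_apply, hdet, det_fin_two_eq b', Module.Basis.map_apply, h1, e1]
    field_simp
  · rw [hg.div hh hk] at hx
    obtain ⟨o, ho, rfl⟩ := hx
    -- The automorphism `b₀ ↦ b'₀`, `g b₁ ↦ h b'₁`, which matches the two local bases.
    let b'' := b'.unitsSMul ![1, Units.mk0 (h * g⁻¹) (mul_ne_zero hh0 (inv_ne_zero hg0))]
    have hb0 : b'' 0 = b' 0 := by simp [b'', Module.Basis.unitsSMul_apply]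
    have hb1 : b'' 1 = (h * g⁻¹) • b' 1 := by
      simp [b'', Module.Basis.unitsSMul_apply, Units.smul_def]
    let φ : V ≃ₗ[K] V := b.equiv b'' (Equiv.refl _)
    have hφb : ∀ i, φ (b i) = b'' i := fun i => by simp [φ]
    have hrep : ∀ v, b'.repr (φ v) 0 = b.repr v 0 ∧
        b'.repr (φ v) 1 = (h * g⁻¹) * b.repr v 1 := by
      intro v
      have := b.sum_repr v
      rw [Fin.sum_univ_two] at this
      rw [← this]
      simp [hφb, hb0, hb1]
      ring
    have hφ : (locAt 𝔭 (decomp 𝔞 (b 0) (b 1))).map ((φ : V →ₗ[K] V).restrictScalars R) =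
        locAt 𝔭 (decomp 𝔟 (b' 0) (b' 1)) := by
      have hiff : ∀ v, v ∈ locAt 𝔭 (decomp 𝔞 (b 0) (b 1)) ↔
          φ v ∈ locAt 𝔭 (decomp 𝔟 (b' 0) (b' 1)) := by
        intro v
        rw [mem_locAt_decomp hg, mem_locAt_decomp hh, (hrep v).1, (hrep v).2]
        refine and_congr_right fun _ => exists_congr fun o => and_congr_right fun _ => ?_
        constructor
        · intro e
          rw [e]
          field_simp
        · intro e
          field_simp at e
          exact e
      ext w
      constructor
      · rintro ⟨v, hv, rfl⟩
        exact (hiff v).1 hv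
      · intro hw
        refine ⟨φ.symm w, (hiff _).2 (by simpa using hw), by simp⟩
    refine (le_iSup₂ (f := fun (φ : V ≃ₗ[K] V)
      (_ : (locAt 𝔭 (decomp 𝔞 (b 0) (b 1))).map ((φ : V →ₗ[K] V).restrictScalars R) =
        locAt 𝔭 (decomp 𝔟 (b' 0) (b' 1))) => (locAt 𝔭 (1 : Submodule R K)).map
      (LinearMap.mulLeft R (LinearMap.det (φ : V →ₗ[K] V)))) φ hφ) ⟨o, ho, ?_⟩
    simp only [LinearMap.mulLeft_apply, hdet, det_fin_two_eq b', Module.Basis.map_apply, hφb, hb0,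
      hb1]
    simp
    left
    ring

/-- The module index of two lattices given by decompositions. -/
theorem moduleIndex_decomp {𝔞 𝔟 : FractionalIdeal R⁰ K} (h𝔞 : 𝔞 ≠ 0) (h𝔟 : 𝔟 ≠ 0)
    (b b' : Module.Basis (Fin 2) K V) :
    moduleIndex K (decomp 𝔞 (b 0) (b 1)) (decomp 𝔟 (b' 0) (b' 1)) =
      ((FractionalIdeal.spanSingleton R⁰ (b.det b') * 𝔟 * 𝔞⁻¹ : FractionalIdeal R⁰ K) :
        Submodule R K) := by
  simp only [moduleIndex, localIndex_decomp _ h𝔞 h𝔟, iInf_locAt]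

end ModuleIndex

/-! ### Norm, trace, discriminant and change of generator in `K[ω]`. -/

open scoped QuadraticAlgebra

section QuadraticAlgebra

open QuadraticAlgebra

variable {K : Type*} [Field K] {p q : K}

theorem algebra_norm_eq (z : QuadraticAlgebra K p q) : Algebra.norm K z = z.norm := by
  rw [← det_toLinearMap_eq_norm, Algebra.norm_apply]
  congr 1

theorem algebra_trace_eq (z : QuadraticAlgebra K p q) : Algebra.trace K _ z = z.trace := by
  rw [Algebra.trace_eq_matrix_trace (QuadraticAlgebra.basis p q), Matrix.trace_fin_two,
    Algebra.leftMulMatrix_eq_repr_mul, Algebra.leftMulMatrix_eq_repr_mul]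
  have h0 : QuadraticAlgebra.basis p q 0 = ⟨1, 0⟩ := by
    simp [QuadraticAlgebra.basis]
  have h1 : QuadraticAlgebra.basis p q 1 = ⟨0, 1⟩ := by
    simp [QuadraticAlgebra.basis]
  simp [h0, h1, trace_def]
  ring

theorem discr_one_mk (k : K) :
    Algebra.discr K ![(1 : QuadraticAlgebra K p q), ⟨k, 1⟩] = q ^ 2 + 4 * p := by
  simp [Algebra.discr, Matrix.det_fin_two, Algebra.traceMatrix_apply, Algebra.traceForm_apply,
    algebra_trace_eq, trace_def]
  ring

/-- Two quadratic algebras whose generators differ by the constant `k`. -/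
def shiftEquiv (k : K) {p' q' : K} (hp : p' = p - k ^ 2 - k * q) (hq : q' = 2 * k + q) :
    QuadraticAlgebra K p q ≃ₐ[K] QuadraticAlgebra K p' q' where
  toFun z := ⟨z.re - k * z.im, z.im⟩
  invFun z := ⟨z.re + k * z.im, z.im⟩
  left_inv z := by ext <;> simp
  right_inv z := by ext <;> simp
  map_add' z w := by ext <;> simp; ring
  map_mul' z w := by subst hp hq; ext <;> simp <;> ring
  commutes' r := by ext <;> simp

end QuadraticAlgebra

/-! ### Charts of oriented quadratic rings. -/

namespace OrientedQuadraticRing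

variable {R K : Type u} [CommRing R] [Field K] [Algebra R K] {𝔞 : FractionalIdeal R⁰ K}
  (A : OrientedQuadraticRing R K 𝔞)

theorem wedge_mem (x y : A.S) : A.wedge x y ∈ 𝔞 := by
  rw [wedge_apply]
  exact (A.orientation _).2

theorem wedge_self (x : A.S) : A.wedge x x = 0 := by
  rw [wedge_apply, (exteriorPower.ιMulti R 2 (M := A.S)).map_eq_zero_of_eq ![x, x]
    (i := 0) (j := 1) (by simp) (by simp)]
  simp

theorem wedge_swap (x y : A.S) : A.wedge x y = -A.wedge y x := by
  have h := A.wedge_self (x + y)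
  simp only [map_add, LinearMap.add_apply, wedge_self] at h
  linear_combination h

theorem wedgeK_swap (x y : A.L) : A.wedgeK x y = -A.wedgeK y x := by
  induction x using TensorProduct.induction_on with
  | zero => simp
  | add x x' hx hx' => simp only [map_add, LinearMap.add_apply, hx, hx']; ring
  | tmul k a =>
    induction y using TensorProduct.induction_on with
    | zero => simp
    | add y y' hy hy' => simp only [map_add, LinearMap.add_apply, hy, hy']; ring
    | tmul k' a' => rw [wedgeK_tmul, wedgeK_tmul, wedge_swap]; ring

theorem wedgeK_self (x : A.L) : A.wedgeK x x = 0 := by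
  induction x using TensorProduct.induction_on with
  | zero => simp
  | add x y hx hy =>
    simp only [map_add, LinearMap.add_apply, hx, hy, A.wedgeK_swap y x]
    ring
  | tmul k a => rw [wedgeK_tmul, wedge_self, mul_zero]

theorem exists_mem_lattice {x : A.L} : x ∈ A.lattice ↔ ∃ a : A.S, (1 : K) ⊗ₜ[R] a = x := by
  simp [lattice]

theorem one_tmul_mem_lattice (a : A.S) : ((1 : K) ⊗ₜ[R] a : A.L) ∈ A.lattice :=
  A.exists_mem_lattice.2 ⟨a, rfl⟩

theorem lattice_fg : A.lattice.FG := by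
  rw [lattice, LinearMap.range_eq_map]
  exact A.finite.fg_top.map _

theorem span_lattice : Submodule.span K (A.lattice : Set A.L) = ⊤ := by
  rw [eq_top_iff]
  rintro x -
  induction x using TensorProduct.induction_on with
  | zero => exact Submodule.zero_mem _
  | add x y hx hy => exact Submodule.add_mem _ hx hy
  | tmul k a =>
    have : (k ⊗ₜ[R] a : A.L) = k • ((1 : K) ⊗ₜ[R] a) := by simp [TensorProduct.smul_tmul']
    rw [this]
    exact Submodule.smul_mem _ _ (Submodule.subset_span (A.one_tmul_mem_lattice a))

/-- The values of the wedge product generate `𝔞`. -/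
theorem le_of_wedge_mem {𝔟 : Submodule R K} (h : ∀ x y : A.S, A.wedge x y ∈ 𝔟) :
    (𝔞 : Submodule R K) ≤ 𝔟 := by
  intro t ht
  obtain ⟨w, hw⟩ := A.orientation.surjective ⟨t, ht⟩
  have key : ∀ w : ⋀[R]^2 A.S, ((A.orientation w : (𝔞 : Submodule R K)) : K) ∈ 𝔟 := by
    intro w
    have hw : w ∈ Submodule.span R (Set.range (exteriorPower.ιMulti R 2 (M := A.S))) := by
      rw [exteriorPower.ιMulti_span]; trivial
    induction hw using Submodule.span_induction with
    | mem x hx =>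
      obtain ⟨v, rfl⟩ := hx
      have : v = ![v 0, v 1] := by ext i; fin_cases i <;> rfl
      rw [this]
      exact h _ _
    | zero => simp
    | add x y _ _ hx hy => rw [map_add]; exact 𝔟.add_mem hx hy
    | smul r x _ hx => rw [map_smul]; exact 𝔟.smul_mem r hx
  have := key w
  rwa [hw] at this

/-- A chart of an oriented quadratic ring identifies `L` with `K[ω]`, where `ω² = p + q ω`, in such
a way that `1, ω` is a basis specified by the orientation. -/
structure Chart (p q : K) where
  /-- the identification -/
  e : A.L ≃ₐ[K] QuadraticAlgebra K p q
  wedgeK_eq : ∀ x y, A.wedgeK x y = (e x).re * (e y).im - (e x).im * (e y).re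
  mem_lattice : ∀ x, x ∈ A.lattice ↔ (e x).re ∈ (1 : FractionalIdeal R⁰ K) ∧ (e x).im ∈ 𝔞

variable {A}

/-- Replacing the generator `ω` of a chart by a translate. -/
def Chart.shift {p q : K} (c : A.Chart p q) (k : K)
    (hk : ∀ t ∈ 𝔞, k * t ∈ (1 : FractionalIdeal R⁰ K)) {p' q' : K} (hp : p' = p - k ^ 2 - k * q) (hq : q' = 2 * k + q) : A.Chart p' q' where
  e := c.e.trans (shiftEquiv k hp hq)
  wedgeK_eq x y := by
    rw [c.wedgeK_eq]
    simp [shiftEquiv]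
    ring
  mem_lattice x := by
    rw [c.mem_lattice]
    simp only [AlgEquiv.trans_apply, shiftEquiv, AlgEquiv.coe_mk, Equiv.coe_fn_mk]
    refine and_congr_left fun him => ⟨fun h => mem_sub h (hk _ him), fun h => ?_⟩
    simpa using mem_add h (hk _ him)

theorem Chart.norm_eq {p q : K} (c : A.Chart p q) (x : A.L) :
    Algebra.norm K x = (c.e x).norm := by
  rw [← algebra_norm_eq, Algebra.norm_eq_of_algEquiv]

theorem Chart.lattice_eq {p q : K} (c : A.Chart p q) (k : K)
    (hk : ∀ t ∈ 𝔞, k * t ∈ (1 : FractionalIdeal R⁰ K)) :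
    A.lattice = decomp 𝔞 1 (c.e.symm ⟨k, 1⟩) := by
  ext x
  rw [c.mem_lattice, mem_decomp]
  constructor
  · rintro ⟨h0, h1⟩
    refine ⟨(c.e x).re - k * (c.e x).im, mem_sub h0 (hk _ h1), _, h1, c.e.injective ?_⟩
    ext <;> simp [mul_comm]
  · rintro ⟨x, hx, y, hy, rfl⟩
    have h0 : (c.e (x • 1 + y • c.e.symm ⟨k, 1⟩)).re = x + k * y := by simp [mul_comm]
    have h1 : (c.e (x • 1 + y • c.e.symm ⟨k, 1⟩)).im = y := by simp
    rw [h0, h1]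
    exact ⟨mem_add hx (hk y hy), hy⟩

/-- In the chart, `π_K(1 ∧ ξ) = 1` forces `ξ = k + ω`, and the discriminant of `1, k + ω` does not
involve `k`. -/
theorem Chart.hasDiscr {p q : K} (c : A.Chart p q) : A.HasDiscr (q ^ 2 + 4 * p) := by
  have h0 : ∀ t ∈ 𝔞, 0 * t ∈ (1 : FractionalIdeal R⁰ K) := fun t _ => by
    rw [zero_mul]; exact FractionalIdeal.zero_mem _
  refine ⟨⟨c.e.symm ⟨0, 1⟩, c.lattice_eq 0 h0, by simp [c.wedgeK_eq]⟩, fun ξ hξ => ?_⟩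
  have h1 := hξ.2
  rw [c.wedgeK_eq] at h1
  have : c.e ξ = ⟨(c.e ξ).re, 1⟩ := by
    ext
    · rfl
    · simpa using h1
  rw [Algebra.discr_eq_discr_of_algEquiv _ c.e, ← discr_one_mk (c.e ξ).re, ← this]
  congr 1
  funext i
  fin_cases i <;> simp

theorem Chart.isNondegenerate_iff {p q : K} (c : A.Chart p q) :
    A.IsNondegenerate ↔ q ^ 2 + 4 * p ≠ 0 := by
  let b : Module.Basis (Fin 2) K A.L := (QuadraticAlgebra.basis p q).map c.e.symm.toLinearEquiv
  rw [IsNondegenerate, LinearMap.BilinForm.nondegenerate_iff_det_ne_zero b,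
    ← Algebra.traceMatrix_of_basis, ← Algebra.discr_def,
    Algebra.discr_eq_discr_of_algEquiv _ c.e, ← discr_one_mk (p := p) (q := q) 0]
  have : (c.e ∘ b : Fin 2 → QuadraticAlgebra K p q) = ![1, ⟨0, 1⟩] := by
    ext i <;> fin_cases i <;> simp [b, QuadraticAlgebra.basis]
  rw [this]

variable [IsDedekindDomain R] [IsFractionRing R K]

/-- `S` is integral over `R` and `R` is integrally closed, so `S ∩ K = R`. -/
theorem mem_one_of_smul_one_mem_lattice {k : K} (h : k • (1 : A.L) ∈ A.lattice) :
    k ∈ (1 : FractionalIdeal R⁰ K) := by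
  have : Module.Finite R A.S := A.finite
  obtain ⟨a, ha⟩ := A.exists_mem_lattice.1 h
  have hL : Nontrivial A.L := by
    have := A.rank_eq_two
    exact Module.nontrivial_of_finrank_pos (R := K) (M := A.L) (by rw [this]; exact two_pos)
  have h1 : IsIntegral R (algebraMap K A.L k) := by
    rw [Algebra.algebraMap_eq_smul_one, ← ha]
    exact (Algebra.IsIntegral.isIntegral (R := R) a).map
      (Algebra.TensorProduct.includeRight : A.S →ₐ[R] A.L)
  have h2 : IsIntegral R k := (isIntegral_algebraMap_iff (algebraMap K A.L).injective).1 h1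
  exact (FractionalIdeal.mem_one_iff R⁰).2 (IsIntegrallyClosed.algebraMap_eq_of_integral h2)

/-- The map `1 ∧ ·` on `S` has kernel `S ∩ K = R`. Its image is a fractional ideal, hence
projective, so it splits: `S = R + 𝔟ξ` with `1 ∧ ξ = 1`. The orientation then forces `𝔟 = 𝔞`, and
`ξ² = p + qξ` yields the chart. -/
theorem exists_chart (A : OrientedQuadraticRing R K 𝔞) (h𝔞 : 𝔞 ≠ 0) :
    ∃ p q, Nonempty (A.Chart p q) := by
  have hfr := A.rank_eq_two
  have : Module.Finite K A.L := Module.finite_of_finrank_pos (R := K) (M := A.L)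
    (by rw [hfr]; exact two_pos)
  have hL : Nontrivial A.L := Module.nontrivial_of_finrank_pos (R := K) (M := A.L)
    (by rw [hfr]; exact two_pos)
  have hbasis : ∀ ξ : A.L, A.wedgeK 1 ξ ≠ 0 → ∀ z : A.L, ∃ x y : K, z = x • 1 + y • ξ := by
    intro ξ hξ z
    have hli : LinearIndependent K ![(1 : A.L), ξ] := by
      rw [LinearIndependent.pair_iff]
      intro x y hxy
      have h1 := congrArg (A.wedgeK 1) hxy
      have h2 := congrArg (A.wedgeK ξ) hxy
      simp only [map_add, map_smul, wedgeK_self, smul_eq_mul, map_zero, mul_zero, zero_add,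
        add_zero, A.wedgeK_swap ξ 1] at h1 h2
      exact ⟨by simpa [hξ] using h2, by simpa [hξ] using h1⟩
    have hsp := hli.span_eq_top_of_card_eq_finrank (by simp [hfr])
    have hz : z ∈ Submodule.span K (Set.range ![(1 : A.L), ξ]) := hsp ▸ Submodule.mem_top
    rw [Matrix.range_cons, Matrix.range_cons, Matrix.range_empty, Set.union_empty,
      Set.singleton_union, Submodule.mem_span_pair] at hz
    obtain ⟨x, y, hxy⟩ := hz
    exact ⟨x, y, hxy.symm⟩
  have hne : ∃ η : A.L, A.wedgeK 1 η ≠ 0 := by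
    by_contra! h
    have hW : ∀ x y : A.L, A.wedgeK x y = 0 := by
      intro x y
      by_contra hxy
      -- `x, y` is a basis, in which the wedge with `1` is nonzero
      have hli : LinearIndependent K ![x, y] := by
        rw [LinearIndependent.pair_iff]
        intro a b hab
        have h1 := congrArg (A.wedgeK x) hab
        have h2 := congrArg (A.wedgeK y) hab
        simp only [map_add, map_smul, wedgeK_self, smul_eq_mul, map_zero, mul_zero, zero_add,
          add_zero, A.wedgeK_swap y x] at h1 h2
        exact ⟨by simpa [hxy] using h2, by simpa [hxy] using h1⟩
      have hsp := hli.span_eq_top_of_card_eq_finrank (by simp [hfr])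
      have hz : (1 : A.L) ∈ Submodule.span K (Set.range ![x, y]) := hsp ▸ Submodule.mem_top
      rw [Matrix.range_cons, Matrix.range_cons, Matrix.range_empty, Set.union_empty,
        Set.singleton_union, Submodule.mem_span_pair] at hz
      obtain ⟨a, b, hab⟩ := hz
      have h1 := h x
      have h2 := h y
      rw [← hab] at h1 h2
      simp only [map_add, map_smul, LinearMap.add_apply, LinearMap.smul_apply, wedgeK_self,
        smul_eq_mul, mul_zero, zero_add, add_zero, A.wedgeK_swap y x] at h1 h2
      have ha : a = 0 := by simpa [hxy] using h2
      have hb : b = 0 := by simpa [hxy] using h1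
      rw [ha, hb] at hab
      simp at hab
    have h0 : (𝔞 : Submodule R K) ≤ ⊥ := A.le_of_wedge_mem fun x y => by
      have := hW ((1 : K) ⊗ₜ x) ((1 : K) ⊗ₜ y)
      rw [wedgeK_tmul] at this
      simpa using this
    exact h𝔞 (FractionalIdeal.coeToSubmodule_eq_bot.1 (le_bot_iff.1 h0))
  let 𝔟 : FractionalIdeal R⁰ K := ⟨A.lattice.map ((A.wedgeK 1).restrictScalars R),
    FractionalIdeal.isFractional_of_fg (A.lattice_fg.map _)⟩
  have hmem𝔟 : ∀ z ∈ A.lattice, A.wedgeK 1 z ∈ 𝔟 := fun z hz =>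
    Submodule.mem_map_of_mem (f := (A.wedgeK 1).restrictScalars R) hz
  have h𝔟 : 𝔟 ≠ 0 := by
    obtain ⟨η, hη⟩ := hne
    obtain ⟨r, hr, hrη⟩ := exists_smul_mem_of_mem_span (R := R) (v := η)
      (A.span_lattice ▸ Submodule.mem_top)
    intro h0
    have := hmem𝔟 _ hrη
    rw [h0, FractionalIdeal.mem_zero_iff, ← algebraMap_smul K r, map_smul, smul_eq_mul,
      mul_eq_zero, map_eq_zero_iff _ (IsFractionRing.injective R K)] at this
    exact this.elim hr hη
  obtain ⟨ξ, hξ, hξ𝔟⟩ := exists_section (l := A.wedgeK 1) (M := A.lattice) h𝔟 rfl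
  have hspan := hbasis ξ (by rw [hξ]; exact one_ne_zero)
  have hw : ∀ x y : K, A.wedgeK 1 (x • 1 + y • ξ) = y := fun x y => by
    simp [wedgeK_self, hξ]
  have hw' : ∀ x y x' y' : K, A.wedgeK (x • 1 + y • ξ) (x' • 1 + y' • ξ) = x * y' - y * x' := by
    intro x y x' y'
    simp [wedgeK_self, hξ, A.wedgeK_swap ξ 1]
    ring
  have hlat : ∀ x y : K, x • 1 + y • ξ ∈ A.lattice ↔ x ∈ (1 : FractionalIdeal R⁰ K) ∧ y ∈ 𝔟 := by
    intro x y
    constructor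
    · intro h
      have hy : y ∈ 𝔟 := by simpa [hw] using hmem𝔟 _ h
      have hx := A.lattice.sub_mem h (hξ𝔟 y hy)
      rw [add_sub_cancel_right] at hx
      exact ⟨mem_one_of_smul_one_mem_lattice hx, hy⟩
    · rintro ⟨hx, hy⟩
      refine A.lattice.add_mem ?_ (hξ𝔟 y hy)
      obtain ⟨r, rfl⟩ := (FractionalIdeal.mem_one_iff R⁰).1 hx
      rw [algebraMap_smul]
      exact A.lattice.smul_mem r (A.one_tmul_mem_lattice 1)
  -- For `𝔞 ≤ 𝔟`: since the orientation is onto, the values on pairs generate `𝔞`, and each is `xy'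
  -- - yx'` with `x, x' ∈ R` and `y, y' ∈ 𝔟`.
  have h𝔞𝔟 : 𝔟 = 𝔞 := by
    refine le_antisymm ?_ ?_
    · rintro _ ⟨z, hz, rfl⟩
      obtain ⟨a, rfl⟩ := A.exists_mem_lattice.1 hz
      have : A.wedgeK 1 ((1 : K) ⊗ₜ a) = A.wedge 1 a := by
        rw [Algebra.TensorProduct.one_def, wedgeK_tmul]; simp
      change A.wedgeK 1 ((1 : K) ⊗ₜ a) ∈ 𝔞
      rw [this]
      exact A.wedge_mem _ _
    · refine A.le_of_wedge_mem (𝔟 := (𝔟 : Submodule R K)) fun a a' => ?_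
      obtain ⟨x, y, hxy⟩ := hspan ((1 : K) ⊗ₜ a)
      obtain ⟨x', y', hxy'⟩ := hspan ((1 : K) ⊗ₜ a')
      have h1 := (hlat x y).1 (hxy ▸ A.one_tmul_mem_lattice a)
      have h2 := (hlat x' y').1 (hxy' ▸ A.one_tmul_mem_lattice a')
      have : A.wedge a a' = x * y' - y * x' := by
        rw [← hw', ← hxy, ← hxy', wedgeK_tmul]; simp
      rw [this]
      exact mem_sub (one_mul_mem h1.1 h2.2) (mul_one_mem h1.2 h2.1)
  obtain ⟨p, q, hpq⟩ := hspan (ξ * ξ)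
  let g := QuadraticAlgebra.lift (⟨ξ, hpq⟩ : { u : A.L // u * u = p • 1 + q • u })
  have hg : ∀ z, g z = z.re • 1 + z.im • ξ := fun z => rfl
  have hgb : Function.Bijective g := by
    refine ⟨(injective_iff_map_eq_zero g).2 fun z hz => ?_, fun z => ?_⟩
    · rw [hg] at hz
      have him : z.im = 0 := by rw [← hw z.re z.im, hz, map_zero]
      rw [him, zero_smul, add_zero] at hz
      have hre : z.re = 0 := by simpa using hz
      ext
      · exact hre
      · exact him
    · obtain ⟨x, y, rfl⟩ := hspan z
      exact ⟨⟨x, y⟩, hg _⟩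
  have hsymm : ∀ x, x = ((AlgEquiv.ofBijective g hgb).symm x).re • 1 +
      ((AlgEquiv.ofBijective g hgb).symm x).im • ξ := fun x => by
    rw [← hg]
    exact ((AlgEquiv.ofBijective g hgb).apply_symm_apply x).symm
  refine ⟨p, q, ⟨(AlgEquiv.ofBijective g hgb).symm, fun x y => ?_, fun x => ?_⟩⟩
  · conv_lhs => rw [hsymm x, hsymm y]
    exact hw' _ _ _ _
  · have := hlat ((AlgEquiv.ofBijective g hgb).symm x).re ((AlgEquiv.ofBijective g hgb).symm x).im
    rw [← hsymm x] at this
    exact this.trans (and_congr_right fun _ => by rw [h𝔞𝔟])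

end OrientedQuadraticRing

/-! ### The Hessian, and its relation to the norm form. -/

namespace CubicForm

variable {K : Type*} [Field K]

/-- The coefficient of `x²` in the Hessian. -/
def hess₀ (f : CubicForm K) : K := f.b ^ 2 - f.a * f.c

/-- The coefficient of `xy` in the Hessian. -/
def hess₁ (f : CubicForm K) : K := f.b * f.c - f.a * f.d

/-- The coefficient of `y²` in the Hessian. -/
def hess₂ (f : CubicForm K) : K := f.c ^ 2 - f.b * f.d

theorem disc_eq (f : CubicForm K) : f.disc = f.hess₁ ^ 2 + 4 * (-(f.hess₀ * f.hess₂)) := by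
  simp only [disc, hess₀, hess₁, hess₂]
  ring

/-- The quadratic algebra defined by the Hessian. -/
abbrev Model (f : CubicForm K) : Type _ := QuadraticAlgebra K (-(f.hess₀ * f.hess₂)) f.hess₁

variable {R : Type*} [CommRing R] [IsDedekindDomain R] [Algebra R K] [IsFractionRing R K]
  {𝔞 : FractionalIdeal R⁰ K} {f : CubicForm K}

theorem IsOfType.hess₀_mem (hf : f.IsOfType 𝔞) :
    f.hess₀ ∈ (1 : FractionalIdeal R⁰ K) := by
  obtain ⟨ha, hb, hc, hd⟩ := hf
  rw [hess₀, sq]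
  exact mem_sub (one_mul_mem hb hb) (mul_inv_mem ha hc)

theorem IsOfType.hess₁_mem (h𝔞 : 𝔞 ≠ 0) (hf : f.IsOfType 𝔞) : f.hess₁ ∈ 𝔞⁻¹ := by
  obtain ⟨ha, hb, hc, hd⟩ := hf
  refine mem_sub (one_mul_mem hb hc) (mul_mem_of_le ?_ ha hd)
  rw [sq, ← mul_assoc, mul_inv_cancel₀ h𝔞, one_mul]

theorem IsOfType.hess₂_mem (hf : f.IsOfType 𝔞) : f.hess₂ ∈ 𝔞⁻¹ ^ 2 := by
  obtain ⟨ha, hb, hc, hd⟩ := hf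
  refine mem_sub ?_ (one_mul_mem hb hd)
  rw [sq, sq]
  exact FractionalIdeal.mul_mem_mul hc hc

end CubicForm

section QuadraticAlgebra

variable {K : Type*} [Field K] {p q : K}

/-- The cubic form `ζ ↦ im (ζ³ ι)` in the coordinates given by `α, β`. -/
def imForm (α β ι : QuadraticAlgebra K p q) : CubicForm K where
  a := (α ^ 3 * ι).im
  b := (α ^ 2 * β * ι).im
  c := (α * β ^ 2 * ι).im
  d := (β ^ 3 * ι).im

/-- Together with the next two identities this says that the Hessian of `ζ ↦ im (ζ³ ι)` is `N(ζ) D²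
N(ι)`, where `D` is the determinant of `α, β`. The Hessian of the form is thus the norm form up to a
scalar. -/
theorem imForm_hess₀ (α β ι : QuadraticAlgebra K p q) :
    (imForm α β ι).hess₀ = α.norm * (α.re * β.im - α.im * β.re) ^ 2 * ι.norm := by
  simp [imForm, CubicForm.hess₀, QuadraticAlgebra.norm_def, pow_succ]
  ring

theorem imForm_hess₁ (α β ι : QuadraticAlgebra K p q) :
    (imForm α β ι).hess₁ =
      (star α * β).trace * (α.re * β.im - α.im * β.re) ^ 2 * ι.norm := by
  simp [imForm, CubicForm.hess₁, QuadraticAlgebra.norm_def, QuadraticAlgebra.trace_def, pow_succ]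
  ring

theorem imForm_hess₂ (α β ι : QuadraticAlgebra K p q) :
    (imForm α β ι).hess₂ = β.norm * (α.re * β.im - α.im * β.re) ^ 2 * ι.norm := by
  simp [imForm, CubicForm.hess₂, QuadraticAlgebra.norm_def, pow_succ]
  ring

variable {α β ι : QuadraticAlgebra K p q} {s : K}

/-- For a balanced quadruple `D = s` and `N(ι) = s⁻³`, so that the scalar `D² N(ι)` is just `s⁻¹`.
-/
theorem imForm_hess₀_mul (hs : α.re * β.im - α.im * β.re = s) (hι : s ^ 3 * ι.norm = 1) :
    (imForm α β ι).hess₀ * s = α.norm := by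
  rw [imForm_hess₀, hs]
  linear_combination α.norm * hι

theorem imForm_hess₁_mul (hs : α.re * β.im - α.im * β.re = s) (hι : s ^ 3 * ι.norm = 1) :
    (imForm α β ι).hess₁ * s = (star α * β).trace := by
  rw [imForm_hess₁, hs]
  linear_combination (star α * β).trace * hι

theorem imForm_hess₂_mul (hs : α.re * β.im - α.im * β.re = s) (hι : s ^ 3 * ι.norm = 1) :
    (imForm α β ι).hess₂ * s = β.norm := by
  rw [imForm_hess₂, hs]
  linear_combination β.norm * hι

end QuadraticAlgebra

section IntegrallyClosed

variable {R K : Type*} [CommRing R] [IsDedekindDomain R] [Field K] [Algebra R K]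
  [IsFractionRing R K]

theorem mem_one_of_quadratic {x u v : K} (hu : u ∈ (1 : FractionalIdeal R⁰ K))
    (hv : v ∈ (1 : FractionalIdeal R⁰ K)) (h : x ^ 2 + u * x = v) :
    x ∈ (1 : FractionalIdeal R⁰ K) := by
  obtain ⟨u, rfl⟩ := (FractionalIdeal.mem_one_iff R⁰).1 hu
  obtain ⟨v, rfl⟩ := (FractionalIdeal.mem_one_iff R⁰).1 hv
  have hx : IsIntegral R x := by
    refine ⟨Polynomial.X ^ 2 + Polynomial.C u * Polynomial.X - Polynomial.C v, by monicity!, ?_⟩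
    simp [h]
  exact (FractionalIdeal.mem_one_iff R⁰).2 (IsIntegrallyClosed.algebraMap_eq_of_integral hx)

theorem mem_sq_of_mem {I : FractionalIdeal R⁰ K} {t t' x : K} (ht : t ∈ I) (ht' : t' ∈ I)
    (hx : x ∈ I⁻¹ ^ 2) : t * t' * x ∈ (1 : FractionalIdeal R⁰ K) := by
  by_cases h0 : I = 0
  · subst h0
    rw [FractionalIdeal.mem_zero_iff] at ht
    rw [ht, zero_mul, zero_mul]
    exact FractionalIdeal.zero_mem _
  · refine mul_mem_of_le ?_ (FractionalIdeal.mul_mem_mul ht ht') hx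
    rw [sq, mul_mul_mul_comm, mul_inv_cancel₀ h0, one_mul]

end IntegrallyClosed

namespace OrientedQuadraticRing

variable {R K : Type u} [CommRing R] [Field K] [Algebra R K] {𝔞 : FractionalIdeal R⁰ K}
  {A : OrientedQuadraticRing R K 𝔞}

theorem mul_mem_lattice {x y : A.L} (hx : x ∈ A.lattice) (hy : y ∈ A.lattice) :
    x * y ∈ A.lattice := by
  obtain ⟨a, rfl⟩ := A.exists_mem_lattice.1 hx
  obtain ⟨b, rfl⟩ := A.exists_mem_lattice.1 hy
  simpa using A.one_tmul_mem_lattice (a * b)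

theorem Chart.wedgeK_one {p q : K} (c : A.Chart p q) (x : A.L) : A.wedgeK 1 x = (c.e x).im := by
  simp [c.wedgeK_eq]

/-- This links the condition `π_K(α ∧ β) = s` with the determinant in the module index. -/
theorem wedgeK_det (b b' : Module.Basis (Fin 2) K A.L) :
    A.wedgeK (b' 0) (b' 1) = b.det b' * A.wedgeK (b 0) (b 1) := by
  have h : ∀ v : A.L, v = b.repr v 0 • b 0 + b.repr v 1 • b 1 := fun v => by
    have := b.sum_repr v
    rw [Fin.sum_univ_two] at this
    exact this.symm
  conv_lhs => rw [h (b' 0), h (b' 1)]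
  simp only [map_add, map_smul, LinearMap.add_apply, LinearMap.smul_apply, wedgeK_self,
    smul_eq_mul, A.wedgeK_swap (b 1) (b 0), Module.Basis.det_apply, Matrix.det_fin_two,
    Module.Basis.toMatrix_apply]
  ring

theorem linearIndependent_of_wedgeK_ne_zero {x y : A.L} (hxy : A.wedgeK x y ≠ 0) :
    LinearIndependent K ![x, y] := by
  rw [LinearIndependent.pair_iff]
  intro a b hab
  have h1 := congrArg (A.wedgeK x) hab
  have h2 := congrArg (A.wedgeK y) hab
  simp only [map_add, map_smul, wedgeK_self, smul_eq_mul, map_zero, mul_zero, zero_add,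
    add_zero, A.wedgeK_swap y x] at h1 h2
  exact ⟨by simpa [hxy] using h2, by simpa [hxy] using h1⟩

theorem exists_basis {x y : A.L} (hxy : A.wedgeK x y ≠ 0) :
    ∃ b : Module.Basis (Fin 2) K A.L, b 0 = x ∧ b 1 = y := by
  refine ⟨basisOfLinearIndependentOfCardEqFinrank (linearIndependent_of_wedgeK_ne_zero hxy)
    (by rw [A.rank_eq_two, Fintype.card_fin]), ?_, ?_⟩ <;> simp

theorem exists_eq_smul_add_smul {x y : A.L} (hxy : A.wedgeK x y ≠ 0) (z : A.L) :
    ∃ a b : K, z = a • x + b • y := by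
  obtain ⟨b, rfl, rfl⟩ := exists_basis hxy
  have := b.sum_repr z
  rw [Fin.sum_univ_two] at this
  exact ⟨_, _, this.symm⟩

theorem Chart.symm_mem_lattice {p q : K} (c : A.Chart p q) {t : K} (ht : t ∈ 𝔞) :
    c.e.symm ⟨0, t⟩ ∈ A.lattice := by
  rw [c.mem_lattice, AlgEquiv.apply_symm_apply]
  exact ⟨FractionalIdeal.zero_mem _, ht⟩

variable [IsDedekindDomain R] [IsFractionRing R K]

/-- Read off from the products `(tω)(t'ω) = tt'p + tt'qω ∈ S` for `t, t' ∈ 𝔞`. -/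
theorem Chart.coeff_mem (h𝔞 : 𝔞 ≠ 0) {p q : K} (c : A.Chart p q) : p ∈ 𝔞⁻¹ ^ 2 ∧ q ∈ 𝔞⁻¹ := by
  have key : ∀ t ∈ 𝔞, ∀ t' ∈ 𝔞,
      t * t' * p ∈ (1 : FractionalIdeal R⁰ K) ∧ t * (t' * q) ∈ 𝔞 := by
    intro t ht t' ht'
    have := mul_mem_lattice (c.symm_mem_lattice ht) (c.symm_mem_lattice ht')
    rw [← map_mul, c.mem_lattice, AlgEquiv.apply_symm_apply] at this
    obtain ⟨h0, h1⟩ := this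
    simp only [QuadraticAlgebra.re_mul, QuadraticAlgebra.im_mul, mul_zero, zero_mul,
      zero_add] at h0 h1
    constructor
    · convert! h0 using 1; ring
    · convert! h1 using 1; ring
  exact ⟨mem_inv_sq_of_forall h𝔞 fun t ht t' ht' => (key t ht t' ht').1,
    mem_inv_of_forall h𝔞 fun t' ht' => mem_one_of_forall h𝔞 fun t ht => (key t ht t' ht').2⟩

end OrientedQuadraticRing

/-! ### Bases of balanced quadruples, and what their forms determine. -/

namespace BalancedQuadruple

variable {R K : Type u} [CommRing R] [Field K] [Algebra R K] {𝔞 : FractionalIdeal R⁰ K}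
  (Q : BalancedQuadruple R K 𝔞)

theorem mul_mul_mul_mem {x y z : Q.L} (hx : x ∈ Q.I) (hy : y ∈ Q.I) (hz : z ∈ Q.I) :
    x * y * z * (↑Q.δ⁻¹ : Q.L) ∈ Q.lattice := by
  have h : x * y * z ∈ Q.I ^ 3 := by
    rw [pow_succ, sq]
    exact Submodule.mul_mem_mul (Submodule.mul_mem_mul hx hy) hz
  obtain ⟨w, hw, hwe⟩ := Q.cube_le h
  have : x * y * z * (↑Q.δ⁻¹ : Q.L) = w := by
    rw [← hwe, LinearMap.mulLeft_apply, mul_right_comm, Units.mul_inv, one_mul]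
  rwa [this]

theorem form_eq_imForm {p q : K} (c : Q.Chart p q) (α β : Q.L) :
    Q.form α β = imForm (c.e α) (c.e β) (c.e (↑Q.δ⁻¹ : Q.L)) := by
  simp only [form, imForm, c.wedgeK_one, map_mul, map_pow]

theorem norm_inv_δ {p q : K} (c : Q.Chart p q) :
    (Q.s : K) ^ 3 * (c.e (↑Q.δ⁻¹ : Q.L)).norm = 1 := by
  rw [Q.cube_eq_norm, ← c.norm_eq, ← map_mul, Units.mul_inv, map_one]

variable {Q}

theorem IsBasis.wedgeK_ne_zero {α β : Q.L} (h : Q.IsBasis α β) : Q.wedgeK α β ≠ 0 := by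
  rw [h.2]; exact Q.s.ne_zero

theorem IsBasis.mem_left {α β : Q.L} (h : Q.IsBasis α β) : α ∈ Q.I := by
  rw [h.1]; exact left_mem_decomp _ _ _

theorem IsBasis.smul_mem {α β : Q.L} (h : Q.IsBasis α β) {t : K} (ht : t ∈ 𝔞) : t • β ∈ Q.I := by
  rw [h.1]; exact smul_right_mem_decomp _ _ ht

variable [IsDedekindDomain R] [IsFractionRing R K]

/-- Some decomposition `I = Rα + 𝔟β` exists. Its index in `S` is `det · 𝔟𝔞⁻¹`, which has to equal
`sR`, so `𝔟` is a principal multiple of `𝔞`. Moving the factor from `𝔟` to `β` also turns the wedge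
into `s`. -/
theorem exists_isBasis (h𝔞 : 𝔞 ≠ 0) (Q : BalancedQuadruple R K 𝔞) : ∃ α β, Q.IsBasis α β := by
  obtain ⟨p, q, ⟨c⟩⟩ := Q.exists_chart h𝔞
  obtain ⟨𝔟, h𝔟, α, β, hI⟩ := exists_eq_decomp Q.rank_eq_two Q.isFractionalIdeal.fg
    Q.isFractionalIdeal.span_eq_top
  have hspan : ⊤ ≤ Submodule.span K (Set.range ![α, β]) := by
    rw [← Q.isFractionalIdeal.span_eq_top, Submodule.span_le, hI]
    intro v hv
    obtain ⟨x, -, y, -, rfl⟩ := mem_decomp.1 hv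
    exact Submodule.add_mem _ (Submodule.smul_mem _ _ (Submodule.subset_span ⟨0, rfl⟩))
      (Submodule.smul_mem _ _ (Submodule.subset_span ⟨1, rfl⟩))
  let b' := basisOfTopLeSpanOfCardEqFinrank ![α, β] hspan
    (by rw [Q.rank_eq_two, Fintype.card_fin])
  have hb0 : b' 0 = α := by simp [b']
  have hb1 : b' 1 = β := by simp [b']
  have h1 : Q.wedgeK 1 (c.e.symm ⟨0, 1⟩) = 1 := by simp [c.wedgeK_one]
  obtain ⟨b, hb, hb₁⟩ := OrientedQuadraticRing.exists_basis (A := Q.toOrientedQuadraticRing)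
    (x := 1) (y := c.e.symm ⟨0, 1⟩) (by rw [h1]; exact one_ne_zero)
  have hlat : Q.lattice = decomp 𝔞 (b 0) (b 1) := by
    rw [hb, hb₁]
    refine c.lattice_eq 0 fun t _ => ?_
    rw [zero_mul]
    exact FractionalIdeal.zero_mem _
  have hdet : Q.wedgeK α β = b.det b' := by
    rw [← hb0, ← hb1, OrientedQuadraticRing.wedgeK_det b b', hb, hb₁, h1, mul_one]
  have hdet0 : b.det b' ≠ 0 := (b.isUnit_det b').ne_zero
  have hidx := Q.index_eq
  rw [hI, hlat, ← hb0, ← hb1, moduleIndex_decomp h𝔞 h𝔟, ← FractionalIdeal.coe_spanSingleton R⁰,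
    FractionalIdeal.coeToSubmodule_inj] at hidx
  have h𝔟𝔞 : 𝔟 = FractionalIdeal.spanSingleton R⁰ ((b.det b')⁻¹ * Q.s) * 𝔞 := by
    rw [← FractionalIdeal.spanSingleton_mul_spanSingleton, ← hidx, mul_assoc, mul_assoc, mul_assoc,
      inv_mul_cancel₀ h𝔞, mul_one, ← mul_assoc, FractionalIdeal.spanSingleton_mul_spanSingleton,
      inv_mul_cancel₀ hdet0, FractionalIdeal.spanSingleton_one, one_mul]
  refine ⟨α, ((b.det b')⁻¹ * (Q.s : K)) • β, ?_, ?_⟩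
  · rw [hI]
    ext v
    simp only [mem_decomp, h𝔟𝔞, FractionalIdeal.mem_singleton_mul]
    constructor
    · rintro ⟨x, hx, _, ⟨y, hy, rfl⟩, rfl⟩
      exact ⟨x, hx, y, hy, by rw [smul_smul, mul_comm y]⟩
    · rintro ⟨x, hx, y, hy, rfl⟩
      exact ⟨x, hx, _, ⟨y, hy, rfl⟩, by rw [smul_smul, mul_comm y]⟩
  · rw [map_smul, hdet, smul_eq_mul]
    field_simp

/-- Since `β` need not lie in `I`, each coefficient is tested after multiplying every `β` by an
element of `𝔞`. The result is `π(1 ∧ w)` with `w ∈ I³δ⁻¹ ⊆ S`, hence in `𝔞`. -/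
theorem IsBasis.form_isOfType (h𝔞 : 𝔞 ≠ 0) {α β : Q.L} (h : Q.IsBasis α β) :
    (Q.form α β).IsOfType 𝔞 := by
  obtain ⟨p, q, ⟨c⟩⟩ := Q.exists_chart h𝔞
  have key : ∀ {x y z : Q.L}, x ∈ Q.I → y ∈ Q.I → z ∈ Q.I →
      Q.wedgeK 1 (x * y * z * (↑Q.δ⁻¹ : Q.L)) ∈ 𝔞 := fun hx hy hz => by
    rw [c.wedgeK_one]
    exact ((c.mem_lattice _).1 (Q.mul_mul_mul_mem hx hy hz)).2
  have hα := h.mem_left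
  refine ⟨?_, mem_one_of_forall h𝔞 fun t ht => ?_, mem_inv_of_forall h𝔞 fun t ht =>
    mem_one_of_forall h𝔞 fun t' ht' => ?_, mem_inv_sq_of_forall h𝔞 fun t ht t' ht' =>
    mem_one_of_forall h𝔞 fun t'' ht'' => ?_⟩
  · convert! key hα hα hα using 1
    simp only [form, pow_succ, pow_zero, one_mul]
  · convert! key hα hα (h.smul_mem ht) using 1
    simp only [form, mul_smul_comm, smul_mul_assoc, map_smul, smul_eq_mul, sq]
  · convert! key hα (h.smul_mem ht) (h.smul_mem ht') using 1
    simp only [form, mul_smul_comm, smul_mul_assoc, map_smul, smul_eq_mul, sq, mul_assoc]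
  · convert! key (h.smul_mem ht) (h.smul_mem ht') (h.smul_mem ht'') using 1
    simp only [form, mul_smul_comm, smul_mul_assoc, map_smul, smul_eq_mul, pow_succ, pow_zero,
      one_mul]
    ring

/-- The oriented ring of a quadruple and the position of its ideal are determined by the form. -/
theorem IsBasis.exists_chart (h𝔞 : 𝔞 ≠ 0) {α β : Q.L} (h : Q.IsBasis α β) {f : CubicForm K}
    (hform : Q.form α β = f) :
    ∃ c : Q.Chart (-(f.hess₀ * f.hess₂)) f.hess₁,
      (c.e α).re = f.hess₀ * (c.e β).im - f.hess₁ * (c.e α).im ∧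
      (c.e β).re = -f.hess₂ * (c.e α).im := by
  obtain ⟨p, q, ⟨c⟩⟩ := Q.exists_chart h𝔞
  obtain ⟨hp, hq⟩ := c.coeff_mem h𝔞
  have hf := h.form_isOfType h𝔞
  rw [hform] at hf
  have hs0 := Q.s.ne_zero
  have hs : (c.e α).re * (c.e β).im - (c.e α).im * (c.e β).re = Q.s := by
    rw [← c.wedgeK_eq, h.2]
  have hι := Q.norm_inv_δ c
  have e0 := imForm_hess₀_mul hs hι
  have e1 := imForm_hess₁_mul hs hι
  have e2 := imForm_hess₂_mul hs hι
  rw [← Q.form_eq_imForm c, hform] at e0 e1 e2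
  -- The imaginary part of `ᾱβ` is `s`, so `ᾱβ = s(k + ω)`. The new generator is `τ = k + ω`, whose
  -- trace and norm are `h₁` and `h₀h₂`.
  let k : K := (star (c.e α) * c.e β).re / Q.s
  have hk : (star (c.e α) * c.e β) = ⟨k * Q.s, Q.s⟩ := by
    ext
    · simp only [k]; field_simp
    · rw [← hs]
      simp
      ring
  have hq' : f.hess₁ = 2 * k + q := by
    rw [hk, QuadraticAlgebra.trace_def] at e1
    simp only at e1
    have : (f.hess₁ - (2 * k + q)) * Q.s = 0 := by linear_combination e1
    simpa [sub_eq_zero] using this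
  have hp' : -(f.hess₀ * f.hess₂) = p - k ^ 2 - k * q := by
    have h1 : (star (c.e α) * c.e β).norm = (c.e α).norm * (c.e β).norm := by
      rw [map_mul, QuadraticAlgebra.norm_star]
    rw [hk, ← e0, ← e2, QuadraticAlgebra.norm_def] at h1
    simp only at h1
    have : (-(f.hess₀ * f.hess₂) - (p - k ^ 2 - k * q)) * (Q.s * Q.s) = 0 := by
      linear_combination h1
    simpa [sub_eq_zero] using this
  -- Comparing the norms of `τ` and `ω` gives a monic quadratic equation for `tk` over `R`. As `R`
  -- is integrally closed, translating by `k` preserves the lattice `R + 𝔞ω`.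
  have hkt : ∀ t ∈ 𝔞, k * t ∈ (1 : FractionalIdeal R⁰ K) := by
    intro t ht
    refine mem_one_of_quadratic (u := t * q) (v := t * t * p + t * t * f.hess₂ * f.hess₀)
      (mul_inv_mem ht hq) (mem_add (mem_sq_of_mem ht ht hp)
      (mul_one_mem (mem_sq_of_mem ht ht hf.hess₂_mem) (hf.hess₀_mem))) ?_
    linear_combination (t ^ 2) * hp'
  -- `N(α)β = α(ᾱβ)` and `N(β)ᾱ = β̄(ᾱβ)`; divided by `s` these read `h₀β = ατ` and `h₂ᾱ = β̄τ`.
  -- Their imaginary parts are the two asserted relations.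
  have hα : (c.e α).norm • c.e β = c.e α * ⟨k * Q.s, Q.s⟩ := by
    rw [← hk, Algebra.smul_def, QuadraticAlgebra.algebraMap_norm_eq_mul_star, mul_assoc]
  have hβ : (c.e β).norm • star (c.e α) = star (c.e β) * ⟨k * Q.s, Q.s⟩ := by
    rw [← hk, Algebra.smul_def, QuadraticAlgebra.algebraMap_norm_eq_mul_star]
    ring
  rw [← e0] at hα
  rw [← e2] at hβ
  have h1 := congrArg QuadraticAlgebra.im hα
  have h2 := congrArg QuadraticAlgebra.im hβ
  simp only [QuadraticAlgebra.im_smul, QuadraticAlgebra.im_mul, QuadraticAlgebra.im_star,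
    QuadraticAlgebra.re_star, smul_eq_mul] at h1 h2
  refine ⟨c.shift k hkt hp' hq', ?_, ?_⟩
  · refine mul_right_cancel₀ hs0 ?_
    simp only [OrientedQuadraticRing.Chart.shift, shiftEquiv, AlgEquiv.trans_apply,
      AlgEquiv.coe_mk, Equiv.coe_fn_mk]
    linear_combination -h1 + (c.e α).im * Q.s * hq'
  · refine mul_right_cancel₀ hs0 ?_
    simp only [OrientedQuadraticRing.Chart.shift, shiftEquiv, AlgEquiv.trans_apply,
      AlgEquiv.coe_mk, Equiv.coe_fn_mk]
    linear_combination -h2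

end BalancedQuadruple

/-! ### The form determines `ι`, and the pair `α, β` up to a factor. -/

section QuadraticAlgebra

variable {K : Type*} [Field K] {p q : K}

/-- Nondegeneracy of the pairing `(w, z) ↦ im (wz)`: testing with `1` and `ω` suffices, whatever `p`
and `q` are. -/
theorem eq_zero_of_im_mul_eq_zero {z : QuadraticAlgebra K p q} (h : ∀ w, (w * z).im = 0) :
    z = 0 := by
  have h0 := h 1
  have h1 := h ⟨0, 1⟩
  rw [one_mul] at h0
  simp [h0] at h1
  ext
  · exact h1
  · exact h0

/-- The element `ι` is determined by the form `im (ζ³ ι)` in the coordinates `α, β`. -/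
theorem imForm_injective {α β ι ι' : QuadraticAlgebra K p q}
    (hspan : ∀ z, ∃ x y : K, z = x • α + y • β) (h : imForm α β ι = imForm α β ι') : ι = ι' := by
  rw [CubicForm.ext_iff] at h
  obtain ⟨ha, hb, hc, hd⟩ := h
  simp only [imForm] at ha hb hc hd
  -- With `w` running through `α², αβ, β²`, the hypotheses are consecutive coefficients of the two
  -- forms. Then `1 = (xα + yβ)²` is a combination of these three `w`.
  have key : ∀ w, (α * w * (ι - ι')).im = 0 → (β * w * (ι - ι')).im = 0 → w * (ι - ι') = 0 := by
    intro w h1 h2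
    refine eq_zero_of_im_mul_eq_zero fun z => ?_
    obtain ⟨x, y, rfl⟩ := hspan z
    have : (x • α + y • β) * (w * (ι - ι')) =
        x • (α * w * (ι - ι')) + y • (β * w * (ι - ι')) := by
      simp only [Algebra.smul_def]; ring
    rw [this, QuadraticAlgebra.im_add, QuadraticAlgebra.im_smul, QuadraticAlgebra.im_smul, h1, h2,
      smul_zero, smul_zero, add_zero]
  have e : ∀ {u v : QuadraticAlgebra K p q}, u * (ι - ι') = v * ι - v * ι' →
      (v * ι).im = (v * ι').im → (u * (ι - ι')).im = 0 := by
    intro u v h1 h2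
    rw [h1, QuadraticAlgebra.im_sub, h2, sub_self]
  have h1 := key (α * α) (e (by ring) ha) (e (by ring) hb)
  have h2 := key (α * β) (e (by ring) hb) (e (by ring) hc)
  have h3 := key (β * β) (e (by ring) hc) (e (by ring) hd)
  obtain ⟨x, y, h⟩ := hspan 1
  rw [← sub_eq_zero]
  calc ι - ι' = 1 * 1 * (ι - ι') := by ring
    _ = x • x • (α * α * (ι - ι')) + (2 * x * y) • (α * β * (ι - ι'))
        + y • y • (β * β * (ι - ι')) := by
      rw [h]
      simp only [Algebra.smul_def, map_mul, map_ofNat]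
      ring
    _ = 0 := by rw [h1, h2, h3]; simp

/-- Two bases on which `ω` acts by the same matrix differ by a scalar of the quadratic algebra. -/
theorem exists_mul_eq {h₀ h₁ h₂ s : K} {α β α' β' : QuadraticAlgebra K (-(h₀ * h₂)) h₁}
    (hs : α.re * β.im - α.im * β.re = s) (hs0 : s ≠ 0)
    (hα : α.re = h₀ * β.im - h₁ * α.im) (hβ : β.re = -h₂ * α.im)
    (hα' : α'.re = h₀ * β'.im - h₁ * α'.im) (hβ' : β'.re = -h₂ * α'.im) :
    ∃ κ, κ * α = α' ∧ κ * β = β' := by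
  rw [hα, hβ] at hs
  -- By the relations, `β.im • α - α.im • β = s`. A factor `κ` with `κα = α'` and `κβ = β'` is
  -- therefore necessarily this one.
  refine ⟨s⁻¹ • (β.im • α' - α.im • β'), ?_, ?_⟩
  · ext <;> simp [hα, hα', hβ'] <;> field_simp <;> rw [← hs] <;> ring
  · ext <;> simp [hβ, hα', hβ'] <;> field_simp <;> rw [← hs] <;> ring

theorem wedge_mul_eq (κ α β : QuadraticAlgebra K p q) :
    (κ * α).re * (κ * β).im - (κ * α).im * (κ * β).re =
      κ.norm * (α.re * β.im - α.im * β.re) := by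
  simp [QuadraticAlgebra.norm_def]
  ring

end QuadraticAlgebra

/-! ### Transport of wedge products and lattices along isomorphisms. -/

namespace OrientedQuadraticRing

variable {R K : Type u} [CommRing R] [Field K] [Algebra R K] {𝔞 : FractionalIdeal R⁰ K}
  {A A' : OrientedQuadraticRing R K 𝔞}

theorem wedgeK_one_tmul (x y : A.S) : A.wedgeK (1 ⊗ₜ x) (1 ⊗ₜ y) = A.wedge x y := by
  rw [wedgeK_tmul, one_mul, one_mul]

theorem extend_one_tmul (φ : A.S ≃ₐ[R] A'.S) (a : A.S) :
    (extend φ : A.L ≃ₐ[K] A'.L) (1 ⊗ₜ a) = 1 ⊗ₜ φ a := by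
  simp [extend]

theorem wedgeK_extend {φ : A.S ≃ₐ[R] A'.S} (hφ : ∀ x y, A'.wedge (φ x) (φ y) = A.wedge x y)
    (x y : A.L) :
    A'.wedgeK ((extend φ : A.L ≃ₐ[K] A'.L) x) ((extend φ : A.L ≃ₐ[K] A'.L) y) = A.wedgeK x y := by
  induction x using TensorProduct.induction_on with
  | zero => simp
  | add x x' hx hx' => simp only [map_add, LinearMap.add_apply, hx, hx']
  | tmul k a =>
    induction y using TensorProduct.induction_on with
    | zero => simp
    | add y y' hy hy' => simp only [map_add, hy, hy']
    | tmul k' a' =>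
      have h : ∀ (k : K) (a : A.S), (extend φ : A.L ≃ₐ[K] A'.L) (k ⊗ₜ a) = k ⊗ₜ φ a := fun k a => by
        simp [extend]
      rw [h, h, wedgeK_tmul, wedgeK_tmul, hφ]

theorem Chart.wedgeK_mul_mul {p q : K} (c : A.Chart p q) (κ x y : A.L) :
    A.wedgeK (κ * x) (κ * y) = Algebra.norm K κ * A.wedgeK x y := by
  rw [c.wedgeK_eq, c.wedgeK_eq, map_mul, map_mul, wedge_mul_eq, c.norm_eq]

theorem scale_map_decomp (φ : A.S ≃ₐ[R] A'.S) (κ : A'.L) (α β : A.L) :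
    scale κ ((decomp 𝔞 α β).map ((extend φ : A.L ≃ₐ[K] A'.L).toLinearMap.restrictScalars R)) =
      decomp 𝔞 (κ * (extend φ : A.L ≃ₐ[K] A'.L) α) (κ * (extend φ : A.L ≃ₐ[K] A'.L) β) := by
  ext x
  rw [BalancedQuadruple.mem_scale_map, mem_decomp]
  constructor
  · rintro ⟨v, hv, rfl⟩
    obtain ⟨x, hx, y, hy, rfl⟩ := mem_decomp.1 hv
    exact ⟨x, hx, y, hy, by simp [mul_add]⟩
  · rintro ⟨x, hx, y, hy, rfl⟩
    exact ⟨_, mem_decomp.2 ⟨x, hx, y, hy, rfl⟩, by simp [mul_add]⟩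

theorem smul_add_smul_mem_decomp {α β : A.L} (h : A.wedgeK α β ≠ 0) {x y : K} :
    x • α + y • β ∈ decomp 𝔞 α β ↔ x ∈ (1 : FractionalIdeal R⁰ K) ∧ y ∈ 𝔞 := by
  obtain ⟨b, rfl, rfl⟩ := exists_basis h
  rw [mem_decomp_basis]
  have e0 : b.repr (x • b 0 + y • b 1) 0 = x := by simp
  have e1 : b.repr (x • b 0 + y • b 1) 1 = y := by simp
  rw [e0, e1]

variable [IsDedekindDomain R] [IsFractionRing R K]

theorem one_tmul_injective (A : OrientedQuadraticRing R K 𝔞) :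
    Function.Injective (Algebra.TensorProduct.includeRight : A.S →ₐ[R] A.L) := by
  have : Module.Finite R A.S := A.finite
  have : Module.IsTorsionFree R A.S := A.torsionFree
  exact Algebra.TensorProduct.includeRight_injective (IsFractionRing.injective R K)

/-- An isomorphism of the algebras `L`, `L'` that maps `S` to `S'` restricts to an isomorphism. -/
theorem exists_extend_eq (E : A.L ≃ₐ[K] A'.L) (hE : ∀ x, x ∈ A.lattice ↔ E x ∈ A'.lattice) :
    ∃ φ : A.S ≃ₐ[R] A'.S, ∀ x, (extend φ : A.L ≃ₐ[K] A'.L) x = E x := by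
  have hsurj : ∀ a : A.S, ∃ a' : A'.S, (1 : K) ⊗ₜ[R] a' = E (1 ⊗ₜ a) := fun a =>
    A'.exists_mem_lattice.1 ((hE _).1 (A.one_tmul_mem_lattice a))
  choose g hg using hsurj
  have hinj' : ∀ {x y : A'.S}, (1 : K) ⊗ₜ[R] x = 1 ⊗ₜ y → x = y := fun h =>
    A'.one_tmul_injective h
  let φ₀ : A.S →ₐ[R] A'.S :=
    { toFun := g
      map_one' := hinj' (by rw [hg, ← Algebra.TensorProduct.one_def, map_one,
        ← Algebra.TensorProduct.one_def])
      map_mul' := fun x y => hinj' (by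
        rw [hg, ← one_mul (1 : K), ← Algebra.TensorProduct.tmul_mul_tmul, map_mul, ← hg, ← hg,
          Algebra.TensorProduct.tmul_mul_tmul])
      map_zero' := hinj' (by rw [hg, TensorProduct.tmul_zero, map_zero, TensorProduct.tmul_zero])
      map_add' := fun x y => hinj' (by
        rw [hg, TensorProduct.tmul_add, map_add, ← hg, ← hg, TensorProduct.tmul_add])
      commutes' := fun r => hinj' (by
        rw [hg, Algebra.algebraMap_eq_smul_one, Algebra.algebraMap_eq_smul_one,
          ← TensorProduct.smul_tmul, ← TensorProduct.smul_tmul, Algebra.smul_def, mul_one,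
          ← Algebra.TensorProduct.algebraMap_apply, ← Algebra.TensorProduct.algebraMap_apply]
        exact (E.restrictScalars R).commutes r) }
  have hφ₀ : Function.Bijective φ₀ := by
    refine ⟨fun x y hxy => A.one_tmul_injective (E.injective ?_), fun y => ?_⟩
    · change E (1 ⊗ₜ x) = E (1 ⊗ₜ y)
      rw [← hg, ← hg]
      exact congrArg _ hxy
    · have h1 : E.symm (1 ⊗ₜ y) ∈ A.lattice := by
        rw [hE, AlgEquiv.apply_symm_apply]
        exact A'.one_tmul_mem_lattice y
      obtain ⟨x, hx⟩ := A.exists_mem_lattice.1 h1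
      refine ⟨x, hinj' ?_⟩
      change (1 : K) ⊗ₜ[R] g x = _
      rw [hg, hx, AlgEquiv.apply_symm_apply]
  refine ⟨AlgEquiv.ofBijective φ₀ hφ₀, fun x => ?_⟩
  induction x using TensorProduct.induction_on with
  | zero => simp
  | add x y hx hy => rw [map_add, map_add, hx, hy]
  | tmul k a =>
    have : (k ⊗ₜ[R] a : A.L) = k • ((1 : K) ⊗ₜ[R] a) := by simp [TensorProduct.smul_tmul']
    rw [this, map_smul, map_smul, extend_one_tmul]
    congr 1
    exact hg a

end OrientedQuadraticRing

/-! ### Change of basis, orbits and equivalence. -/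

namespace BalancedQuadruple

open OrientedQuadraticRing

variable {R K : Type u} [CommRing R] [Field K] [Algebra R K] {𝔞 : FractionalIdeal R⁰ K}
  {Q Q' : BalancedQuadruple R K 𝔞}

theorem form_smul {α β : Q.L} (g : Matrix.SpecialLinearGroup (Fin 2) K) :
    Q.form (g 0 0 • α + g 0 1 • β) (g 1 0 • α + g 1 1 • β) = g • Q.form α β := by
  have key : ∀ k₀ k₁ k₂ k₃ : K,
      Q.wedgeK 1 (k₀ • (α ^ 3 * (↑Q.δ⁻¹ : Q.L)) + k₁ • (α ^ 2 * β * (↑Q.δ⁻¹ : Q.L)) +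
        k₂ • (α * β ^ 2 * (↑Q.δ⁻¹ : Q.L)) + k₃ • (β ^ 3 * (↑Q.δ⁻¹ : Q.L))) =
      k₀ * (Q.form α β).a + k₁ * (Q.form α β).b + k₂ * (Q.form α β).c + k₃ * (Q.form α β).d := by
    intro k₀ k₁ k₂ k₃
    simp only [map_add, map_smul, smul_eq_mul, form]
  have hsm : ∀ (k : K) (x : Q.L), k • x = algebraMap K Q.L k * x := fun k x => Algebra.smul_def k x
  rw [CubicForm.smul_def]
  ext
  · refine Eq.trans (congrArg (Q.wedgeK 1) ?_) ((key (g 0 0 ^ 3) (3 * g 0 0 ^ 2 * g 0 1)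
      (3 * g 0 0 * g 0 1 ^ 2) (g 0 1 ^ 3)).trans ?_)
    on_goal 2 => ring
    simp only [hsm, map_mul, map_pow, map_ofNat]
    ring
  · refine Eq.trans (congrArg (Q.wedgeK 1) ?_) ((key (g 0 0 ^ 2 * g 1 0)
      (g 0 0 ^ 2 * g 1 1 + 2 * g 0 0 * g 0 1 * g 1 0)
      (g 0 1 ^ 2 * g 1 0 + 2 * g 0 0 * g 0 1 * g 1 1) (g 0 1 ^ 2 * g 1 1)).trans ?_)
    on_goal 2 => ring
    simp only [hsm, map_mul, map_pow, map_ofNat, map_add]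
    ring
  · refine Eq.trans (congrArg (Q.wedgeK 1) ?_) ((key (g 0 0 * g 1 0 ^ 2)
      (g 1 0 ^ 2 * g 0 1 + 2 * g 0 0 * g 1 0 * g 1 1)
      (g 0 0 * g 1 1 ^ 2 + 2 * g 0 1 * g 1 0 * g 1 1) (g 0 1 * g 1 1 ^ 2)).trans ?_)
    on_goal 2 => ring
    simp only [hsm, map_mul, map_pow, map_ofNat, map_add]
    ring
  · refine Eq.trans (congrArg (Q.wedgeK 1) ?_) ((key (g 1 0 ^ 3) (3 * g 1 0 ^ 2 * g 1 1)
      (3 * g 1 0 * g 1 1 ^ 2) (g 1 1 ^ 3)).trans ?_)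
    on_goal 2 => ring
    simp only [hsm, map_mul, map_pow, map_ofNat]
    ring

variable [IsDedekindDomain R] [IsFractionRing R K]

/-- Bases may be transported along equivalences without changing the form. -/
theorem Equivalent.exists_isBasis (h𝔞 : 𝔞 ≠ 0) (h : Q.Equivalent Q') {α β : Q.L}
    (hb : Q.IsBasis α β) : ∃ α' β', Q'.IsBasis α' β' ∧ Q'.form α' β' = Q.form α β := by
  obtain ⟨φ, κ, hφ, hI, hδ, hs⟩ := h
  obtain ⟨p, q, ⟨c⟩⟩ := Q'.exists_chart h𝔞
  set E : Q.L ≃ₐ[K] Q'.L := extend φ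
  -- The factor `κ³` coming from the cube of `κφ(ζ)` cancels against `δ' = κ³φ(δ)`, so the form does
  -- not change.
  have hκ : κ ^ 3 * (↑Q'.δ⁻¹ : Q'.L) = E (↑Q.δ⁻¹ : Q.L) := by
    have h1 : E (Q.δ : Q.L) * E (↑Q.δ⁻¹ : Q.L) = 1 := by rw [← map_mul, Units.mul_inv, map_one]
    have h2 : κ ^ 3 * E (Q.δ : Q.L) * (↑Q'.δ⁻¹ : Q'.L) = 1 := by rw [← hδ, Units.mul_inv]
    calc κ ^ 3 * (↑Q'.δ⁻¹ : Q'.L) =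
        (κ ^ 3 * (↑Q'.δ⁻¹ : Q'.L)) * (E (Q.δ : Q.L) * E (↑Q.δ⁻¹ : Q.L)) := by rw [h1, mul_one]
      _ = (κ ^ 3 * E (Q.δ : Q.L) * (↑Q'.δ⁻¹ : Q'.L)) * E (↑Q.δ⁻¹ : Q.L) := by ring
      _ = E (↑Q.δ⁻¹ : Q.L) := by rw [h2, one_mul]
  have hw : ∀ z : Q.L, Q'.wedgeK 1 (E z) = Q.wedgeK 1 z := fun z => by
    rw [← map_one E]
    exact wedgeK_extend hφ 1 z
  refine ⟨κ * E α, κ * E β, ⟨?_, ?_⟩, ?_⟩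
  · rw [hI, hb.1]
    exact scale_map_decomp φ κ α β
  · rw [c.wedgeK_mul_mul, hs, ← hb.2]
    congr 1
    exact wedgeK_extend hφ α β
  · ext <;> simp only [form] <;> rw [← hw] <;> congr 1 <;>
      simp only [map_mul, map_pow, ← hκ] <;> ring

theorem decomp_smul_le {α β : Q.L} {g : Matrix.SpecialLinearGroup (Fin 2) K} (hg : g ∈ SLa 𝔞) :
    decomp 𝔞 (g 0 0 • α + g 0 1 • β) (g 1 0 • α + g 1 1 • β) ≤ decomp 𝔞 α β := by
  obtain ⟨h00, h01, h10, h11⟩ := hg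
  intro v hv
  obtain ⟨x, hx, y, hy, rfl⟩ := mem_decomp.1 hv
  refine mem_decomp.2 ⟨x * g 0 0 + y * g 1 0, mem_add (one_mul_mem hx h00) (mul_inv_mem hy h10),
    x * g 0 1 + y * g 1 1, mem_add (one_mul_mem hx h01) (mul_one_mem hy h11), ?_⟩
  module

theorem IsBasis.smul {α β : Q.L} (hb : Q.IsBasis α β)
    {g : Matrix.SpecialLinearGroup (Fin 2) K} (hg : g ∈ SLa 𝔞) :
    Q.IsBasis (g 0 0 • α + g 0 1 • β) (g 1 0 • α + g 1 1 • β) := by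
  have hdet := Matrix.SpecialLinearGroup.det_coe g
  rw [Matrix.det_fin_two] at hdet
  refine ⟨?_, ?_⟩
  · rw [hb.1]
    refine le_antisymm ?_ (decomp_smul_le hg)
    have := decomp_smul_le (Q := Q) (α := g 0 0 • α + g 0 1 • β) (β := g 1 0 • α + g 1 1 • β)
      (inv_mem hg)
    convert! this using 2
    · simp only [Matrix.SpecialLinearGroup.coe_inv, Matrix.adjugate_fin_two, Matrix.of_apply,
        Matrix.cons_val', Matrix.cons_val_zero, Matrix.cons_val_one, Matrix.cons_val_fin_one]
      match_scalars
      · linear_combination -hdet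
      · ring
    · simp only [Matrix.SpecialLinearGroup.coe_inv, Matrix.adjugate_fin_two, Matrix.of_apply,
        Matrix.cons_val', Matrix.cons_val_zero, Matrix.cons_val_one, Matrix.cons_val_fin_one]
      match_scalars
      · linear_combination -hdet
      · ring
  · simp only [map_add, map_smul, LinearMap.add_apply, LinearMap.smul_apply, wedgeK_self,
      smul_eq_mul, Q.wedgeK_swap β α, hb.2]
    linear_combination (Q.s : K) * hdet

/-- The forms of a quadruple in two bases are in the same orbit. -/
theorem IsBasis.exists_smul_form_eq (h𝔞 : 𝔞 ≠ 0) {α β α' β' : Q.L} (hb : Q.IsBasis α β)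
    (hb' : Q.IsBasis α' β') : ∃ g ∈ SLa 𝔞, g • Q.form α β = Q.form α' β' := by
  obtain ⟨x, y, hα'⟩ := exists_eq_smul_add_smul hb.wedgeK_ne_zero α'
  obtain ⟨u, v, hβ'⟩ := exists_eq_smul_add_smul hb.wedgeK_ne_zero β'
  have h1 := hb'.mem_left
  rw [hb.1, hα', smul_add_smul_mem_decomp hb.wedgeK_ne_zero] at h1
  have h2 : ∀ t ∈ 𝔞, t * u ∈ (1 : FractionalIdeal R⁰ K) ∧ t * v ∈ 𝔞 := by
    intro t ht
    have := hb'.smul_mem ht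
    rwa [hb.1, hβ', smul_add, smul_smul, smul_smul,
      smul_add_smul_mem_decomp hb.wedgeK_ne_zero] at this
  -- Both bases have wedge `s`, so the determinant of the change of basis is exactly `1` and not
  -- merely a unit.
  have hdet : x * v - y * u = 1 := by
    have := hb'.2
    rw [hα', hβ'] at this
    simp only [map_add, map_smul, LinearMap.add_apply, LinearMap.smul_apply, wedgeK_self,
      smul_eq_mul, Q.wedgeK_swap β α, hb.2] at this
    refine mul_right_cancel₀ Q.s.ne_zero ?_
    linear_combination this
  let g : Matrix.SpecialLinearGroup (Fin 2) K := ⟨!![x, y; u, v], by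
    rw [Matrix.det_fin_two]; simpa using hdet⟩
  refine ⟨g, ⟨h1.1, h1.2, mem_inv_of_forall h𝔞 fun t ht => (h2 t ht).1,
    mem_one_of_forall h𝔞 fun t ht => (h2 t ht).2⟩, ?_⟩
  rw [← form_smul, hα', hβ']
  rfl

/-- Quadruples with the same form are equivalent. -/
theorem equivalent_of_form_eq (h𝔞 : 𝔞 ≠ 0) {α β : Q.L} {α' β' : Q'.L} (hb : Q.IsBasis α β)
    (hb' : Q'.IsBasis α' β') {f : CubicForm K} (h : Q.form α β = f)
    (h' : Q'.form α' β' = f) : Q.Equivalent Q' := by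
  obtain ⟨c, hc1, hc2⟩ := hb.exists_chart h𝔞 h
  obtain ⟨c', hc1', hc2'⟩ := hb'.exists_chart h𝔞 h'
  -- Both charts map to the same algebra `f.Model`, with the same image of the lattice, so the
  -- identity in coordinates restricts to an isomorphism of the rings.
  obtain ⟨φ, hφ⟩ := exists_extend_eq (c.e.trans c'.e.symm) fun x => by
    rw [c.mem_lattice, c'.mem_lattice]
    simp
  have hφ' : ∀ x, c'.e ((extend φ : Q.L ≃ₐ[K] Q'.L) x) = c.e x := fun x => by
    rw [hφ]; simp
  have hs : (c.e α).re * (c.e β).im - (c.e α).im * (c.e β).re = Q.s := by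
    rw [← c.wedgeK_eq, hb.2]
  have hs' : (c'.e α').re * (c'.e β').im - (c'.e α').im * (c'.e β').re = Q'.s := by
    rw [← c'.wedgeK_eq, hb'.2]
  obtain ⟨κ, hκα, hκβ⟩ := exists_mul_eq hs Q.s.ne_zero hc1 hc2 hc1' hc2'
  refine ⟨φ, c'.e.symm κ, fun x y => ?_, ?_, ?_, ?_⟩
  · rw [← wedgeK_one_tmul, ← wedgeK_one_tmul, ← extend_one_tmul (K := K),
      ← extend_one_tmul (K := K),
      c.wedgeK_eq, c'.wedgeK_eq, hφ', hφ']
  · rw [hb.1, scale_map_decomp, hb'.1]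
    congr 1
    · apply c'.e.injective
      rw [map_mul, hφ', AlgEquiv.apply_symm_apply, hκα]
    · apply c'.e.injective
      rw [map_mul, hφ', AlgEquiv.apply_symm_apply, hκβ]
  · have hι : c.e (↑Q.δ⁻¹ : Q.L) = κ ^ 3 * c'.e (↑Q'.δ⁻¹ : Q'.L) := by
      refine imForm_injective (α := c.e α) (β := c.e β) (fun z => ?_) ?_
      · obtain ⟨x, y, hz⟩ := exists_eq_smul_add_smul hb.wedgeK_ne_zero (c.e.symm z)
        refine ⟨x, y, ?_⟩
        rw [← c.e.apply_symm_apply z, hz]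
        simp
      · refine (Q.form_eq_imForm c α β).symm.trans (h.trans (h'.symm.trans
          ((Q'.form_eq_imForm c' α' β').trans ?_)))
        rw [← hκα, ← hκβ]
        ext <;> simp only [imForm] <;> congr 1 <;> ring
    apply c'.e.injective
    rw [map_mul, map_pow, hφ', AlgEquiv.apply_symm_apply]
    have h1 : c.e (Q.δ : Q.L) * c.e (↑Q.δ⁻¹ : Q.L) = 1 := by
      rw [← map_mul, Units.mul_inv, map_one]
    have h2 : c'.e (Q'.δ : Q'.L) * c'.e (↑Q'.δ⁻¹ : Q'.L) = 1 := by
      rw [← map_mul, Units.mul_inv, map_one]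
    calc c'.e (Q'.δ : Q'.L) = c'.e (Q'.δ : Q'.L) * (c.e (Q.δ : Q.L) * c.e (↑Q.δ⁻¹ : Q.L)) := by
          rw [h1, mul_one]
      _ = κ ^ 3 * c.e (Q.δ : Q.L) * (c'.e (Q'.δ : Q'.L) * c'.e (↑Q'.δ⁻¹ : Q'.L)) := by
          rw [hι]; ring
      _ = κ ^ 3 * c.e (Q.δ : Q.L) := by rw [h2, mul_one]
  · rw [c'.norm_eq, AlgEquiv.apply_symm_apply, ← hs, ← wedge_mul_eq, hκα, hκβ, hs']

end BalancedQuadruple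

/-! ### The exterior square, and the oriented ring `R + 𝔞ω` with given `p, q`. -/

section Exterior

variable {R M N : Type*} [CommRing R] [AddCommGroup M] [Module R M] [AddCommGroup N] [Module R N]

/-- The alternating map given by an alternating bilinear map. -/
def altOfBilin (B : M →ₗ[R] M →ₗ[R] N) (hB : ∀ x, B x x = 0) : M [⋀^Fin 2]→ₗ[R] N where
  toFun v := B (v 0) (v 1)
  map_update_add' v i x y := by
    fin_cases i <;> simp [Function.update]
  map_update_smul' v i c x := by
    fin_cases i <;> simp [Function.update]
  map_eq_zero_of_eq' v i j h hij := by
    have : v 0 = v 1 := by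
      fin_cases i <;> fin_cases j <;> first | exact absurd rfl hij | exact h | exact h.symm
    rw [this, hB]

/-- The wedge product `(x, y) ↦ x ∧ y` as a bilinear map. -/
def wedgeMap : M →ₗ[R] M →ₗ[R] ⋀[R]^2 M :=
  LinearMap.mk₂ R (fun x y => exteriorPower.ιMulti R 2 ![x, y])
    (fun x x' y => by
      have h := (exteriorPower.ιMulti R 2 (M := M)).map_update_add ![x, y] 0 x x'
      have e : ∀ z, Function.update ![x, y] 0 z = ![z, y] := by
        intro z; ext i; fin_cases i <;> simp
      simpa only [e] using h)
    (fun c x y => by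
      have h := (exteriorPower.ιMulti R 2 (M := M)).map_update_smul ![x, y] 0 c x
      have e : ∀ z, Function.update ![x, y] 0 z = ![z, y] := by
        intro z; ext i; fin_cases i <;> simp
      simpa only [e] using h)
    (fun x y y' => by
      have h := (exteriorPower.ιMulti R 2 (M := M)).map_update_add ![x, y] 1 y y'
      have e : ∀ z, Function.update ![x, y] 1 z = ![x, z] := by
        intro z; ext i; fin_cases i <;> simp
      simpa only [e] using h)
    (fun c x y => by
      have h := (exteriorPower.ιMulti R 2 (M := M)).map_update_smul ![x, y] 1 c y
      have e : ∀ z, Function.update ![x, y] 1 z = ![x, z] := by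
        intro z; ext i; fin_cases i <;> simp
      simpa only [e] using h)

theorem wedgeMap_apply (x y : M) : wedgeMap x y = exteriorPower.ιMulti R 2 ![x, y] := rfl

theorem wedgeMap_self (x : M) : wedgeMap (R := R) x x = 0 := by
  rw [wedgeMap_apply]
  exact (exteriorPower.ιMulti R 2 (M := M)).map_eq_zero_of_eq ![x, x] (i := 0) (j := 1) (by simp)
    (by simp)

theorem wedgeMap_swap (x y : M) : wedgeMap (R := R) x y = -wedgeMap y x := by
  have h := wedgeMap_self (R := R) (x + y)
  simp only [map_add, LinearMap.add_apply, wedgeMap_self, zero_add, add_zero] at h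
  exact eq_neg_of_add_eq_zero_right h

end Exterior

section Order

variable {R K : Type u} [CommRing R] [IsDedekindDomain R] [Field K] [Algebra R K]
  [IsFractionRing R K] {𝔞 : FractionalIdeal R⁰ K} {p q : K}

/-- The order `R + 𝔞 ω` of `K[ω]`, where `ω² = p + q ω`. -/
def order (hp : p ∈ 𝔞⁻¹ ^ 2) (hq : q ∈ 𝔞⁻¹) : Subalgebra R (QuadraticAlgebra K p q) where
  carrier := {z | z.re ∈ (1 : FractionalIdeal R⁰ K) ∧ z.im ∈ 𝔞}
  mul_mem' := by
    rintro z w ⟨hz0, hz1⟩ ⟨hw0, hw1⟩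
    refine ⟨mem_add (one_mul_mem hz0 hw0) ?_, mem_add (mem_add (one_mul_mem hz0 hw1)
      (mul_one_mem hz1 hw0)) ?_⟩
    · rw [mul_assoc, mul_comm]
      exact mem_sq_of_mem hz1 hw1 hp
    · exact mul_mem_of_le (one_mul 𝔞).le (by rw [mul_comm]; exact mul_inv_mem hz1 hq) hw1
  add_mem' := fun hz hw => ⟨mem_add hz.1 hw.1, mem_add hz.2 hw.2⟩
  algebraMap_mem' r := ⟨algebraMap_mem_one r, FractionalIdeal.zero_mem _⟩

variable (hp : p ∈ 𝔞⁻¹ ^ 2) (hq : q ∈ 𝔞⁻¹)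

theorem mem_order {z : QuadraticAlgebra K p q} :
    z ∈ order hp hq ↔ z.re ∈ (1 : FractionalIdeal R⁰ K) ∧ z.im ∈ 𝔞 := Iff.rfl

/-- The element `t ω` of the order `R + 𝔞 ω`. -/
def orderIm : (𝔞 : Submodule R K) →ₗ[R] order hp hq where
  toFun t := ⟨⟨0, t⟩, FractionalIdeal.zero_mem _, t.2⟩
  map_add' x y := by ext <;> simp
  map_smul' r x := by ext <;> simp

theorem decomp_fg {V : Type*} [AddCommGroup V] [Module R V] [Module K V] [IsScalarTower R K V]
    (α β : V) : (decomp 𝔞 α β).FG :=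
  (Submodule.fg_span_singleton α).sup ((FractionalIdeal.fg_of_isNoetherianRing le_rfl 𝔞).map _)

instance : Module.Finite R (order hp hq) := by
  have h : Subalgebra.toSubmodule (order hp hq) = decomp 𝔞 1 ⟨0, 1⟩ := by
    ext z
    rw [Subalgebra.mem_toSubmodule, mem_order, mem_decomp]
    constructor
    · rintro ⟨h0, h1⟩
      exact ⟨_, h0, _, h1, by ext <;> simp⟩
    · rintro ⟨x, hx, y, hy, rfl⟩
      have e0 : (x • (1 : QuadraticAlgebra K p q) + y • ⟨0, 1⟩).re = x := by simp
      have e1 : (x • (1 : QuadraticAlgebra K p q) + y • ⟨0, 1⟩).im = y := by simp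
      rw [e0, e1]
      exact ⟨hx, hy⟩
  exact Module.Finite.iff_fg.2 (h ▸ decomp_fg _ _)

/-- The canonical map from the base change of the order to `K[ω]`. -/
def orderMap : K ⊗[R] order hp hq →ₐ[K] QuadraticAlgebra K p q :=
  Algebra.TensorProduct.lift (Algebra.ofId K _) (order hp hq).val fun _ _ => Commute.all _ _

theorem orderMap_tmul (k : K) (a : order hp hq) : orderMap hp hq (k ⊗ₜ a) = k • (a : _) := by
  rw [orderMap, Algebra.TensorProduct.lift_tmul, Algebra.smul_def]
  rfl

theorem exists_smul_eq_one_tmul {S : Type u} [AddCommGroup S] [Module R S] (z : K ⊗[R] S) :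
    ∃ r : R, r ≠ 0 ∧ ∃ a : S, r • z = 1 ⊗ₜ a := by
  have h : z ∈ Submodule.span K
      ((LinearMap.range (TensorProduct.mk R K S 1) : Submodule R (K ⊗[R] S)) : Set _) := by
    induction z using TensorProduct.induction_on with
    | zero => exact Submodule.zero_mem _
    | add x y hx hy => exact Submodule.add_mem _ hx hy
    | tmul k a =>
      have : (k ⊗ₜ[R] a) = k • ((1 : K) ⊗ₜ[R] a) := by simp [TensorProduct.smul_tmul']
      rw [this]
      exact Submodule.smul_mem _ _ (Submodule.subset_span ⟨a, rfl⟩)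
  obtain ⟨r, hr, a, ha⟩ := exists_smul_mem_of_mem_span (R := R) h
  exact ⟨r, hr, a, ha.symm⟩

theorem orderMap_bijective (h𝔞 : 𝔞 ≠ 0) : Function.Bijective (orderMap hp hq) := by
  constructor
  · rw [injective_iff_map_eq_zero]
    intro z hz
    obtain ⟨r, hr, a, ha⟩ := exists_smul_eq_one_tmul z
    rw [← algebraMap_smul K r] at ha
    have h1 := congrArg (orderMap hp hq) ha
    rw [map_smul, hz, smul_zero, orderMap_tmul, one_smul] at h1
    have h2 : a = 0 := Subtype.ext h1.symm
    rw [h2, TensorProduct.tmul_zero] at ha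
    exact (smul_eq_zero.1 ha).resolve_left (by simpa using hr)
  · intro z
    obtain ⟨t, ht, ht0⟩ : ∃ t ∈ 𝔞, t ≠ 0 := by
      by_contra! h
      exact h𝔞 (FractionalIdeal.eq_zero_iff.2 h)
    refine ⟨z.re ⊗ₜ 1 + (z.im / t) ⊗ₜ orderIm hp hq ⟨t, ht⟩, ?_⟩
    rw [map_add, orderMap_tmul, orderMap_tmul]
    ext <;> simp [orderIm, ht0]

theorem re_mul_im_sub_mem (z w : order hp hq) :
    z.1.re * w.1.im - z.1.im * w.1.re ∈ 𝔞 :=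
  mem_sub (one_mul_mem z.2.1 w.2.2) (mul_one_mem z.2.2 w.2.1)

/-- The determinant pairing on the order `R + 𝔞 ω`. -/
def orderPairing : order hp hq →ₗ[R] order hp hq →ₗ[R] (𝔞 : Submodule R K) :=
  LinearMap.mk₂ R (fun z w => ⟨z.1.re * w.1.im - z.1.im * w.1.re, re_mul_im_sub_mem hp hq z w⟩)
    (fun z z' w => by ext; simp; ring)
    (fun c z w => by ext; simp [smul_sub])
    (fun z w w' => by ext; simp; ring)
    (fun c z w => by ext; simp [smul_sub])

theorem orderPairing_apply (z w : order hp hq) :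
    (orderPairing hp hq z w : K) = z.1.re * w.1.im - z.1.im * w.1.re := rfl

/-- The exterior square of an invertible ideal vanishes. -/
theorem wedgeMap_orderIm (h𝔞 : 𝔞 ≠ 0) (y y' : (𝔞 : Submodule R K)) :
    wedgeMap (R := R) (orderIm hp hq y) (orderIm hp hq y') = 0 := by
  obtain ⟨m, hm, n, hn, r, hr, t, ht, h1⟩ := exists_det_one h𝔞 h𝔞
  have key : ∀ y : (𝔞 : Submodule R K), ∃ c d : R, algebraMap R K c = y * t ∧
      algebraMap R K d = y * r ∧ y = c • (⟨m, hm⟩ : (𝔞 : Submodule R K)) - d • ⟨n, hn⟩ := by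
    intro y
    obtain ⟨c, hc⟩ := (FractionalIdeal.mem_one_iff R⁰).1 (mul_inv_mem (I := 𝔞) y.2 ht)
    obtain ⟨d, hd⟩ := (FractionalIdeal.mem_one_iff R⁰).1 (mul_inv_mem (I := 𝔞) y.2 hr)
    refine ⟨c, d, hc, hd, ?_⟩
    ext
    simp only [Submodule.coe_sub, Submodule.coe_smul, Algebra.smul_def, hc, hd]
    linear_combination (-(y : K)) * h1
  obtain ⟨c, d, hc, hd, e⟩ := key y
  obtain ⟨c', d', hc', hd', e'⟩ := key y'
  have h0 : d * c' - c * d' = 0 := by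
    apply IsFractionRing.injective R K
    rw [map_sub, map_mul, map_mul, hc, hd, hc', hd', map_zero]
    ring
  rw [e, e']
  simp only [map_sub, map_smul, LinearMap.sub_apply, LinearMap.smul_apply, wedgeMap_self,
    smul_zero, zero_sub, sub_zero]
  rw [wedgeMap_swap (orderIm hp hq ⟨n, hn⟩) (orderIm hp hq ⟨m, hm⟩)]
  simp only [smul_neg, smul_smul, neg_neg]
  rw [← sub_smul, mul_comm c' d, mul_comm d' c, h0, zero_smul]

/-- The orientation of the order `R + 𝔞 ω` for which `1 ∧ ω` has image `1`. -/
theorem exists_orientation (h𝔞 : 𝔞 ≠ 0) :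
    ∃ e : ⋀[R]^2 (order hp hq) ≃ₗ[R] (𝔞 : Submodule R K),
      ∀ z w, e (exteriorPower.ιMulti R 2 ![z, w]) = orderPairing hp hq z w := by
  let D : ⋀[R]^2 (order hp hq) →ₗ[R] (𝔞 : Submodule R K) :=
    exteriorPower.alternatingMapLinearEquiv (altOfBilin (orderPairing hp hq) fun z => by
      ext
      rw [orderPairing_apply, mul_comm, sub_self]
      rfl)
  have hD : ∀ z w, D (exteriorPower.ιMulti R 2 ![z, w]) = orderPairing hp hq z w := fun z w => by
    simp [D, altOfBilin]
  let J : (𝔞 : Submodule R K) →ₗ[R] ⋀[R]^2 (order hp hq) :=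
    (wedgeMap (R := R) (1 : order hp hq)) ∘ₗ orderIm hp hq
  have hDJ : D ∘ₗ J = LinearMap.id := by
    ext t
    simp only [J, LinearMap.comp_apply, wedgeMap_apply, hD, orderPairing_apply, orderIm]
    simp
  -- For `z = x + yω` and `w = x' + y'ω` the terms `1 ∧ 1` and `yω ∧ y'ω` of `z ∧ w` vanish. What
  -- remains is `1 ∧ (xy' - yx')ω`, which is `J` of the determinant.
  have hJD : J ∘ₗ D = LinearMap.id := by
    refine exteriorPower.linearMap_ext ?_
    ext v : 1
    have hv : v = ![v 0, v 1] := by funext i; fin_cases i <;> rfl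
    rw [hv]
    generalize v 0 = z
    generalize v 1 = w
    simp only [LinearMap.compAlternatingMap_apply, LinearMap.comp_apply, hD, LinearMap.id_apply]
    rw [← wedgeMap_apply z w]
    have split : ∀ z : order hp hq, ∃ r : R, algebraMap R K r = z.1.re ∧
        z = r • 1 + orderIm hp hq ⟨z.1.im, z.2.2⟩ := by
      intro z
      obtain ⟨r, hr⟩ := (FractionalIdeal.mem_one_iff R⁰).1 z.2.1
      refine ⟨r, hr, ?_⟩
      ext <;> simp [orderIm, ← hr, Algebra.algebraMap_eq_smul_one]
    obtain ⟨x, hx, hz⟩ := split z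
    obtain ⟨x', hx', hw⟩ := split w
    have e : orderPairing hp hq z w =
        x • (⟨w.1.im, w.2.2⟩ : (𝔞 : Submodule R K)) - x' • ⟨z.1.im, z.2.2⟩ := by
      ext
      simp only [orderPairing_apply, Submodule.coe_sub, Submodule.coe_smul, Algebra.smul_def, hx,
        hx']
      ring
    conv_rhs => rw [hz, hw]
    rw [e]
    simp only [J, LinearMap.comp_apply, map_sub, map_add, map_smul, LinearMap.add_apply,
      LinearMap.smul_apply, wedgeMap_self, wedgeMap_orderIm hp hq h𝔞, smul_zero, zero_add, add_zero]
    rw [wedgeMap_swap (orderIm hp hq ⟨z.1.im, z.2.2⟩) 1]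
    module
  exact ⟨LinearEquiv.ofLinearMap D J hDJ hJD, hD⟩

/-- Every pair of admissible coefficients comes from an oriented quadratic ring. -/
theorem exists_orientedQuadraticRing (h𝔞 : 𝔞 ≠ 0) (hp : p ∈ 𝔞⁻¹ ^ 2) (hq : q ∈ 𝔞⁻¹) :
    ∃ A : OrientedQuadraticRing R K 𝔞, Nonempty (A.Chart p q) := by
  obtain ⟨o, ho⟩ := exists_orientation hp hq h𝔞
  let e : K ⊗[R] order hp hq ≃ₐ[K] QuadraticAlgebra K p q :=
    AlgEquiv.ofBijective (orderMap hp hq) (orderMap_bijective hp hq h𝔞)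
  have he : ∀ (k : K) (a : order hp hq), e (k ⊗ₜ a) = k • (a : QuadraticAlgebra K p q) :=
    orderMap_tmul hp hq
  let A : OrientedQuadraticRing R K 𝔞 :=
    { S := order hp hq
      rank_eq_two := by
        rw [e.toLinearEquiv.finrank_eq]
        exact QuadraticAlgebra.finrank_eq_two p q
      orientation := o }
  have hw : ∀ z w : order hp hq,
      OrientedQuadraticRing.wedge A z w = z.1.re * w.1.im - z.1.im * w.1.re := fun z w => by
    rw [OrientedQuadraticRing.wedge_apply, ← orderPairing_apply]
    exact congrArg _ (ho z w)
  refine ⟨A, ⟨e, fun x y => ?_, fun x => ?_⟩⟩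
  · induction x using TensorProduct.induction_on with
    | zero => simp
    | add x x' hx hx' =>
      simp only [map_add, LinearMap.add_apply, hx, hx', QuadraticAlgebra.re_add,
        QuadraticAlgebra.im_add]
      ring
    | tmul k a =>
      induction y using TensorProduct.induction_on with
      | zero => simp
      | add y y' hy hy' =>
        simp only [map_add, hy, hy', QuadraticAlgebra.re_add, QuadraticAlgebra.im_add]
        ring
      | tmul k' a' =>
        rw [OrientedQuadraticRing.wedgeK_tmul, hw]
        erw [he, he]
        simp only [QuadraticAlgebra.re_smul, QuadraticAlgebra.im_smul, smul_eq_mul]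
        ring
  · rw [OrientedQuadraticRing.exists_mem_lattice]
    constructor
    · rintro ⟨a, rfl⟩
      erw [he, one_smul]
      exact a.2
    · intro h
      refine ⟨(⟨e x, h⟩ : order hp hq), e.injective ?_⟩
      erw [he, one_smul]

end Order

/-! ### Realizing a cubic form by explicit elements of its Hessian algebra. -/

section QuadraticAlgebra

variable {K : Type*} [Field K]

/-- If `Cᵢ` were `α³⁻ⁱβⁱι`, the long factor would be `(yα - xβ)³ι`. The chain relations suffice for
the resulting identities without knowing `ι`; where `yα - xβ` is invertible, this is how `ι` is
recovered. -/
theorem pow_mul_eq_of_chain {B : Type*} [CommRing B] {α β C₀ C₁ C₂ C₃ x y : B}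
    (h₁ : α * C₁ = β * C₀) (h₂ : α * C₂ = β * C₁) (h₃ : α * C₃ = β * C₂) :
    α ^ 3 * (y ^ 3 * C₀ - 3 * y ^ 2 * x * C₁ + 3 * y * x ^ 2 * C₂ - x ^ 3 * C₃) =
        (y * α - x * β) ^ 3 * C₀ ∧
    α ^ 2 * β * (y ^ 3 * C₀ - 3 * y ^ 2 * x * C₁ + 3 * y * x ^ 2 * C₂ - x ^ 3 * C₃) =
        (y * α - x * β) ^ 3 * C₁ ∧
    α * β ^ 2 * (y ^ 3 * C₀ - 3 * y ^ 2 * x * C₁ + 3 * y * x ^ 2 * C₂ - x ^ 3 * C₃) =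
        (y * α - x * β) ^ 3 * C₂ ∧
    β ^ 3 * (y ^ 3 * C₀ - 3 * y ^ 2 * x * C₁ + 3 * y * x ^ 2 * C₂ - x ^ 3 * C₃) =
        (y * α - x * β) ^ 3 * C₃ := by
  -- all monomials of degree three in `α, β` act through the same chain
  refine ⟨?_, ?_, ?_, ?_⟩
  · linear_combination (-3 * y ^ 2 * x * α ^ 2 + 3 * y * x ^ 2 * α * β - x ^ 3 * β ^ 2) * h₁ +
      (3 * y * x ^ 2 * α ^ 2 - x ^ 3 * α * β) * h₂ - x ^ 3 * α ^ 2 * h₃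
  · linear_combination (-y ^ 3 * α ^ 2) * h₁ + (3 * y * x ^ 2 * α * β - x ^ 3 * β ^ 2) * h₂ -
      x ^ 3 * α * β * h₃
  · linear_combination (-y ^ 3 * α * β) * h₁ + (-y ^ 3 * α ^ 2 + 3 * y ^ 2 * x * α * β) * h₂ -
      x ^ 3 * β ^ 2 * h₃
  · linear_combination (-y ^ 3 * β ^ 2) * h₁ + (-y ^ 3 * α * β + 3 * y ^ 2 * x * β ^ 2) * h₂ +
      (-y ^ 3 * α ^ 2 + 3 * y ^ 2 * x * α * β - 3 * y * x ^ 2 * β ^ 2) * h₃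

namespace CubicForm

variable (f : CubicForm K)

/-- The discriminant of the Hessian is `disc f`, so the Hessian is not the zero form. Three points
are enough to detect its coefficients, over any field. -/
theorem exists_hess_ne_zero (hf : f.disc ≠ 0) :
    ∃ x y : K, f.hess₀ * y ^ 2 - f.hess₁ * x * y + f.hess₂ * x ^ 2 ≠ 0 := by
  by_contra! h
  have h0 : f.hess₀ = 0 := by simpa using h 0 1
  have h2 : f.hess₂ = 0 := by simpa using h 1 0
  have h1 : f.hess₁ = 0 := by simpa [h0, h2] using h 1 1
  exact hf (by rw [disc_eq, h0, h1, h2]; ring)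

/-- The products of `ι` with the cubic monomials in `α, β`, where `im (ζ³ ι)` is the form `f`. -/
structure IsRealization (f : CubicForm K) (α β ι : f.Model) (s : K) : Prop where
  re_left : α.re = f.hess₀ * β.im - f.hess₁ * α.im
  re_right : β.re = -f.hess₂ * α.im
  det_eq : α.re * β.im - α.im * β.re = s
  ne_zero : s ≠ 0
  norm_eq : s ^ 3 * ι.norm = 1
  aaa : α ^ 3 * ι = ⟨f.b * f.hess₀ - f.a * f.hess₁, f.a⟩
  aab : α ^ 2 * β * ι = ⟨-(f.a * f.hess₂), f.b⟩
  abb : α * β ^ 2 * ι = ⟨-(f.b * f.hess₂), f.c⟩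
  bbb : β ^ 3 * ι = ⟨-(f.c * f.hess₂), f.d⟩

/-- The imaginary parts `x, y` of `α, β` are free as long as the resulting determinant `s` is
nonzero; the real parts are forced by `τα = h₀β` and `τβ = h₁β - h₂α`. The products `Cᵢ` must have
imaginary parts `a, b, c, d`, and their real parts are forced by the same relations. It remains to
find `ι` with `Cᵢ = α³⁻ⁱβⁱι`. -/
theorem exists_isRealization (hf : f.disc ≠ 0) : ∃ α β ι s, f.IsRealization α β ι s := by
  obtain ⟨x, y, hxy⟩ := f.exists_hess_ne_zero hf
  set s := f.hess₀ * y ^ 2 - f.hess₁ * x * y + f.hess₂ * x ^ 2 with hs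
  let α : f.Model := ⟨f.hess₀ * y - f.hess₁ * x, x⟩
  let β : f.Model := ⟨-f.hess₂ * x, y⟩
  let C₀ : f.Model := ⟨f.b * f.hess₀ - f.a * f.hess₁, f.a⟩
  let C₁ : f.Model := ⟨-(f.a * f.hess₂), f.b⟩
  let C₂ : f.Model := ⟨-(f.b * f.hess₂), f.c⟩
  let C₃ : f.Model := ⟨-(f.c * f.hess₂), f.d⟩
  have h₁ : α * C₁ = β * C₀ := by
    ext <;> simp [α, β, C₀, C₁] <;> simp only [hess₀, hess₁, hess₂] <;> ring
  have h₂ : α * C₂ = β * C₁ := by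
    ext <;> simp [α, β, C₁, C₂] <;> simp only [hess₀, hess₁, hess₂] <;> ring
  have h₃ : α * C₃ = β * C₂ := by
    ext <;> simp [α, β, C₂, C₃] <;> simp only [hess₀, hess₁, hess₂] <;> ring
  let X : f.Model := algebraMap K _ x
  let Y : f.Model := algebraMap K _ y
  have hXY : Y * α - X * β = algebraMap K _ s := by
    simp only [X, Y, QuadraticAlgebra.algebraMap_eq, α, β, hs]
    ext <;> simp <;> ring
  -- Since `yα - xβ = s`, this is what `s³ι` has to be.
  let P : f.Model := Y ^ 3 * C₀ - 3 * Y ^ 2 * X * C₁ + 3 * Y * X ^ 2 * C₂ - X ^ 3 * C₃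
  have hP : P = ⟨y ^ 3 * C₀.re - 3 * y ^ 2 * x * C₁.re + 3 * y * x ^ 2 * C₂.re - x ^ 3 * C₃.re,
      y ^ 3 * C₀.im - 3 * y ^ 2 * x * C₁.im + 3 * y * x ^ 2 * C₂.im - x ^ 3 * C₃.im⟩ := by
    ext <;> simp [P, X, Y, pow_succ]
  have hn : P.norm = s ^ 3 := by
    rw [hP, QuadraticAlgebra.norm_def]
    simp only [C₀, C₁, C₂, C₃, hs, hess₀, hess₁, hess₂]
    ring
  have hι : ∀ u : f.Model, u * ((s ^ 3)⁻¹ • P) = (s ^ 3)⁻¹ • (u * P) := fun u => mul_smul_comm _ _ _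
  have hsm : ∀ C : f.Model, (s ^ 3)⁻¹ • (algebraMap K f.Model s ^ 3 * C) = C := fun C => by
    rw [← map_pow, ← Algebra.smul_def, smul_smul, inv_mul_cancel₀ (pow_ne_zero 3 hxy), one_smul]
  obtain ⟨k₀, k₁, k₂, k₃⟩ := pow_mul_eq_of_chain (x := X) (y := Y) h₁ h₂ h₃
  rw [hXY] at k₀ k₁ k₂ k₃
  refine ⟨α, β, (s ^ 3)⁻¹ • P, s, rfl, rfl, ?_, hxy, ?_, ?_, ?_, ?_, ?_⟩
  · simp only [α, β, hs]
    ring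
  · rw [Algebra.smul_def, map_mul, QuadraticAlgebra.norm_algebraMap, hn]
    field_simp
  · rw [hι, k₀, hsm]
  · rw [hι, k₁, hsm]
  · rw [hι, k₂, hsm]
  · rw [hι, k₃, hsm]

end CubicForm

end QuadraticAlgebra

/-! ### Every nondegenerate form comes from a balanced quadruple. -/

section Realize

theorem zpow_mul_mem {R K : Type*} [CommRing R] [IsDedekindDomain R] [Field K] [Algebra R K]
    [IsFractionRing R K] {𝔞 : FractionalIdeal R⁰ K} (h𝔞 : 𝔞 ≠ 0) {m n k : ℤ} {x y : K}
    (hx : x ∈ 𝔞 ^ m) (hy : y ∈ 𝔞 ^ n) (h : m + n = k) : x * y ∈ 𝔞 ^ k := by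
  rw [← h, zpow_add₀ h𝔞]
  exact FractionalIdeal.mul_mem_mul hx hy

variable {R K : Type u} [CommRing R] [Field K] [Algebra R K] {𝔞 : FractionalIdeal R⁰ K}
  {A : OrientedQuadraticRing R K 𝔞} {f : CubicForm K}

open OrientedQuadraticRing

theorem span_decomp_eq_top (h𝔞 : 𝔞 ≠ 0) {α β : A.L} (h : A.wedgeK α β ≠ 0) :
    Submodule.span K (decomp 𝔞 α β : Set A.L) = ⊤ := by
  rw [eq_top_iff]
  rintro v -
  obtain ⟨x, y, rfl⟩ := exists_eq_smul_add_smul h v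
  obtain ⟨t, ht, ht0⟩ : ∃ t ∈ 𝔞, t ≠ 0 := by
    by_contra! h
    exact h𝔞 (FractionalIdeal.eq_zero_iff.2 h)
  have h1 : y • β = (y / t) • t • β := by
    rw [smul_smul, div_mul_cancel₀ _ ht0]
  rw [h1]
  exact Submodule.add_mem _
    (Submodule.smul_mem _ _ (Submodule.subset_span (left_mem_decomp _ _ _)))
    (Submodule.smul_mem _ _ (Submodule.subset_span (smul_right_mem_decomp _ _ ht)))

theorem wedgeK_realization {α β ι : f.Model} {s : K}
    (c : A.Chart (-(f.hess₀ * f.hess₂)) f.hess₁) (hr : f.IsRealization α β ι s) :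
    A.wedgeK (c.e.symm α) (c.e.symm β) = s := by
  rw [c.wedgeK_eq, AlgEquiv.apply_symm_apply, AlgEquiv.apply_symm_apply, hr.det_eq]

variable [IsDedekindDomain R] [IsFractionRing R K]

/-- Stability under `S` follows from `τα = h₀β` and `τβ = h₁β - h₂α`, the Hessian coefficients lying
in `R`, `𝔞⁻¹`, `𝔞⁻²`. -/
theorem isFractionalIdeal_realization (h𝔞 : 𝔞 ≠ 0) (hf : f.IsOfType 𝔞) {α β ι : f.Model} {s : K}
    (c : A.Chart (-(f.hess₀ * f.hess₂)) f.hess₁) (hr : f.IsRealization α β ι s) :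
    A.IsFractionalIdeal (decomp 𝔞 (c.e.symm α) (c.e.symm β)) := by
  have hw := wedgeK_realization c hr
  have hw0 : A.wedgeK (c.e.symm α) (c.e.symm β) ≠ 0 := hw ▸ hr.ne_zero
  refine ⟨fun a v hv => ?_, decomp_fg _ _, span_decomp_eq_top h𝔞 hw0⟩
  · obtain ⟨x, hx, y, hy, rfl⟩ := mem_decomp.1 hv
    obtain ⟨hr1, ht⟩ := (c.mem_lattice _).1 (A.one_tmul_mem_lattice a)
    set z : A.L := 1 ⊗ₜ a
    refine mem_decomp.2 ⟨(c.e z).re * x - (c.e z).im * y * f.hess₂,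
      mem_sub (one_mul_mem hr1 hx) (mem_sq_of_mem ht hy hf.hess₂_mem),
      (c.e z).re * y + (c.e z).im * (x * f.hess₀) + (c.e z).im * f.hess₁ * y,
      mem_add (mem_add (one_mul_mem hr1 hy) (mul_one_mem ht (one_mul_mem hx hf.hess₀_mem)))
        (one_mul_mem (mul_inv_mem ht (hf.hess₁_mem h𝔞)) hy), c.e.injective ?_⟩
    ext <;> simp [hr.re_left, hr.re_right] <;> ring

theorem mul_mul_mul_mem_realization (h𝔞 : 𝔞 ≠ 0) (hf : f.IsOfType 𝔞) {α β ι : f.Model} {s : K}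
    (c : A.Chart (-(f.hess₀ * f.hess₂)) f.hess₁) (hr : f.IsRealization α β ι s) {u v w : A.L}
    (hu : u ∈ decomp 𝔞 (c.e.symm α) (c.e.symm β)) (hv : v ∈ decomp 𝔞 (c.e.symm α) (c.e.symm β))
    (hw : w ∈ decomp 𝔞 (c.e.symm α) (c.e.symm β)) : u * v * w * c.e.symm ι ∈ A.lattice := by
  obtain ⟨x₀, hx₀, x₁, hx₁, rfl⟩ := mem_decomp.1 hu
  obtain ⟨y₀, hy₀, y₁, hy₁, rfl⟩ := mem_decomp.1 hv
  obtain ⟨z₀, hz₀, z₁, hz₁, rfl⟩ := mem_decomp.1 hw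
  have e : c.e ((x₀ • c.e.symm α + x₁ • c.e.symm β) * (y₀ • c.e.symm α + y₁ • c.e.symm β) *
      (z₀ • c.e.symm α + z₁ • c.e.symm β) * c.e.symm ι) =
      (x₀ * y₀ * z₀) • (α ^ 3 * ι) + (x₀ * y₀ * z₁ + x₀ * y₁ * z₀ + x₁ * y₀ * z₀) • (α ^ 2 * β * ι)
      + (x₀ * y₁ * z₁ + x₁ * y₀ * z₁ + x₁ * y₁ * z₀) • (α * β ^ 2 * ι)
      + (x₁ * y₁ * z₁) • (β ^ 3 * ι) := by
    simp only [map_mul, map_add, map_smul, AlgEquiv.apply_symm_apply]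
    simp only [Algebra.smul_def, map_mul, map_add]
    ring
  have h0 := hf.hess₀_mem
  have h1 := hf.hess₁_mem h𝔞
  have h2 := hf.hess₂_mem
  obtain ⟨ha, hb, hc, hd⟩ := hf
  -- Membership becomes a count of weights, weight `n` meaning membership in `𝔞ⁿ`. The coefficients
  -- `a, b, c, d` have weights `1, 0, -1, -2`, those of the Hessian `0, -1, -2`, coordinates along
  -- `α, β` weights `0, 1`. In the result every real term has weight `0` and every imaginary term
  -- weight `1`.
  rw [← zpow_zero 𝔞] at hx₀ hy₀ hz₀ hb h0
  rw [← zpow_one 𝔞] at hx₁ hy₁ hz₁ ha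
  rw [← zpow_neg_one] at hc h1
  have hsq : 𝔞⁻¹ ^ 2 = 𝔞 ^ (-2 : ℤ) := by
    rw [inv_pow, zpow_neg, zpow_ofNat]
  rw [hsq] at hd h2
  have m0 : x₀ * y₀ * z₀ ∈ 𝔞 ^ (0 : ℤ) :=
    zpow_mul_mem h𝔞 (zpow_mul_mem h𝔞 hx₀ hy₀ rfl) hz₀ rfl
  have m1 : x₀ * y₀ * z₁ + x₀ * y₁ * z₀ + x₁ * y₀ * z₀ ∈ 𝔞 ^ (1 : ℤ) :=
    mem_add (mem_add (zpow_mul_mem h𝔞 (zpow_mul_mem h𝔞 hx₀ hy₀ rfl) hz₁ rfl)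
      (zpow_mul_mem h𝔞 (zpow_mul_mem h𝔞 hx₀ hy₁ rfl) hz₀ rfl))
      (zpow_mul_mem h𝔞 (zpow_mul_mem h𝔞 hx₁ hy₀ rfl) hz₀ rfl)
  have m2 : x₀ * y₁ * z₁ + x₁ * y₀ * z₁ + x₁ * y₁ * z₀ ∈ 𝔞 ^ (2 : ℤ) :=
    mem_add (mem_add (zpow_mul_mem h𝔞 (zpow_mul_mem h𝔞 hx₀ hy₁ rfl) hz₁ rfl)
      (zpow_mul_mem h𝔞 (zpow_mul_mem h𝔞 hx₁ hy₀ rfl) hz₁ rfl))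
      (zpow_mul_mem h𝔞 (zpow_mul_mem h𝔞 hx₁ hy₁ rfl) hz₀ rfl)
  have m3 : x₁ * y₁ * z₁ ∈ 𝔞 ^ (3 : ℤ) :=
    zpow_mul_mem h𝔞 (zpow_mul_mem h𝔞 hx₁ hy₁ rfl) hz₁ rfl
  rw [c.mem_lattice, e, hr.aaa, hr.aab, hr.abb, hr.bbb, ← zpow_zero 𝔞]
  nth_rewrite 2 [← zpow_one 𝔞]
  simp only [QuadraticAlgebra.re_add, QuadraticAlgebra.im_add, QuadraticAlgebra.re_smul,
    QuadraticAlgebra.im_smul, smul_eq_mul]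
  exact ⟨mem_add (mem_add (mem_add
    (zpow_mul_mem h𝔞 m0 (mem_sub (zpow_mul_mem h𝔞 hb h0 rfl) (zpow_mul_mem h𝔞 ha h1 rfl)) rfl)
    (zpow_mul_mem h𝔞 m1 (mem_neg (zpow_mul_mem h𝔞 ha h2 rfl)) rfl))
    (zpow_mul_mem h𝔞 m2 (mem_neg (zpow_mul_mem h𝔞 hb h2 rfl)) rfl))
    (zpow_mul_mem h𝔞 m3 (mem_neg (zpow_mul_mem h𝔞 hc h2 rfl)) rfl),
    mem_add (mem_add (mem_add (zpow_mul_mem h𝔞 m0 ha rfl) (zpow_mul_mem h𝔞 m1 hb rfl))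
      (zpow_mul_mem h𝔞 m2 hc rfl)) (zpow_mul_mem h𝔞 m3 hd rfl)⟩

/-- Every nondegenerate form is the form of a balanced quadruple. -/
theorem exists_balancedQuadruple (h𝔞 : 𝔞 ≠ 0) (hf : f.IsOfType 𝔞) (hdisc : f.disc ≠ 0) :
    ∃ (Q : BalancedQuadruple R K 𝔞) (α β : Q.L), Q.IsBasis α β ∧ Q.form α β = f := by
  obtain ⟨α, β, ι, s, hr⟩ := f.exists_isRealization hdisc
  have hp : -(f.hess₀ * f.hess₂) ∈ 𝔞⁻¹ ^ 2 := mem_neg (one_mul_mem hf.hess₀_mem hf.hess₂_mem)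
  obtain ⟨A, ⟨c⟩⟩ := exists_orientedQuadraticRing h𝔞 hp (hf.hess₁_mem h𝔞)
  have hιu : IsUnit ι := by
    rw [QuadraticAlgebra.isUnit_iff_norm_isUnit]
    exact IsUnit.of_mul_eq_one_right _ hr.norm_eq
  obtain ⟨δ, hδ⟩ : ∃ δ : A.Lˣ, (↑δ⁻¹ : A.L) = c.e.symm ι := by
    obtain ⟨w, hw⟩ := hιu.map c.e.symm
    exact ⟨w⁻¹, by rw [inv_inv, hw]⟩
  have hwedge := wedgeK_realization c hr
  have hw0 : A.wedgeK (c.e.symm α) (c.e.symm β) ≠ 0 := hwedge ▸ hr.ne_zero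
  have hidx : moduleIndex K A.lattice (decomp 𝔞 (c.e.symm α) (c.e.symm β)) =
      Submodule.span R {s} := by
    have h1 : A.wedgeK 1 (c.e.symm ⟨0, 1⟩) = 1 := by simp [c.wedgeK_one]
    obtain ⟨b, hb, hb₁⟩ := exists_basis (A := A) (x := 1) (y := c.e.symm ⟨0, 1⟩)
      (by rw [h1]; exact one_ne_zero)
    obtain ⟨b', hb', hb₁'⟩ := exists_basis hw0
    have hlat : A.lattice = decomp 𝔞 (b 0) (b 1) := by
      rw [hb, hb₁]
      refine c.lattice_eq 0 fun t _ => ?_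
      rw [zero_mul]
      exact FractionalIdeal.zero_mem _
    have hdet := wedgeK_det b b'
    rw [hb, hb₁, hb', hb₁', h1, mul_one, hwedge] at hdet
    rw [hlat, ← hb', ← hb₁', moduleIndex_decomp h𝔞 h𝔞, mul_assoc, mul_inv_cancel₀ h𝔞, mul_one,
      ← hdet, FractionalIdeal.coe_spanSingleton]
  let Q : BalancedQuadruple R K 𝔞 :=
    { A with
      nondegenerate := c.isNondegenerate_iff.2 (by rwa [← CubicForm.disc_eq])
      I := decomp 𝔞 (c.e.symm α) (c.e.symm β)
      isFractionalIdeal := isFractionalIdeal_realization h𝔞 hf c hr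
      δ := δ
      s := Units.mk0 s hr.ne_zero
      cube_le := by
        rw [pow_succ, sq, Submodule.mul_le]
        intro m hm w hw
        have : m * w * c.e.symm ι ∈ A.lattice := by
          induction hm using Submodule.mul_induction_on' with
          | mem_mul_mem u hu v hv => exact mul_mul_mul_mem_realization h𝔞 hf c hr hu hv hw
          | add x _ y _ hx hy =>
            rw [add_mul, add_mul]
            exact A.lattice.add_mem hx hy
        refine ⟨_, this, ?_⟩
        rw [LinearMap.mulLeft_apply, ← hδ, mul_left_comm, Units.mul_inv, mul_one]
      index_eq := hidx
      cube_eq_norm := by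
        have h1 : Algebra.norm K (δ : A.L) * Algebra.norm K (↑δ⁻¹ : A.L) = 1 := by
          rw [← map_mul, Units.mul_inv, map_one]
        rw [hδ, c.norm_eq (c.e.symm ι), AlgEquiv.apply_symm_apply] at h1
        have h2 := hr.norm_eq
        have h0 : ι.norm ≠ 0 := right_ne_zero_of_mul_eq_one h2
        exact mul_right_cancel₀ h0 (h2.trans h1.symm) }
  refine ⟨Q, c.e.symm α, c.e.symm β, ⟨rfl, hwedge⟩, ?_⟩
  have hform := Q.form_eq_imForm c (c.e.symm α) (c.e.symm β)
  have hδ' : c.e (↑Q.δ⁻¹ : Q.L) = ι := by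
    change c.e (↑δ⁻¹ : A.L) = ι
    rw [hδ, AlgEquiv.apply_symm_apply]
  rw [hform, hδ', AlgEquiv.apply_symm_apply, AlgEquiv.apply_symm_apply]
  ext
  · simp only [imForm, hr.aaa]
  · simp only [imForm, hr.aab]
  · simp only [imForm, hr.abb]
  · simp only [imForm, hr.bbb]

end Realize

/-! ### The conjugate ideal, invertibility and projectivity. -/

section Dual

variable {K : Type*} [Field K] {h₀ h₁ h₂ s : K} {α β : QuadraticAlgebra K (-(h₀ * h₂)) h₁}

/-- These are `N(α) = sh₀`, `αβ̄ = sτ̄`, `βᾱ = sτ` and `N(β) = sh₂`, with `τ̄ = h₁ - τ`. -/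
theorem mul_star_eq (hs : α.re * β.im - α.im * β.re = s) (hα : α.re = h₀ * β.im - h₁ * α.im)
    (hβ : β.re = -h₂ * α.im) :
    α * star α = s • ⟨h₀, 0⟩ ∧ α * star β = s • ⟨h₁, -1⟩ ∧ β * star α = s • ⟨0, 1⟩ ∧
      β * star β = s • ⟨h₂, 0⟩ := by
  subst hs
  refine ⟨?_, ?_, ?_, ?_⟩ <;> ext <;> simp [hα, hβ] <;> ring

theorem omega_mul_star (hα : α.re = h₀ * β.im - h₁ * α.im) (hβ : β.re = -h₂ * α.im) (r u : K) :
    ⟨r, u⟩ * star α = (r + u * h₁) • star α - (u * h₀) • star β ∧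
      ⟨r, u⟩ * star β = (u * h₂) • star α + r • star β := by
  refine ⟨?_, ?_⟩ <;> ext <;> simp [hα, hβ] <;> ring

end Dual

namespace OrientedQuadraticRing

variable {R K : Type u} [CommRing R] [Field K] [Algebra R K] {𝔞 : FractionalIdeal R⁰ K}
  {A : OrientedQuadraticRing R K 𝔞} {p q : K}

/-- The nontrivial involution of `L`. -/
def Chart.conj (c : A.Chart p q) : A.L →ₐ[K] A.L where
  toFun x := c.e.symm (star (c.e x))
  map_one' := by simp
  map_mul' x y := by rw [map_mul, star_mul', map_mul]
  map_zero' := by simp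
  map_add' x y := by rw [map_add, star_add, map_add]
  commutes' k := by
    rw [AlgEquiv.commutes, ← AlgEquiv.commutes c.e.symm k]
    congr 1
    ext <;> simp

theorem Chart.e_conj (c : A.Chart p q) (x : A.L) : c.e (c.conj x) = star (c.e x) :=
  c.e.apply_symm_apply _

variable {f : CubicForm K} {α β : A.L} {s : K}
  {c : A.Chart (-(f.hess₀ * f.hess₂)) f.hess₁}

variable (c α β s) in
/-- The multiple by `s⁻¹` of the conjugate of `R α + 𝔞 β`. -/
def Chart.conjInv : Submodule R A.L := decomp 𝔞 (s⁻¹ • c.conj α) (s⁻¹ • c.conj β)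

/-- The coordinates of `α` and `β` in a chart that is adapted to the form `f`. -/
structure Chart.IsAdapted (c : A.Chart (-(f.hess₀ * f.hess₂)) f.hess₁) (α β : A.L) (s : K) :
    Prop where
  re_left : (c.e α).re = f.hess₀ * (c.e β).im - f.hess₁ * (c.e α).im
  re_right : (c.e β).re = -f.hess₂ * (c.e α).im
  wedgeK_eq : A.wedgeK α β = s
  ne_zero : s ≠ 0

namespace Chart.IsAdapted

/-- This makes `T = s⁻¹IĪ` explicit: the coefficients of the Hessian appear in the real part only,
and the imaginary part is a determinant. -/
theorem e_mul (h : c.IsAdapted α β s) (x y x' y' : K) :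
    c.e ((x • α + y • β) * (x' • s⁻¹ • c.conj α + y' • s⁻¹ • c.conj β)) =
      ⟨x * x' * f.hess₀ + x * y' * f.hess₁ + y * y' * f.hess₂, y * x' - x * y'⟩ := by
  obtain ⟨h00, h01, h10, h11⟩ := mul_star_eq ((c.wedgeK_eq α β).symm.trans h.wedgeK_eq)
    h.re_left h.re_right
  have key : ∀ z w : f.Model, z * w = s • (s⁻¹ • (z * w)) := fun z w => by
    rw [smul_smul, mul_inv_cancel₀ h.ne_zero, one_smul]
  have hc : ∀ {z w : f.Model}, z = s • w → s⁻¹ • z = w := fun hz => by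
    rw [hz, smul_smul, inv_mul_cancel₀ h.ne_zero, one_smul]
  have e : c.e ((x • α + y • β) * (x' • s⁻¹ • c.conj α + y' • s⁻¹ • c.conj β)) =
      (x * x') • s⁻¹ • (c.e α * star (c.e α)) + (x * y') • s⁻¹ • (c.e α * star (c.e β)) +
      (y * x') • s⁻¹ • (c.e β * star (c.e α)) + (y * y') • s⁻¹ • (c.e β * star (c.e β)) := by
    simp only [map_mul, map_add, map_smul, e_conj]
    simp only [Algebra.smul_def, map_mul]
    ring
  rw [e, hc h00, hc h01, hc h10, hc h11]
  ext
  · simp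
  · simp
    ring

/-- Used with `𝔤 = R` to show `T ⊆ S`, and with `𝔤 = 𝔭` when `𝔭` contains the Hessian. -/
theorem e_mem_of_mem_mul (h : c.IsAdapted α β s) {𝔤 : FractionalIdeal R⁰ K} (h₀ : f.hess₀ ∈ 𝔤)
    (h₁ : ∀ t ∈ 𝔞, t * f.hess₁ ∈ 𝔤) (h₂ : ∀ t ∈ 𝔞, ∀ t' ∈ 𝔞, t * t' * f.hess₂ ∈ 𝔤) {m : A.L}
    (hm : m ∈ decomp 𝔞 α β * c.conjInv α β s) : (c.e m).re ∈ 𝔤 ∧ (c.e m).im ∈ 𝔞 := by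
  induction hm using Submodule.mul_induction_on' with
  | mem_mul_mem v hv w hw =>
    obtain ⟨x, hx, y, hy, rfl⟩ := mem_decomp.1 hv
    obtain ⟨x', hx', y', hy', rfl⟩ := mem_decomp.1 hw
    rw [h.e_mul]
    refine ⟨mem_add (mem_add ?_ (h₁ _ (one_mul_mem hx hy')) ) (h₂ y hy y' hy'),
      mem_sub (mul_one_mem hy hx') (one_mul_mem hx hy')⟩
    exact one_mul_mem (one_mul_mem hx hx') h₀
  | add v _ w _ hv hw =>
    rw [map_add]
    exact ⟨mem_add hv.1 hw.1, mem_add hv.2 hw.2⟩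

theorem symm_mem_mul (h : c.IsAdapted α β s) {x y x' y' : K}
    (hx : x ∈ (1 : FractionalIdeal R⁰ K)) (hy : y ∈ 𝔞) (hx' : x' ∈ (1 : FractionalIdeal R⁰ K))
    (hy' : y' ∈ 𝔞) {z : f.Model} (hz : z = ⟨x * x' * f.hess₀ + x * y' * f.hess₁ + y * y' * f.hess₂,
      y * x' - x * y'⟩) : c.e.symm z ∈ decomp 𝔞 α β * c.conjInv α β s := by
  rw [hz, ← h.e_mul, AlgEquiv.symm_apply_apply]
  exact Submodule.mul_mem_mul (mem_decomp.2 ⟨x, hx, y, hy, rfl⟩)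
    (mem_decomp.2 ⟨x', hx', y', hy', rfl⟩)

theorem symm_im_mem_mul (h : c.IsAdapted α β s) {t : K} (ht : t ∈ 𝔞) :
    c.e.symm ⟨0, t⟩ ∈ decomp 𝔞 α β * c.conjInv α β s :=
  h.symm_mem_mul (FractionalIdeal.zero_mem _) ht one_mem_one (FractionalIdeal.zero_mem _) (by simp)

theorem symm_hess₀_mem_mul (h : c.IsAdapted α β s) :
    c.e.symm ⟨f.hess₀, 0⟩ ∈ decomp 𝔞 α β * c.conjInv α β s :=
  h.symm_mem_mul one_mem_one (FractionalIdeal.zero_mem _) one_mem_one (FractionalIdeal.zero_mem _)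
    (by simp)

theorem symm_hess₁_mem_mul (h : c.IsAdapted α β s) {t : K} (ht : t ∈ 𝔞) :
    c.e.symm ⟨t * f.hess₁, 0⟩ ∈ decomp 𝔞 α β * c.conjInv α β s := by
  have h1 : c.e.symm ⟨t * f.hess₁, -t⟩ ∈ decomp 𝔞 α β * c.conjInv α β s :=
    h.symm_mem_mul one_mem_one (FractionalIdeal.zero_mem _) (FractionalIdeal.zero_mem _) ht
      (by simp)
  have h2 := Submodule.add_mem _ h1 (h.symm_im_mem_mul ht)
  rw [← map_add] at h2
  convert h2 using 2
  ext <;> simp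

theorem symm_hess₂_mem_mul (h : c.IsAdapted α β s) {t t' : K} (ht : t ∈ 𝔞) (ht' : t' ∈ 𝔞) :
    c.e.symm ⟨t * t' * f.hess₂, 0⟩ ∈ decomp 𝔞 α β * c.conjInv α β s :=
  h.symm_mem_mul (FractionalIdeal.zero_mem _) ht (FractionalIdeal.zero_mem _) ht' (by simp)

/-- The ideal `T ∩ R` contains `h₀`, `𝔞h₁` and `𝔞²h₂`. A maximal ideal containing it would
contradict projectivity. -/
theorem one_mem_mul_of_isProjective (h : c.IsAdapted α β s) [IsDedekindDomain R]
    [IsFractionRing R K] (hf : f.IsOfType 𝔞) (h𝔞 : 𝔞 ≠ 0) (hproj : f.IsProjective 𝔞) :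
    (1 : A.L) ∈ decomp 𝔞 α β * c.conjInv α β s := by
  set T := decomp 𝔞 α β * c.conjInv α β s with hT
  let N : Ideal R := T.comap (Algebra.linearMap R A.L)
  have hmem : ∀ {r : R} {k : K}, algebraMap R K r = k → c.e.symm ⟨k, 0⟩ ∈ T → r ∈ N := by
    rintro r k rfl hr
    rw [Submodule.mem_comap, Algebra.linearMap_apply, IsScalarTower.algebraMap_apply R K A.L,
      ← AlgEquiv.commutes c.e.symm]
    exact hr
  by_cases hN : N = ⊤
  · have : (1 : R) ∈ N := hN ▸ Submodule.mem_top
    rw [Submodule.mem_comap, Algebra.linearMap_apply, map_one] at this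
    exact this
  · exfalso
    obtain ⟨𝔭, hmax, hle⟩ := Ideal.exists_le_maximal N hN
    have hk : ∀ {k : K}, k ∈ (1 : FractionalIdeal R⁰ K) → c.e.symm ⟨k, 0⟩ ∈ T →
        k ∈ (𝔭 : FractionalIdeal R⁰ K) := by
      intro k hk hT
      obtain ⟨r, rfl⟩ := (FractionalIdeal.mem_one_iff R⁰).1 hk
      exact (FractionalIdeal.mem_coeIdeal _).2 ⟨r, hle (hmem rfl hT), rfl⟩
    refine hproj 𝔭 hmax.isPrime ⟨?_, ?_, ?_⟩
    · rw [FractionalIdeal.spanSingleton_le_iff_mem]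
      exact hk hf.hess₀_mem h.symm_hess₀_mem_mul
    · rw [FractionalIdeal.spanSingleton_mul_le_iff]
      intro t ht
      have h1 := hk (mul_inv_mem ht (hf.hess₁_mem h𝔞)) (h.symm_hess₁_mem_mul ht)
      convert mem_neg h1 using 1
      rw [CubicForm.hess₁]
      ring
    · rw [mul_comm, sq, FractionalIdeal.mul_le]
      intro t ht u hu
      obtain ⟨u, rfl⟩ := (FractionalIdeal.mem_spanSingleton R⁰).1 hu
      refine FractionalIdeal.mul_induction_on ht (fun i hi j hj => ?_) fun x y hx hy => ?_
      · rw [mul_smul_comm]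
        exact Submodule.smul_mem _ _ (hk (mem_sq_of_mem hi hj hf.hess₂_mem)
          (h.symm_hess₂_mem_mul hi hj))
      · rw [add_mul]
        exact mem_add hx hy

theorem isFractionalIdeal_conjInv (h : c.IsAdapted α β s) [IsDedekindDomain R]
    [IsFractionRing R K] (hf : f.IsOfType 𝔞) (h𝔞 : 𝔞 ≠ 0) :
    A.IsFractionalIdeal (c.conjInv α β s) := by
  refine ⟨fun a v hv => ?_, decomp_fg _ _, span_decomp_eq_top h𝔞 ?_⟩
  · obtain ⟨x, hx, y, hy, rfl⟩ := mem_decomp.1 hv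
    obtain ⟨hr1, ht⟩ := (c.mem_lattice _).1 (A.one_tmul_mem_lattice a)
    set z : A.L := 1 ⊗ₜ a
    obtain ⟨e1, e2⟩ := omega_mul_star h.re_left h.re_right (c.e z).re (c.e z).im
    refine mem_decomp.2 ⟨x * (c.e z).re + x * ((c.e z).im * f.hess₁) + (c.e z).im * y * f.hess₂,
      mem_add (mem_add (one_mul_mem hx hr1)
        (one_mul_mem hx (mul_inv_mem ht (hf.hess₁_mem h𝔞)))) (mem_sq_of_mem ht hy hf.hess₂_mem),
      y * (c.e z).re - x * ((c.e z).im * f.hess₀),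
      mem_sub (mul_one_mem hy hr1) (one_mul_mem hx (mul_one_mem ht hf.hess₀_mem)),
      c.e.injective ?_⟩
    have e3 : c.e (z * (x • s⁻¹ • c.conj α + y • s⁻¹ • c.conj β)) =
        x • s⁻¹ • (c.e z * star (c.e α)) + y • s⁻¹ • (c.e z * star (c.e β)) := by
      simp only [map_mul, map_add, map_smul, e_conj, mul_add, mul_smul_comm]
    have hz : c.e z = ⟨(c.e z).re, (c.e z).im⟩ := rfl
    rw [e3, hz, e1, e2]
    simp only [map_add, map_smul, e_conj]
    simp only [Algebra.smul_def, map_mul, map_add, map_sub]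
    ring
  · rw [map_smul, map_smul, LinearMap.smul_apply, c.wedgeK_eq, e_conj, e_conj]
    have h1 := h.wedgeK_eq
    rw [c.wedgeK_eq] at h1
    have h2 : (star (c.e α)).re * (star (c.e β)).im - (star (c.e α)).im * (star (c.e β)).re =
        -s := by
      rw [← h1]
      simp
      ring
    rw [h2]
    simp [h.ne_zero]

theorem isInvertible_of_isProjective (h : c.IsAdapted α β s) [IsDedekindDomain R]
    [IsFractionRing R K] (hf : f.IsOfType 𝔞) (h𝔞 : 𝔞 ≠ 0) (hproj : f.IsProjective 𝔞)
    (hI : A.IsFractionalIdeal (decomp 𝔞 α β)) : A.IsInvertible (decomp 𝔞 α β) := by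
  refine ⟨hI, c.conjInv α β s, h.isFractionalIdeal_conjInv hf h𝔞, le_antisymm ?_ ?_⟩
  · intro m hm
    exact (c.mem_lattice m).2 (h.e_mem_of_mem_mul hf.hess₀_mem
      (fun t ht => mul_inv_mem ht (hf.hess₁_mem h𝔞))
      (fun t ht t' ht' => mem_sq_of_mem ht ht' hf.hess₂_mem) hm)
  · intro m hm
    obtain ⟨hr, ht⟩ := (c.mem_lattice m).1 hm
    obtain ⟨r, hr⟩ := (FractionalIdeal.mem_one_iff R⁰).1 hr
    have h1 := Submodule.add_mem _
      (Submodule.smul_mem _ r (h.one_mem_mul_of_isProjective hf h𝔞 hproj)) (h.symm_im_mem_mul ht)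
    convert h1 using 1
    apply c.e.injective
    rw [← algebraMap_smul K r (1 : A.L), map_add, map_smul, map_one, AlgEquiv.apply_symm_apply, hr]
    ext <;> simp

/-- If `IJ = S`, then `s⁻¹Ī · sJ̄ = S̄ ⊆ S`, because the trace of `tτ` is `th₁ ∈ R` for `t ∈ 𝔞`.
Thus `sJ̄` serves as inverse. -/
theorem exists_conjInv_inverse (h : c.IsAdapted α β s) [IsDedekindDomain R]
    [IsFractionRing R K] (h𝔞 : 𝔞 ≠ 0) {J : Submodule R A.L} (hJ : decomp 𝔞 α β * J = A.lattice) :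
    ∃ J' : Submodule R A.L, c.conjInv α β s * J' ≤ A.lattice ∧ 1 ∈ c.conjInv α β s * J' := by
  obtain ⟨l, hl⟩ : ∃ l : K → A.L →ₗ[K] A.L, ∀ k x, l k x = k • c.conj x :=
    ⟨fun k => k • c.conj.toLinearMap, fun _ _ => rfl⟩
  have hI : c.conjInv α β s = (decomp 𝔞 α β).map ((l s⁻¹).restrictScalars R) := by
    rw [map_decomp, hl, hl, conjInv]
  have hmul : ∀ x y, l s⁻¹ x * l s y = c.conj (x * y) := fun x y => by
    rw [hl, hl, smul_mul_smul_comm, inv_mul_cancel₀ h.ne_zero, one_smul, map_mul]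
  have hconj : ∀ x ∈ A.lattice, c.conj x ∈ A.lattice := by
    intro x hx
    obtain ⟨h0, h1⟩ := (c.mem_lattice x).1 hx
    obtain ⟨-, hq⟩ := c.coeff_mem h𝔞
    rw [c.mem_lattice, e_conj]
    simp only [QuadraticAlgebra.re_star, QuadraticAlgebra.im_star]
    exact ⟨mem_add h0 (mul_comm f.hess₁ _ ▸ mul_inv_mem h1 hq), mem_neg h1⟩
  refine ⟨J.map ((l s).restrictScalars R), ?_, ?_⟩
  · rw [hI, Submodule.mul_le]
    rintro _ ⟨x, hx, rfl⟩ _ ⟨y, hy, rfl⟩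
    rw [LinearMap.restrictScalars_apply, LinearMap.restrictScalars_apply, hmul]
    exact hconj _ (hJ ▸ Submodule.mul_mem_mul hx hy)
  · have key : ∀ m ∈ decomp 𝔞 α β * J,
        c.conj m ∈ c.conjInv α β s * J.map ((l s).restrictScalars R) := by
      intro m hm
      induction hm using Submodule.mul_induction_on' with
      | mem_mul_mem x hx y hy =>
        rw [← hmul, hI]
        exact Submodule.mul_mem_mul (Submodule.mem_map_of_mem hx) (Submodule.mem_map_of_mem hy)
      | add x _ y _ hx hy =>
        rw [map_add]
        exact Submodule.add_mem _ hx hy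
    rw [← map_one c.conj]
    refine key 1 ?_
    rw [hJ, c.mem_lattice, map_one]
    exact ⟨one_mem_one, FractionalIdeal.zero_mem _⟩

/-- If `𝔭` contains the Hessian, then `T² ⊆ 𝔭T`. As `T` is a product of two invertible ideals,
cancelling gives `T ⊆ 𝔭S`. But `𝔞τ ⊆ T`, whence `𝔞 ⊆ 𝔭𝔞`, which is absurd. -/
theorem isProjective_of_isInvertible (h : c.IsAdapted α β s) [IsDedekindDomain R]
    [IsFractionRing R K] (h𝔞 : 𝔞 ≠ 0) (hI : A.IsInvertible (decomp 𝔞 α β)) :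
    f.IsProjective 𝔞 := by
  obtain ⟨-, J, -, hJ⟩ := hI
  obtain ⟨J', hJ'le, hJ'one⟩ := h.exists_conjInv_inverse h𝔞 hJ
  rintro 𝔭 h𝔭 ⟨h₀, h₁, h₂⟩
  rw [FractionalIdeal.spanSingleton_le_iff_mem] at h₀
  replace h₁ : ∀ t ∈ 𝔞, t * f.hess₁ ∈ (𝔭 : FractionalIdeal R⁰ K) := fun t ht => by
    have := mem_neg (FractionalIdeal.spanSingleton_mul_le_iff.1 h₁ t ht)
    convert this using 1
    rw [CubicForm.hess₁]
    ring
  replace h₂ : ∀ t ∈ 𝔞, ∀ t' ∈ 𝔞, t * t' * f.hess₂ ∈ (𝔭 : FractionalIdeal R⁰ K) :=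
    fun t ht t' ht' => by
      have := FractionalIdeal.spanSingleton_mul_le_iff.1 h₂ (t * t')
        (by rw [sq]; exact FractionalIdeal.mul_mem_mul ht ht')
      rwa [mul_comm] at this
  have h₀' : f.hess₀ ∈ (𝔭 : FractionalIdeal R⁰ K) := h₀
  set T := decomp 𝔞 α β * c.conjInv α β s with hT
  let P : Submodule R A.L := Submodule.map (Algebra.linearMap R A.L) 𝔭
  have hP : ∀ {k : K} {z : A.L}, k ∈ (𝔭 : FractionalIdeal R⁰ K) → z ∈ T → k • z ∈ P * T := by
    intro k z hk hz
    obtain ⟨r, hr, rfl⟩ := (FractionalIdeal.mem_coeIdeal _).1 hk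
    rw [algebraMap_smul, Algebra.smul_def]
    exact Submodule.mul_mem_mul (Submodule.mem_map_of_mem hr) hz
  have hTT : T * T ≤ P * T := by
    rw [Submodule.mul_le]
    intro m hm n hn
    obtain ⟨hm0, hm1⟩ := h.e_mem_of_mem_mul h₀' h₁ h₂ hm
    obtain ⟨hn0, hn1⟩ := h.e_mem_of_mem_mul h₀' h₁ h₂ hn
    -- This is `mn` expanded by `τ² = -h₀h₂ + h₁τ` and grouped so that each term is an element of
    -- `𝔭` times an element of `T`.
    have e : m * n = (c.e m).re • n + (c.e n).re • c.e.symm ⟨0, (c.e m).im⟩ +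
        ((c.e m).im * f.hess₁) • c.e.symm ⟨0, (c.e n).im⟩ -
        f.hess₀ • c.e.symm ⟨(c.e m).im * (c.e n).im * f.hess₂, 0⟩ := by
      apply c.e.injective
      simp only [map_mul, map_add, map_sub, map_smul, AlgEquiv.apply_symm_apply]
      ext <;> simp <;> ring
    rw [e]
    exact Submodule.sub_mem _ (Submodule.add_mem _ (Submodule.add_mem _ (hP hm0 hn)
      (hP hn0 (h.symm_im_mem_mul hm1))) (hP (h₁ _ hm1) (h.symm_im_mem_mul hn1)))
      (hP h₀' (h.symm_hess₂_mem_mul hm1 hn1))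
  have hone : (1 : A.L) ∈ T * (J * J') := by
    rw [hT, mul_mul_mul_comm, hJ, ← one_mul (1 : A.L)]
    exact Submodule.mul_mem_mul ((c.mem_lattice 1).2 (by simp [FractionalIdeal.zero_mem])) hJ'one
  have hle : T * (J * J') ≤ A.lattice := by
    rw [hT, mul_mul_mul_comm, hJ, Submodule.mul_le]
    exact fun x hx y hy => mul_mem_lattice hx (hJ'le hy)
  have hTP : T ≤ P * A.lattice := by
    intro m hm
    have h1 : m * 1 ∈ T * (T * (J * J')) := Submodule.mul_mem_mul hm hone
    rw [mul_one, ← mul_assoc] at h1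
    have h2 := mul_le_mul' hTT le_rfl h1
    rw [mul_assoc] at h2
    exact mul_le_mul' le_rfl hle h2
  have him : ∀ m ∈ P * A.lattice, (c.e m).im ∈ (𝔭 : FractionalIdeal R⁰ K) * 𝔞 := by
    intro m hm
    induction hm using Submodule.mul_induction_on' with
    | mem_mul_mem x hx y hy =>
      obtain ⟨r, hr, rfl⟩ := hx
      rw [Algebra.linearMap_apply, ← Algebra.smul_def, ← algebraMap_smul K r y, map_smul,
        QuadraticAlgebra.im_smul]
      exact FractionalIdeal.mul_mem_mul ((FractionalIdeal.mem_coeIdeal _).2 ⟨r, hr, rfl⟩)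
        ((c.mem_lattice y).1 hy).2
    | add x _ y _ hx hy =>
      rw [map_add]
      exact mem_add hx hy
  have h𝔞le : 1 * 𝔞 ≤ (𝔭 : FractionalIdeal R⁰ K) * 𝔞 := fun t ht => by
    rw [one_mul] at ht
    have := him _ (hTP (h.symm_im_mem_mul ht))
    rwa [AlgEquiv.apply_symm_apply] at this
  have h1 : (1 : FractionalIdeal R⁰ K) ≤ 𝔭 := by
    have := mul_le_mul_left h𝔞le 𝔞⁻¹
    rwa [mul_assoc, mul_assoc, mul_inv_cancel₀ h𝔞, mul_one, mul_one] at this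
  obtain ⟨r, hr, hr1⟩ := (FractionalIdeal.mem_coeIdeal _).1 (h1 one_mem_one)
  rw [← map_one (algebraMap R K)] at hr1
  exact h𝔭.ne_top ((Ideal.eq_top_iff_one _).2 (IsFractionRing.injective R K hr1 ▸ hr))

end Chart.IsAdapted

end OrientedQuadraticRing

/-! ### The map on classes and its properties. -/

section Parametrization

namespace BalancedQuadruple

open OrientedQuadraticRing

variable {R K : Type u} [CommRing R] [IsDedekindDomain R] [Field K] [Algebra R K]
  [IsFractionRing R K] {𝔞 : FractionalIdeal R⁰ K} {Q : BalancedQuadruple R K 𝔞} {α β : Q.L}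

theorem IsBasis.disc_form_ne_zero (h𝔞 : 𝔞 ≠ 0) (hb : Q.IsBasis α β) : (Q.form α β).disc ≠ 0 := by
  obtain ⟨c, -, -⟩ := hb.exists_chart h𝔞 rfl
  rw [CubicForm.disc_eq]
  exact c.isNondegenerate_iff.1 Q.nondegenerate

theorem IsBasis.hasDiscr (h𝔞 : 𝔞 ≠ 0) (hb : Q.IsBasis α β) : Q.HasDiscr (Q.form α β).disc := by
  obtain ⟨c, -, -⟩ := hb.exists_chart h𝔞 rfl
  rw [CubicForm.disc_eq]
  exact c.hasDiscr

theorem IsBasis.isInvertible_iff (h𝔞 : 𝔞 ≠ 0) (hb : Q.IsBasis α β) :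
    Q.IsInvertible Q.I ↔ (Q.form α β).IsProjective 𝔞 := by
  obtain ⟨c, h1, h2⟩ := hb.exists_chart h𝔞 rfl
  have hc : c.IsAdapted α β (Q.s : K) := ⟨h1, h2, hb.2, Q.s.ne_zero⟩
  have hI := Q.isFractionalIdeal
  rw [hb.1] at hI ⊢
  exact ⟨hc.isProjective_of_isInvertible h𝔞, fun h =>
    hc.isInvertible_of_isProjective (hb.form_isOfType h𝔞) h𝔞 h hI⟩

/-- The form of a basis, as an element of `V_𝔞`. -/
def IsBasis.nondegForm (h𝔞 : 𝔞 ≠ 0) (hb : Q.IsBasis α β) : NondegForm 𝔞 :=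
  ⟨Q.form α β, hb.form_isOfType h𝔞, hb.disc_form_ne_zero h𝔞⟩

variable (Q) in
/-- The orbit of the forms of a balanced quadruple. -/
def orbit (h𝔞 : 𝔞 ≠ 0) : Quotient (orbitSetoid 𝔞) :=
  Quotient.mk _ ((Q.exists_isBasis h𝔞).choose_spec.choose_spec.nondegForm h𝔞)

theorem IsBasis.mk_nondegForm_eq (h𝔞 : 𝔞 ≠ 0) {α' β' : Q.L} (hb : Q.IsBasis α β)
    (hb' : Q.IsBasis α' β') : (Quotient.mk (orbitSetoid 𝔞) (hb.nondegForm h𝔞)) =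
      Quotient.mk _ (hb'.nondegForm h𝔞) := by
  obtain ⟨g, hg, h⟩ := hb'.exists_smul_form_eq h𝔞 hb
  exact Quotient.sound ⟨⟨g, hg⟩, h⟩

theorem IsBasis.orbit_eq (h𝔞 : 𝔞 ≠ 0) (hb : Q.IsBasis α β) :
    Q.orbit h𝔞 = Quotient.mk _ (hb.nondegForm h𝔞) :=
  IsBasis.mk_nondegForm_eq h𝔞 _ hb

/-- Acting on the basis by `SL(R ⊕ 𝔞)` reaches every form in the orbit on the nose. Equality of
orbits thereby becomes equality of forms. -/
theorem exists_isBasis_of_orbit_eq (h𝔞 : 𝔞 ≠ 0) {f : NondegForm 𝔞}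
    (h : Q.orbit h𝔞 = Quotient.mk _ f) : ∃ α β, Q.IsBasis α β ∧ Q.form α β = f.1 := by
  obtain ⟨α, β, hb⟩ := Q.exists_isBasis h𝔞
  rw [hb.orbit_eq h𝔞] at h
  obtain ⟨g, hg⟩ := Quotient.exact h.symm
  exact ⟨_, _, hb.smul g.2, (form_smul g.1).trans hg⟩

theorem Equivalent.orbit_eq (h𝔞 : 𝔞 ≠ 0) {Q' : BalancedQuadruple R K 𝔞} (h : Q.Equivalent Q') :
    Q.orbit h𝔞 = Q'.orbit h𝔞 := by
  obtain ⟨α, β, hb⟩ := Q.exists_isBasis h𝔞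
  obtain ⟨α', β', hb', hf⟩ := h.exists_isBasis h𝔞 hb
  rw [hb.orbit_eq h𝔞, hb'.orbit_eq h𝔞]
  exact congrArg _ (Subtype.ext hf.symm)

/-- The map from classes of balanced quadruples to orbits of nondegenerate forms. -/
def orbitMap (h𝔞 : 𝔞 ≠ 0) : Quotient (setoid R K 𝔞) → Quotient (orbitSetoid 𝔞) :=
  Quotient.lift (fun Q => Q.orbit h𝔞) fun _ _ h => Equivalent.orbit_eq h𝔞 h

theorem orbitMap_bijective (h𝔞 : 𝔞 ≠ 0) :
    Function.Bijective (orbitMap (R := R) (K := K) h𝔞) := by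
  refine ⟨?_, ?_⟩
  · rintro ⟨Q⟩ ⟨Q'⟩ (h : Q.orbit h𝔞 = Q'.orbit h𝔞)
    obtain ⟨α, β, hb⟩ := Q'.exists_isBasis h𝔞
    rw [hb.orbit_eq h𝔞] at h
    obtain ⟨α', β', hb', hf⟩ := exists_isBasis_of_orbit_eq h𝔞 h
    exact Quotient.sound (equivalent_of_form_eq h𝔞 hb' hb hf rfl)
  · rintro ⟨f⟩
    obtain ⟨Q, α, β, hb, hf⟩ := exists_balancedQuadruple h𝔞 f.2.1 f.2.2
    exact ⟨Quotient.mk _ Q, (hb.orbit_eq h𝔞).trans (congrArg _ (Subtype.ext hf))⟩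

end BalancedQuadruple

end Parametrization

end CubicParam

end

theorem mainTheorem2 {R K : Type u} [CommRing R] [IsDedekindDomain R] [Field K] [Algebra R K]
    [IsFractionRing R K] (hchar : ringChar R ≠ 3)
    (𝔞 : FractionalIdeal (nonZeroDivisors R) K) (h𝔞 : 𝔞 ≠ 0) :
    -- every balanced quadruple admits a decomposition of its ideal as used to define the map
    (∀ Q : CubicParam.BalancedQuadruple R K 𝔞, ∃ α β : Q.L, Q.IsBasis α β) ∧
    ∃ Φ : Quotient (CubicParam.BalancedQuadruple.setoid R K 𝔞) →
        Quotient (CubicParam.orbitSetoid 𝔞),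
      -- `Φ` sends the class of a quadruple to the orbit of its form, for every choice of basis
      (∀ (Q : CubicParam.BalancedQuadruple R K 𝔞) (α β : Q.L), Q.IsBasis α β →
        ∃ h : (Q.form α β).IsOfType 𝔞 ∧ (Q.form α β).disc ≠ 0,
          Φ (Quotient.mk _ Q) = Quotient.mk _ ⟨Q.form α β, h⟩) ∧
      Function.Bijective Φ ∧
      (∀ (Q : CubicParam.BalancedQuadruple R K 𝔞) (f : CubicParam.NondegForm 𝔞),
        Φ (Quotient.mk _ Q) = Quotient.mk _ f →
          Q.HasDiscr f.1.disc ∧ (Q.IsInvertible Q.I ↔ f.1.IsProjective 𝔞)) := by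
  refine ⟨fun Q => Q.exists_isBasis h𝔞, CubicParam.BalancedQuadruple.orbitMap h𝔞,
    fun Q α β hb => ⟨⟨hb.form_isOfType h𝔞, hb.disc_form_ne_zero h𝔞⟩, hb.orbit_eq h𝔞⟩,
    CubicParam.BalancedQuadruple.orbitMap_bijective h𝔞, fun Q f h => ?_⟩
  obtain ⟨α, β, hb, hf⟩ := CubicParam.BalancedQuadruple.exists_isBasis_of_orbit_eq h𝔞 h
  rw [← hf]
  exact ⟨hb.hasDiscr h𝔞, hb.isInvertible_iff h𝔞⟩
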